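/- **Setting.** Inner products are linear in the first argument. Let $H,\widehat H$ be finite-dimensional complex Hilbert spaces, $H_0=H\oplus\widehat H$, $\mathbf H=H\oplus\widehat H\oplus H$, $\widehat\nu=\dim\widehat H$, and $J(h,\widehat h,h')=(-h',i\widehat h,h)$ on $\mathbf H$. Let $\mathcal I=[a,b)$ or $[a,b]$ be a real interval, $-\infty<a<b\le\infty$ (a finite $b$ may or may not belong to $\mathcal I$), and let $B,\Delta$ be functions on $\mathcal I$ with values in the operators on $\mathbf H$, integrable on each $[a,\beta]\subset\mathcal I$, with $B=B^*$ and $\Delta\ge0$ a.e. Assume that the system $Jy'-By=\Delta f$ is definite: if $y$ is locally absolutely continuous, $Jy'-By=\lambda\Delta y$ a.e. for some $\lambda\in\mathbb C$ and $\Delta y=0$ a.e., then $y=0$ on $\mathcal I$. Let $\mathcal L^2_\Delta(\mathcal I)$ be the space of measurable $f:\mathcal I\to\mathbf H$ with $\int_{\mathcal I}(\Delta f,f)\,dt<\infty$, with the semi-inner product $(f,g)_\Delta=\int_{\mathcal I}(\Delta f,g)\,dt$; let $L^2_\Delta(\mathcal I)$ be the Hilbert space of its equivalence classes and $\pi$ the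 quotient map. Put $$t_{\max}=\{\{y,f\}\in\mathcal L^2_\Delta(\mathcal I)^2:\ y\in AC(\mathcal I;\mathbf H),\ Jy'-By=\Delta f\ \text{a.e.}\},\quad T_{\max}=(\pi\oplus\pi)t_{\max},$$ $$[y,z]_b=\lim_{t\uparrow b}(Jy(t),z(t))\quad (y,z\in\operatorname{dom}t_{\max}),$$ $$t_{\min}=\{\{y,f\}\in t_{\max}:\ y(a)=0,\ [y,z]_b=0\ \text{for all } z\in\operatorname{dom} t_{\max}\},\quad T_{\min}=(\pi\oplus\pi)t_{\min}.$$ Let $n_\pm=\dim\ker(T_{\min}^*\mp i)$ be the deficiency indices of $T_{\min}$, and let $\nu_{b+}$ and $\nu_{b-}$ be the indices of inertia of $[\cdot,\cdot]_b$, i.e. the maximal dimensions of subspaces of $\operatorname{dom}t_{\max}$ on which $-i[y,y]_b$ is positive definite, respectively negative definite. Let $\mathcal H_b,\widehat{\mathcal H}_b$ be finite-dimensional Hilbert spaces and $\Gamma_b=(\Gamma_{0b},\widehat\Gamma_b,\Gamma_{1b}):\operatorname{dom}t_{\max}\to\mathcal H_b\oplus\widehat{\mathcal H}_b\oplus\mathcal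 H_b$ a surjective linear map such that $$[y,z]_b=i\operatorname{sign}(\nu_{b+}-\nu_{b-})(\widehat\Gamma_by,\widehat\Gamma_bz)-(\Gamma_{1b}y,\Gamma_{0b}z)+(\Gamma_{0b}y,\Gamma_{1b}z),$$ where $\widehat{\mathcal H}_b=\{0\}$ if $\nu_{b+}=\nu_{b-}$. Let $X_a$ be an operator on $\mathbf H$ with $X_a^*JX_a=J$ and write $X_ay(a)=(\Gamma_{0a}y,\widehat\Gamma_ay,\Gamma_{1a}y)\in H\oplus\widehat H\oplus H$. **Boundary triplets.** Let $A$ be a closed symmetric linear relation in a Hilbert space, $\mathcal H_1$ a subspace of a Hilbert space $\mathcal H_0$, $P_2$ the orthogonal projection of $\mathcal H_0$ onto $\mathcal H_0\ominus\mathcal H_1$, and $\alpha\in\{1,-1\}$. Linear maps $\Gamma_j:A^*\to\mathcal H_j$, $j=0,1$, form a boundary triplet $\Pi_\alpha$ for $A^*$ if $(\Gamma_0,\Gamma_1):A^*\to\mathcal H_0\oplus\mathcal H_1$ is surjective and for all $\widehat f=\{f,f'\}$, $\widehat g=\{g,g'\}$ in $A^*$ $$(f',g)-(f,g')=(\Gamma_1\widehat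 f,\Gamma_0\widehat g)-(\Gamma_0\widehat f,\Gamma_1\widehat g)+i\alpha(P_2\Gamma_0\widehat f,P_2\Gamma_0\widehat g).$$ It is an ordinary boundary triplet if $\mathcal H_0=\mathcal H_1$ (then the last term is absent). **The three cases.** *Case 1:* $\nu_{b+}-\nu_{b-}\ge\widehat\nu$. Then $\dim\widehat H\le\dim\widehat{\mathcal H}_b$; identify $\widehat H$ with a subspace of $\widehat{\mathcal H}_b$ by any isometric embedding and put $\mathcal H_2'=\widehat{\mathcal H}_b\ominus\widehat H$, $\mathcal H_0=H_0\oplus(\mathcal H_b\oplus\mathcal H_2')$, $\mathcal H_1=H_0\oplus\mathcal H_b$, $$\Gamma_0'=\begin{pmatrix}-\Gamma_{1a}+i(\widehat\Gamma_a-P_{\widehat H}\widehat\Gamma_b)\\ \Gamma_{0b}+P_{\mathcal H_2'}\widehat\Gamma_b\end{pmatrix},\qquad \Gamma_1'=\begin{pmatrix}\Gamma_{0a}+\tfrac12(\widehat\Gamma_a+P_{\widehat H}\widehat\Gamma_b)\\ -\Gamma_{1b}\end{pmatrix}.$$ *Case 2:* $\widehat\nu>\nu_{b+}-\nu_{b-}>0$.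 Then $\dim\widehat{\mathcal H}_b<\dim\widehat H$; identify $\widehat{\mathcal H}_b$ with a subspace of $\widehat H$ by any isometric embedding and put $\mathcal H_2'=\widehat H\ominus\widehat{\mathcal H}_b$, $H_0'=H\oplus\widehat{\mathcal H}_b$, $\mathcal H_0=H_0'\oplus\mathcal H_2'\oplus\mathcal H_b$, $\mathcal H_1=H_0'\oplus\mathcal H_b$, $$\Gamma_0'=\begin{pmatrix}-\Gamma_{1a}+i(P_{\widehat{\mathcal H}_b}\widehat\Gamma_a-\widehat\Gamma_b)\\ iP_{\mathcal H_2'}\widehat\Gamma_a\\ \Gamma_{0b}\end{pmatrix},\qquad \Gamma_1'=\begin{pmatrix}\Gamma_{0a}+\tfrac12(P_{\widehat{\mathcal H}_b}\widehat\Gamma_a+\widehat\Gamma_b)\\ -\Gamma_{1b}\end{pmatrix}.$$ *Case 3:* $\widehat\nu\ge0\ge\nu_{b+}-\nu_{b-}$ and $\widehat\nu\ne\nu_{b+}-\nu_{b-}$. Put $\mathcal H_0=H\oplus\widehat H\oplus(\mathcal H_b\oplus\widehat{\mathcal H}_b)$, $\mathcal H_1=H\oplus\mathcal H_b$, $$\Gamma_0'=\begin{pmatrix}-\Gamma_{1a}\\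 i\widehat\Gamma_a\\ \Gamma_{0b}+\widehat\Gamma_b\end{pmatrix},\qquad \Gamma_1'=\begin{pmatrix}\Gamma_{0a}\\ -\Gamma_{1b}\end{pmatrix}.$$ **Proposition 3.3.** $T_{\min}$ is a closed symmetric relation with $T_{\min}^*=T_{\max}$, and in each of Cases 1–3 the equalities $\Gamma_j\{\pi y,\pi f\}=\Gamma_j'y$, $\{y,f\}\in t_{\max}$, $j=0,1$, define linear maps $\Gamma_j:T_{\max}\to\mathcal H_j$ which form a boundary triplet $\Pi_\alpha$ for $T_{\max}$, with $\alpha=+1$ in Case 1 and $\alpha=-1$ in Cases 2 and 3. If in addition $n_+=n_-$, then Case 1 holds, $\dim\widehat{\mathcal H}_b=\dim\widehat H$ (so that, after the identification, $\widehat{\mathcal H}_b=\widehat H$, $\mathcal H_2'=\{0\}$ and $\mathcal H_0=\mathcal H_1=H_0\oplus\mathcal H_b$), and the maps $\Gamma_j\{\pi y,\pi f\}=\Gamma_j'y$ with $$\Gamma_0'=\begin{pmatrix}-\Gamma_{1a}+i(\widehat\Gamma_a-\widehat\Gamma_b)\\ \Gamma_{0b}\end{pmatrix},\qquad \Gamma_1'=\begin{pmatrix}\Gamma_{0a}+\tfrac12(\widehat\Gamma_a+\widehat\Gamma_b)\\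 -\Gamma_{1b}\end{pmatrix}$$ form an ordinary boundary triplet for $T_{\max}$ with the boundary space $H_0\oplus\mathcal H_b$. -/

import Mathlib

open Filter MeasureTheory Topology

noncomputable section

/-! ### Linear relations and boundary triplets

A linear relation in `X` is a linear subspace of `X × X`; the adjoint relation is
`Submodule.adjoint`. Mathlib's `inner ℂ x y` is linear in `y`, so that the inner product `(x, y)`
which is linear in `x` is written `inner ℂ y x`. -/

section Relations

variable {X : Type*} [NormedAddCommGroup X] [InnerProductSpace ℂ X]

/-- The defect subspace `ker (A* - lam)` of a linear relation `A`. -/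
def defectSubspace (A : Submodule ℂ (X × X)) (lam : ℂ) : Submodule ℂ X :=
  A.adjoint.comap (LinearMap.prod LinearMap.id (lam • LinearMap.id))

/-- The deficiency index `n₊(A)`: the dimension of the defect subspace in the upper half-plane
(for a closed symmetric relation it is the same at all points of the half-plane). -/
def deficiencyPlus (A : Submodule ℂ (X × X)) : Cardinal :=
  Module.rank ℂ (defectSubspace A Complex.I)

/-- The deficiency index `n₋(A)`. -/
def deficiencyMinus (A : Submodule ℂ (X × X)) : Cardinal :=
  Module.rank ℂ (defectSubspace A (-Complex.I))

variable {K : Type*} [NormedAddCommGroup K] [InnerProductSpace ℂ K]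

/-- `{K ⊕ K₁, Γ₀, Γ₁}` is a boundary triplet `Π_α` for the adjoint `S = A*` of the closed symmetric
linear relation `A`. Here `K` is the first boundary space, `K₁` is a subspace of it, and `P₂` is
the orthogonal projection in `K` onto the orthogonal complement of `K₁`. -/
structure IsBoundaryTriplet (α : ℤ) (A S : Submodule ℂ (X × X)) (K₁ : Submodule ℂ K)
    [K₁.HasOrthogonalProjection] (Γ₀ : S →ₗ[ℂ] K) (Γ₁ : S →ₗ[ℂ] K₁) : Prop where
  sign : α = 1 ∨ α = -1
  isClosed : IsClosed (A : Set (X × X))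
  symmetric : A ≤ A.adjoint
  eq_adjoint : S = A.adjoint
  surjective : Function.Surjective fun f : S => (Γ₀ f, Γ₁ f)
  green : ∀ f g : S,
    inner ℂ g.1.1 f.1.2 - inner ℂ g.1.2 f.1.1 =
      inner ℂ (Γ₀ g) (Γ₁ f : K) - inner ℂ (Γ₁ g : K) (Γ₀ f)
        + Complex.I * (α : ℂ) *
          inner ℂ (K₁ᗮ.starProjection (Γ₀ g)) (K₁ᗮ.starProjection (Γ₀ f))

/-- `{K, Γ₀, Γ₁}` is an ordinary boundary triplet (boundary value space) for the adjoint `S = A*`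
of the closed symmetric linear relation `A`. -/
structure IsOrdinaryBoundaryTriplet (A S : Submodule ℂ (X × X))
    (Γ₀ Γ₁ : S →ₗ[ℂ] K) : Prop where
  isClosed : IsClosed (A : Set (X × X))
  symmetric : A ≤ A.adjoint
  eq_adjoint : S = A.adjoint
  surjective : Function.Surjective fun f : S => (Γ₀ f, Γ₁ f)
  green : ∀ f g : S,
    inner ℂ g.1.1 f.1.2 - inner ℂ g.1.2 f.1.1 =
      inner ℂ (Γ₀ g) (Γ₁ f) - inner ℂ (Γ₁ g) (Γ₀ f)

end Relations

/-! ### The spaces `H₀ = H ⊕ Ĥ` and `𝐇 = H ⊕ Ĥ ⊕ H`, the operator `J` -/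

/-- `H₀ = H ⊕ Ĥ` (orthogonal sum). -/
abbrev SpaceH₀ (H Hh : Type*) : Type _ := WithLp 2 (H × Hh)

/-- `𝐇 = H₀ ⊕ H = H ⊕ Ĥ ⊕ H` (orthogonal sum). -/
def BoldH (H Hh : Type*) : Type _ := WithLp 2 (SpaceH₀ H Hh × H)

/-- Orthogonal direct sum of two elements. -/
abbrev osum {E F : Type*} (x : E) (y : F) : WithLp 2 (E × F) := WithLp.toLp 2 (x, y)

section Spaces

variable (H Hh : Type*) [NormedAddCommGroup H] [InnerProductSpace ℂ H]
  [NormedAddCommGroup Hh] [InnerProductSpace ℂ Hh]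

instance : NormedAddCommGroup (BoldH H Hh) :=
  inferInstanceAs (NormedAddCommGroup (WithLp 2 (SpaceH₀ H Hh × H)))

instance : InnerProductSpace ℂ (BoldH H Hh) :=
  inferInstanceAs (InnerProductSpace ℂ (WithLp 2 (SpaceH₀ H Hh × H)))

instance [FiniteDimensional ℂ H] [FiniteDimensional ℂ Hh] : FiniteDimensional ℂ (BoldH H Hh) :=
  inferInstanceAs (FiniteDimensional ℂ (WithLp 2 (SpaceH₀ H Hh × H)))

variable {H Hh} in
/-- The tautological identification of `𝐇` with `(H ⊕ Ĥ) ⊕ H`. -/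
def BoldH.blocks : BoldH H Hh ≃ₗᵢ[ℂ] WithLp 2 (SpaceH₀ H Hh × H) :=
  LinearIsometryEquiv.refl ℂ (WithLp 2 (SpaceH₀ H Hh × H))

/-- The signature operator `J (h, ĥ, h') = (-h', i ĥ, h)` on `H ⊕ Ĥ ⊕ H`. -/
def opJ : BoldH H Hh →ₗ[ℂ] BoldH H Hh where
  toFun x := BoldH.blocks.symm
    (osum (osum (-(BoldH.blocks x).snd) (Complex.I • (BoldH.blocks x).fst.snd)) (BoldH.blocks x).fst.fst)
  map_add' x y := by
    rw [← map_add]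
    congr 1
    simp only [map_add, WithLp.add_fst, WithLp.add_snd, smul_add, neg_add, osum]
    rfl
  map_smul' c x := by
    rw [RingHom.id_apply, ← map_smul]
    congr 1
    simp only [map_smul, WithLp.smul_fst, WithLp.smul_snd, smul_comm Complex.I c, ← smul_neg, osum]
    rfl

/-- The data of a first-order symmetric system `J y' - B y = Δ f` on an interval `I` with left
endpoint `a ∈ I` and right endpoint `b`, `-∞ < a < b ≤ ∞`, where `b` may or may not belong to `I`.
Functions on `I` are represented by functions on `ℝ`. -/
structure SymmetricSystem where
  /-- The regular left endpoint. -/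
  a : ℝ
  /-- The right endpoint. -/
  b : EReal
  hab : (a : EReal) < b
  /-- The interval. -/
  I : Set ℝ
  hI : I = {t : ℝ | a ≤ t ∧ (t : EReal) < b} ∨ I = {t : ℝ | a ≤ t ∧ (t : EReal) ≤ b}
  /-- The coefficient `B`. -/
  B : ℝ → BoldH H Hh →L[ℂ] BoldH H Hh
  /-- The weight `Δ`. -/
  Δ : ℝ → BoldH H Hh →L[ℂ] BoldH H Hh
  B_locallyIntegrable : ∀ β ∈ I, IntegrableOn B (Set.Icc a β)
  Δ_locallyIntegrable : ∀ β ∈ I, IntegrableOn Δ (Set.Icc a β)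
  B_symmetric : ∀ᵐ t ∂volume.restrict I, (B t : BoldH H Hh →ₗ[ℂ] BoldH H Hh).IsSymmetric
  Δ_nonneg : ∀ᵐ t ∂volume.restrict I, (Δ t).IsPositive

end Spaces

namespace SymmetricSystem

variable {H Hh : Type*} [NormedAddCommGroup H] [InnerProductSpace ℂ H]
  [NormedAddCommGroup Hh] [InnerProductSpace ℂ Hh]

/-- `y` is absolutely continuous on each segment `[a, β] ⊆ I`. -/
def IsAC (S : SymmetricSystem H Hh) (y : ℝ → BoldH H Hh) : Prop :=
  ∀ β ∈ S.I, AbsolutelyContinuousOnInterval y S.a β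

/-- `J y' - B y = Δ f` almost everywhere on `I`. -/
def Solves (S : SymmetricSystem H Hh) (y f : ℝ → BoldH H Hh) : Prop :=
  ∀ᵐ t ∂volume.restrict S.I, DifferentiableAt ℝ y t ∧
    opJ H Hh (deriv y t) - S.B t (y t) = S.Δ t (f t)

/-- The system is definite: for each `lam`, a solution `y` of `J y' - B y = lam Δ y` with
`Δ y = 0` a.e. on `I` vanishes on `I`. -/
def IsDefinite (S : SymmetricSystem H Hh) : Prop :=
  ∀ (lam : ℂ) (y : ℝ → BoldH H Hh), S.IsAC y → S.Solves y (lam • y) →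
    (∀ᵐ t ∂volume.restrict S.I, S.Δ t (y t) = 0) → ∀ t ∈ S.I, y t = 0

/-! ### The semi-Hilbert space `𝓛²_Δ(I)` and the Hilbert space `L²_Δ(I)` -/

section Measurability

variable (S : SymmetricSystem H Hh)

theorem aestronglyMeasurable_Δ : AEStronglyMeasurable S.Δ (volume.restrict S.I) := by
  have h : LocallyIntegrableOn S.Δ S.I volume := by
    intro x hx
    have hax : S.a ≤ x := by rcases S.hI with h | h <;> (rw [h] at hx; exact hx.1)
    by_cases hmax : ∃ β ∈ S.I, x < β
    · obtain ⟨β, hβ, hxβ⟩ := hmax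
      refine ⟨Set.Icc S.a β, ?_, S.Δ_locallyIntegrable β hβ⟩
      refine mem_nhdsWithin.2 ⟨Set.Iio β, isOpen_Iio, hxβ, ?_⟩
      rintro t ⟨ht1, ht2⟩
      refine ⟨?_, le_of_lt ht1⟩
      rcases S.hI with h | h <;> (rw [h] at ht2; exact ht2.1)
    · push Not at hmax
      refine ⟨Set.Icc S.a x, ?_, S.Δ_locallyIntegrable x hx⟩
      refine mem_nhdsWithin.2 ⟨Set.univ, isOpen_univ, trivial, ?_⟩
      rintro t ⟨-, ht2⟩
      refine ⟨?_, hmax t ht2⟩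
      rcases S.hI with h | h <;> (rw [h] at ht2; exact ht2.1)
  exact h.aestronglyMeasurable

theorem aestronglyMeasurable_form {f g : ℝ → BoldH H Hh}
    (hf : AEStronglyMeasurable f (volume.restrict S.I))
    (hg : AEStronglyMeasurable g (volume.restrict S.I)) :
    AEStronglyMeasurable (fun t => inner ℂ (f t) (S.Δ t (g t))) (volume.restrict S.I) := by
  refine hf.inner ?_
  exact (isBoundedBilinearMap_apply (𝕜 := ℂ) (E := BoldH H Hh)
    (F := BoldH H Hh)).continuous.comp_aestronglyMeasurable (S.aestronglyMeasurable_Δ.prodMk hg)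

/-- Cauchy-Schwarz type bound for a positive operator. -/
theorem norm_form_le {T : BoldH H Hh →L[ℂ] BoldH H Hh} (hT : T.IsPositive) (x y : BoldH H Hh) :
    ‖inner ℂ x (T y)‖ ≤ ‖inner ℂ x (T x)‖ + ‖inner ℂ y (T y)‖ := by
  let c : PreInnerProductSpace.Core ℂ (BoldH H Hh) :=
    { inner := fun u v => inner ℂ u (T v)
      conj_inner_symm := fun u v => by
        rw [inner_conj_symm]; exact hT.1 u v
      re_inner_nonneg := fun u => by
        have := hT.2 u
        rw [ContinuousLinearMap.reApplyInnerSelf_apply] at this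
        have e : inner ℂ (T u) u = inner ℂ u (T u) := hT.1 u u
        rwa [e] at this
      add_left := fun u v w => inner_add_left _ _ _
      smul_left := fun u v r => inner_smul_left _ _ _ }
  have h := @InnerProductSpace.Core.inner_mul_inner_self_le ℂ (BoldH H Hh) _ _ _ c x y
  have hsw : ‖(inner ℂ y (T x) : ℂ)‖ = ‖(inner ℂ x (T y) : ℂ)‖ := by
    rw [← inner_conj_symm, RCLike.norm_conj]
    exact congrArg norm (hT.1 x y)
  have h' : ‖(inner ℂ x (T y) : ℂ)‖ * ‖(inner ℂ y (T x) : ℂ)‖ ≤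
      RCLike.re (inner ℂ x (T x) : ℂ) * RCLike.re (inner ℂ y (T y) : ℂ) := h
  rw [hsw] at h'
  have hx := RCLike.re_le_norm (inner ℂ x (T x) : ℂ)
  have hy := RCLike.re_le_norm (inner ℂ y (T y) : ℂ)
  have hx0 : 0 ≤ RCLike.re (inner ℂ x (T x) : ℂ) := c.re_inner_nonneg x
  have hy0 : 0 ≤ RCLike.re (inner ℂ y (T y) : ℂ) := c.re_inner_nonneg y
  have h0 := norm_nonneg (inner ℂ x (T y) : ℂ)
  nlinarith [mul_nonneg hx0 hy0]

theorem integrableOn_form {f g : ℝ → BoldH H Hh}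
    (hf : AEStronglyMeasurable f (volume.restrict S.I))
    (hg : AEStronglyMeasurable g (volume.restrict S.I))
    (hf2 : IntegrableOn (fun t => inner ℂ (f t) (S.Δ t (f t))) S.I)
    (hg2 : IntegrableOn (fun t => inner ℂ (g t) (S.Δ t (g t))) S.I) :
    IntegrableOn (fun t => inner ℂ (f t) (S.Δ t (g t))) S.I := by
  refine Integrable.mono' (hf2.norm.add hg2.norm) (S.aestronglyMeasurable_form hf hg) ?_
  filter_upwards [S.Δ_nonneg] with t ht
  exact norm_form_le ht _ _

end Measurability

/-- The functions `f` on `I` (measurable, defined up to null sets) with values in `𝐇` such that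
`∫_I (Δ f, f) < ∞`. -/
def lSqSubmodule (S : SymmetricSystem H Hh) : Submodule ℂ (ℝ → BoldH H Hh) where
  carrier := {f | AEStronglyMeasurable f (volume.restrict S.I) ∧
    IntegrableOn (fun t => inner ℂ (f t) (S.Δ t (f t))) S.I}
  zero_mem' := by
    refine ⟨aestronglyMeasurable_const, ?_⟩
    simp
  add_mem' := by
    rintro f g ⟨hf, hf2⟩ ⟨hg, hg2⟩
    refine ⟨hf.add hg, ?_⟩
    have h1 := S.integrableOn_form hf hg hf2 hg2
    have h2 := S.integrableOn_form hg hf hg2 hf2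
    refine (((hf2.add h1).add (h2.add hg2))).congr ?_
    refine Eventually.of_forall fun t => ?_
    simp only [Pi.add_apply, map_add, inner_add_left, inner_add_right]
    ring
  smul_mem' := by
    rintro c f ⟨hf, hf2⟩
    refine ⟨hf.const_smul c, ?_⟩
    refine (Integrable.const_mul hf2 ((starRingEnd ℂ) c * c)).congr ?_
    refine Eventually.of_forall fun t => ?_
    simp only [Pi.smul_apply, map_smul, inner_smul_left, inner_smul_right, mul_assoc]
    ring

/-- The semi-Hilbert space `𝓛²_Δ(I)`. -/
def LSq (S : SymmetricSystem H Hh) : Type _ := S.lSqSubmodule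

instance (S : SymmetricSystem H Hh) : AddCommGroup S.LSq :=
  inferInstanceAs (AddCommGroup S.lSqSubmodule)

instance (S : SymmetricSystem H Hh) : Module ℂ S.LSq :=
  inferInstanceAs (Module ℂ S.lSqSubmodule)

/-- The function `ℝ → 𝐇` underlying an element of `𝓛²_Δ(I)`. -/
def LSq.toFun {S : SymmetricSystem H Hh} : S.LSq →ₗ[ℂ] (ℝ → BoldH H Hh) :=
  S.lSqSubmodule.subtype

instance (S : SymmetricSystem H Hh) : CoeFun S.LSq fun _ => ℝ → BoldH H Hh := ⟨LSq.toFun⟩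

/-- The semi-inner product `(f, g)_Δ = ∫_I (Δ f, g)`, that is `inner f g = (g, f)_Δ`. -/
@[reducible] def lSqCore (S : SymmetricSystem H Hh) : PreInnerProductSpace.Core ℂ S.LSq where
  inner f g := ∫ t in S.I, inner ℂ (f t) (S.Δ t (g t))
  conj_inner_symm f g := by
    rw [← integral_conj]
    refine integral_congr_ae ?_
    filter_upwards [S.Δ_nonneg] with t ht
    rw [inner_conj_symm]
    exact ht.1 _ _
  re_inner_nonneg f := by
    have h := integral_re (𝕜 := ℂ) (f := fun t => inner ℂ (f t) (S.Δ t (f t))) f.2.2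
    rw [← h]
    refine integral_nonneg_of_ae ?_
    filter_upwards [S.Δ_nonneg] with t ht
    have := ht.2 (f t)
    rw [ContinuousLinearMap.reApplyInnerSelf_apply] at this
    have e : inner ℂ (S.Δ t (f t)) (f t) = inner ℂ (f t) (S.Δ t (f t)) := ht.1 _ _
    rwa [e] at this
  add_left f g h := by
    refine Eq.trans ?_ (integral_add (S.integrableOn_form f.2.1 h.2.1 f.2.2 h.2.2)
      (S.integrableOn_form g.2.1 h.2.1 g.2.2 h.2.2))
    refine integral_congr_ae (Eventually.of_forall fun t => ?_)
    simp only [map_add, Pi.add_apply, inner_add_left]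
  smul_left f g c := by
    rw [← integral_const_mul]
    refine integral_congr_ae (Eventually.of_forall fun t => ?_)
    simp only [map_smul, Pi.smul_apply, inner_smul_left]

instance (S : SymmetricSystem H Hh) : SeminormedAddCommGroup S.LSq :=
  @InnerProductSpace.Core.toSeminormedAddCommGroup ℂ S.LSq _ _ _ S.lSqCore

instance (S : SymmetricSystem H Hh) : InnerProductSpace ℂ S.LSq :=
  InnerProductSpace.ofCore S.lSqCore

/-- The Hilbert space `L²_Δ(I)` of equivalence classes. -/
abbrev L2 (S : SymmetricSystem H Hh) : Type _ := SeparationQuotient S.LSq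

/-- The quotient map `π`. -/
def π (S : SymmetricSystem H Hh) : S.LSq →ₗ[ℂ] S.L2 :=
  (SeparationQuotient.mkCLM ℂ S.LSq).toLinearMap

/-! ### Maximal and minimal relations, the boundary form at `b` -/

/-- The maximal relation in `𝓛²_Δ(I)`. A function `y` on `I` is represented by its extension by
zero to `ℝ`. -/
def tmax (S : SymmetricSystem H Hh) : Submodule ℂ (S.LSq × S.LSq) where
  carrier := {p | Function.support p.1 ⊆ S.I ∧ S.IsAC p.1 ∧ S.Solves p.1 p.2}
  zero_mem' := by
    refine ⟨by simp, fun β _ => ?_, ?_⟩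
    · have : (LSq.toFun (0 : S.LSq × S.LSq).1) = fun _ => (0 : BoldH H Hh) := by
        simp; rfl
      rw [this]
      simpa [AbsolutelyContinuousOnInterval] using tendsto_const_nhds
    · refine Eventually.of_forall fun t => ?_
      have : (LSq.toFun (0 : S.LSq × S.LSq).1) = fun _ => (0 : BoldH H Hh) := by
        simp; rfl
      simp
  add_mem' := by
    rintro p q ⟨hp1, hp2, hp3⟩ ⟨hq1, hq2, hq3⟩
    refine ⟨?_, fun β hβ => ?_, ?_⟩
    · rw [Prod.fst_add, map_add]
      exact (Function.support_add _ _).trans (Set.union_subset hp1 hq1)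
    · rw [Prod.fst_add, map_add]
      exact (hp2 β hβ).add (hq2 β hβ)
    · filter_upwards [hp3, hq3] with t h1 h2
      rw [Prod.fst_add, map_add, Prod.snd_add, map_add]
      refine ⟨h1.1.add h2.1, ?_⟩
      rw [deriv_add h1.1 h2.1, Pi.add_apply, Pi.add_apply, map_add, map_add, map_add,
        ← h1.2, ← h2.2]
      abel
  smul_mem' := by
    rintro c p ⟨hp1, hp2, hp3⟩
    refine ⟨?_, fun β hβ => ?_, ?_⟩
    · rw [Prod.smul_fst, map_smul]
      exact (Function.support_const_smul_subset c _).trans hp1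
    · rw [Prod.smul_fst, map_smul]
      exact (hp2 β hβ).const_smul c
    · filter_upwards [hp3] with t h1
      rw [Prod.smul_fst, map_smul, Prod.smul_snd, map_smul]
      refine ⟨h1.1.const_smul c, ?_⟩
      have h := h1.1.hasDerivAt.const_smul c
      rw [h.deriv, Pi.smul_apply, Pi.smul_apply, map_smul, map_smul, map_smul, ← h1.2, smul_sub]

/-- The domain of the maximal relation in `𝓛²_Δ(I)`. -/
def dom (S : SymmetricSystem H Hh) : Submodule ℂ S.LSq :=
  S.tmax.map (LinearMap.fst ℂ S.LSq S.LSq)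

/-- The maximal relation `T_max = (π ⊕ π) t_max` in `L²_Δ(I)`. -/
def Tmax (S : SymmetricSystem H Hh) : Submodule ℂ (S.L2 × S.L2) :=
  S.tmax.map (S.π.prodMap S.π)

/-- The filter `t ↑ b`. -/
def atB (S : SymmetricSystem H Hh) : Filter ℝ :=
  comap (fun t : ℝ => (t : EReal)) (𝓝[<] S.b)

/-- The boundary form `[y, z]_b = lim_{t ↑ b} (J y(t), z(t))`; the limit exists for all
`y, z` in the domain of the maximal relation. -/
def bForm (S : SymmetricSystem H Hh) (y z : S.LSq) : ℂ :=
  limUnder S.atB fun t => inner ℂ (z t) (opJ H Hh (y t))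

/-- The minimal relation in `𝓛²_Δ(I)`: those `{y, f}` in the maximal relation with `y(a) = 0` and
`[y, z]_b = 0` for all `z` in the domain of the maximal relation. -/
def tmin (S : SymmetricSystem H Hh) : Submodule ℂ (S.LSq × S.LSq) where
  carrier := {p | p ∈ S.tmax ∧ p.1 S.a = 0 ∧
    ∀ z ∈ S.dom, Tendsto (fun t => inner ℂ (z t) (opJ H Hh (p.1 t))) S.atB (𝓝 (0 : ℂ))}
  zero_mem' := by
    refine ⟨S.tmax.zero_mem, by simp, fun z _ => ?_⟩
    simpa using tendsto_const_nhds
  add_mem' := by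
    rintro p q ⟨hp1, hp2, hp3⟩ ⟨hq1, hq2, hq3⟩
    refine ⟨S.tmax.add_mem hp1 hq1, ?_, fun z hz => ?_⟩
    · simp [hp2, hq2]
    · simpa [inner_add_right] using (hp3 z hz).add (hq3 z hz)
  smul_mem' := by
    rintro c p ⟨hp1, hp2, hp3⟩
    refine ⟨S.tmax.smul_mem c hp1, ?_, fun z hz => ?_⟩
    · simp [hp2]
    · simpa [inner_smul_right] using (hp3 z hz).const_mul c

/-- The minimal relation `T_min = (π ⊕ π) t_min` in `L²_Δ(I)`. -/
def Tmin (S : SymmetricSystem H Hh) : Submodule ℂ (S.L2 × S.L2) :=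
  S.tmin.map (S.π.prodMap S.π)

/-- The index of inertia `ν_{b+}` of the skew-Hermitian form `[·,·]_b`: the largest dimension of
a subspace on which the Hermitian form `-i [·,·]_b` is positive definite. -/
def nubPlus (S : SymmetricSystem H Hh) : ℕ∞ :=
  ⨆ (L : Submodule ℂ S.LSq) (_ : L ≤ S.dom) (_ : FiniteDimensional ℂ L)
    (_ : ∀ y ∈ L, y ≠ 0 → 0 < (-Complex.I * S.bForm y y).re), (Module.finrank ℂ L : ℕ∞)

/-- The index of inertia `ν_{b-}`: the largest dimension of a subspace on which the Hermitian form
`-i [·,·]_b` is negative definite. -/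
def nubMinus (S : SymmetricSystem H Hh) : ℕ∞ :=
  ⨆ (L : Submodule ℂ S.LSq) (_ : L ≤ S.dom) (_ : FiniteDimensional ℂ L)
    (_ : ∀ y ∈ L, y ≠ 0 → (-Complex.I * S.bForm y y).re < 0), (Module.finrank ℂ L : ℕ∞)

open Classical in
/-- `sign (ν_{b+} - ν_{b-})`. -/
def bSign (S : SymmetricSystem H Hh) : ℤ :=
  if S.nubMinus < S.nubPlus then 1 else if S.nubPlus < S.nubMinus then -1 else 0

/-! ### Boundary maps -/

/-- The maps `Γ_b = (Γ_{0b} : Γ̂_b : Γ_{1b})` of singular boundary values at `b`. -/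
structure SingularBoundaryMap (S : SymmetricSystem H Hh) (Hb Hhb : Type*)
    [NormedAddCommGroup Hb] [InnerProductSpace ℂ Hb]
    [NormedAddCommGroup Hhb] [InnerProductSpace ℂ Hhb] where
  /-- `Γ_{0b}` -/
  G0 : S.dom →ₗ[ℂ] Hb
  /-- `Γ̂_b` -/
  Gh : S.dom →ₗ[ℂ] Hhb
  /-- `Γ_{1b}` -/
  G1 : S.dom →ₗ[ℂ] Hb
  surjective : Function.Surjective fun y : S.dom => (G0 y, Gh y, G1 y)
  form : ∀ y z : S.dom, S.bForm y z =
    Complex.I * (S.bSign : ℂ) * inner ℂ (Gh z) (Gh y)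
      - inner ℂ (G0 z) (G1 y) + inner ℂ (G1 z) (G0 y)
  /-- When `ν_{b+} = ν_{b-}`, the middle component is absent. -/
  middle_trivial : S.nubPlus = S.nubMinus → Subsingleton Hhb

/-- `Γ_{0a} y`, the first block of `Γ_a y = X_a y(a)`. -/
def Ga0 (S : SymmetricSystem H Hh) (Xa : BoldH H Hh →ₗ[ℂ] BoldH H Hh) (y : S.LSq) : H :=
  (BoldH.blocks (Xa (y S.a))).fst.fst

/-- `Γ̂_a y`, the second block of `Γ_a y = X_a y(a)`. -/
def Gah (S : SymmetricSystem H Hh) (Xa : BoldH H Hh →ₗ[ℂ] BoldH H Hh) (y : S.LSq) : Hh :=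
  (BoldH.blocks (Xa (y S.a))).fst.snd

/-- `Γ_{1a} y`, the third block of `Γ_a y = X_a y(a)`. -/
def Ga1 (S : SymmetricSystem H Hh) (Xa : BoldH H Hh →ₗ[ℂ] BoldH H Hh) (y : S.LSq) : H :=
  (BoldH.blocks (Xa (y S.a))).snd

/-- `Γ {ỹ, f̃} = Γ' y` for all `{ỹ, f̃} ∈ T_max`, where `y` is the absolutely continuous
representative of `ỹ` with `{y, f} ∈ t_max`. -/
def Induces (S : SymmetricSystem H Hh) {K : Type*} (Γ : S.Tmax → K) (Γ' : S.dom → K) : Prop :=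
  ∀ (p : S.LSq × S.LSq) (hp : p ∈ S.tmax),
    Γ ⟨S.π.prodMap S.π p, Submodule.mem_map_of_mem hp⟩ =
      Γ' ⟨p.1, Submodule.mem_map_of_mem (f := LinearMap.fst ℂ S.LSq S.LSq) hp⟩

/-- Case 1: `ν_{b+} - ν_{b-} ≥ ν₋ - ν₊ ≥ 0`, where `ν₋ - ν₊ = dim Ĥ`. -/
def Case1 (S : SymmetricSystem H Hh) : Prop :=
  S.nubMinus + (Module.finrank ℂ Hh : ℕ∞) ≤ S.nubPlus

/-- Case 2: `ν₋ - ν₊ > ν_{b+} - ν_{b-} > 0`, where `ν₋ - ν₊ = dim Ĥ`. -/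
def Case2 (S : SymmetricSystem H Hh) : Prop :=
  S.nubPlus < S.nubMinus + (Module.finrank ℂ Hh : ℕ∞) ∧ S.nubMinus < S.nubPlus

/-- Case 3: `ν₋ - ν₊ ≥ 0 ≥ ν_{b+} - ν_{b-}` and `ν₋ - ν₊ ≠ ν_{b+} - ν_{b-}`, where
`ν₋ - ν₊ = dim Ĥ`. -/
def Case3 (S : SymmetricSystem H Hh) : Prop :=
  S.nubPlus ≤ S.nubMinus ∧ S.nubMinus + (Module.finrank ℂ Hh : ℕ∞) ≠ S.nubPlus

section Maps

variable {Hb Hhb : Type*} [NormedAddCommGroup Hb] [InnerProductSpace ℂ Hb]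
  [NormedAddCommGroup Hhb] [InnerProductSpace ℂ Hhb]
  [FiniteDimensional ℂ Hh] [FiniteDimensional ℂ Hhb]

/-! #### Case 1

The inclusion of `Ĥ` into `Ĥ_b` is an isometric embedding `V`. Then `P_Ĥ` is the adjoint of `V`
and `H₂' = Ĥ_b ⊖ Ĥ` is the orthogonal complement of the range of `V`. -/

/-- `H₂'`, the orthogonal complement of the image of an isometric embedding. -/
abbrev complRange {E F : Type*} [NormedAddCommGroup E] [InnerProductSpace ℂ E]
    [NormedAddCommGroup F] [InnerProductSpace ℂ F] (V : E →ₗᵢ[ℂ] F) : Submodule ℂ F :=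
  (LinearMap.range V.toLinearMap)ᗮ

/-- `𝓗₀ = H₀ ⊕ (H_b ⊕ H₂')` in Case 1. -/
abbrev K0Case1 (H Hb : Type*) (V : Hh →ₗᵢ[ℂ] Hhb) : Type _ :=
  WithLp 2 (SpaceH₀ H Hh × WithLp 2 (Hb × complRange V))

/-- `𝓗₁ = H₀ ⊕ H_b` as a subspace of `𝓗₀` in Case 1. -/
def K1Case1 (H Hb : Type*) [NormedAddCommGroup H] [InnerProductSpace ℂ H]
    [NormedAddCommGroup Hb] [InnerProductSpace ℂ Hb]
    (V : Hh →ₗᵢ[ℂ] Hhb) : Submodule ℂ (K0Case1 H Hb V) where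
  carrier := {x | x.snd.snd = 0}
  zero_mem' := by simp
  add_mem' := by
    intro x y hx hy
    simp only [Set.mem_ofPred_eq] at hx hy ⊢
    simp [hx, hy]
  smul_mem' := by
    intro c x hx
    simp only [Set.mem_ofPred_eq] at hx ⊢
    simp [hx]

/-- `Γ₀' = (-Γ_{1a} + i (Γ̂_a - P_Ĥ Γ̂_b), Γ_{0b} + P_{H₂'} Γ̂_b)` in Case 1. -/
def G0Case1 (S : SymmetricSystem H Hh) (Xa : BoldH H Hh →ₗ[ℂ] BoldH H Hh)
    (Γb : S.SingularBoundaryMap Hb Hhb) (V : Hh →ₗᵢ[ℂ] Hhb) (y : S.dom) : K0Case1 H Hb V :=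
  osum
    (osum (-S.Ga1 Xa y) (Complex.I • (S.Gah Xa y - LinearMap.adjoint V.toLinearMap (Γb.Gh y))))
    (osum (Γb.G0 y) ((complRange V).orthogonalProjectionOnto (Γb.Gh y)))

/-- `Γ₁' = (Γ_{0a} + (Γ̂_a + P_Ĥ Γ̂_b) / 2, -Γ_{1b})` in Case 1, with values in
`𝓗₁ ⊆ 𝓗₀`. -/
def G1Case1 (S : SymmetricSystem H Hh) (Xa : BoldH H Hh →ₗ[ℂ] BoldH H Hh)
    (Γb : S.SingularBoundaryMap Hb Hhb) (V : Hh →ₗᵢ[ℂ] Hhb) (y : S.dom) : K0Case1 H Hb V :=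
  osum
    (osum (S.Ga0 Xa y)
      ((1 / 2 : ℂ) • (S.Gah Xa y + LinearMap.adjoint V.toLinearMap (Γb.Gh y))))
    (osum (-Γb.G1 y) 0)

/-! #### Case 2

The inclusion of `Ĥ_b` into `Ĥ` is an isometric embedding `V`. Then `P_{Ĥ_b}` is the adjoint of `V`
and `H₂' = Ĥ ⊖ Ĥ_b` is the orthogonal complement of the range of `V`. -/

/-- `𝓗₀ = H₀' ⊕ H₂' ⊕ H_b` with `H₀' = H ⊕ Ĥ_b` in Case 2. -/
abbrev K0Case2 (H Hb : Type*) (V : Hhb →ₗᵢ[ℂ] Hh) : Type _ :=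
  WithLp 2 (WithLp 2 (H × Hhb) × WithLp 2 (complRange V × Hb))

/-- `𝓗₁ = H₀' ⊕ H_b` as a subspace of `𝓗₀` in Case 2. -/
def K1Case2 (H Hb : Type*) [NormedAddCommGroup H] [InnerProductSpace ℂ H]
    [NormedAddCommGroup Hb] [InnerProductSpace ℂ Hb]
    (V : Hhb →ₗᵢ[ℂ] Hh) : Submodule ℂ (K0Case2 H Hb V) where
  carrier := {x | x.snd.fst = 0}
  zero_mem' := by simp
  add_mem' := by
    intro x y hx hy
    simp only [Set.mem_ofPred_eq] at hx hy ⊢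
    simp [hx, hy]
  smul_mem' := by
    intro c x hx
    simp only [Set.mem_ofPred_eq] at hx ⊢
    simp [hx]

/-- `Γ₀' = (-Γ_{1a} + i (P_{Ĥ_b} Γ̂_a - Γ̂_b), i P_{H₂'} Γ̂_a, Γ_{0b})` in Case 2. -/
def G0Case2 (S : SymmetricSystem H Hh) (Xa : BoldH H Hh →ₗ[ℂ] BoldH H Hh)
    (Γb : S.SingularBoundaryMap Hb Hhb) (V : Hhb →ₗᵢ[ℂ] Hh) (y : S.dom) : K0Case2 H Hb V :=
  osum
    (osum (-S.Ga1 Xa y) (Complex.I • (LinearMap.adjoint V.toLinearMap (S.Gah Xa y) - Γb.Gh y)))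
    (osum (Complex.I • (complRange V).orthogonalProjectionOnto (S.Gah Xa y)) (Γb.G0 y))

/-- `Γ₁' = (Γ_{0a} + (P_{Ĥ_b} Γ̂_a + Γ̂_b) / 2, -Γ_{1b})` in Case 2, with values in
`𝓗₁ ⊆ 𝓗₀`. -/
def G1Case2 (S : SymmetricSystem H Hh) (Xa : BoldH H Hh →ₗ[ℂ] BoldH H Hh)
    (Γb : S.SingularBoundaryMap Hb Hhb) (V : Hhb →ₗᵢ[ℂ] Hh) (y : S.dom) : K0Case2 H Hb V :=
  osum
    (osum (S.Ga0 Xa y)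
      ((1 / 2 : ℂ) • (LinearMap.adjoint V.toLinearMap (S.Gah Xa y) + Γb.Gh y)))
    (osum 0 (-Γb.G1 y))

/-! #### Case 3 -/

/-- `𝓗₀ = (H ⊕ Ĥ) ⊕ (H_b ⊕ Ĥ_b)` in Case 3. -/
abbrev K0Case3 (H Hh Hb Hhb : Type*) : Type _ :=
  WithLp 2 (SpaceH₀ H Hh × WithLp 2 (Hb × Hhb))

/-- `𝓗₁ = H ⊕ H_b` as a subspace of `𝓗₀` in Case 3. -/
def K1Case3 (H Hh Hb Hhb : Type*) [NormedAddCommGroup H] [InnerProductSpace ℂ H]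
    [NormedAddCommGroup Hh] [InnerProductSpace ℂ Hh]
    [NormedAddCommGroup Hb] [InnerProductSpace ℂ Hb]
    [NormedAddCommGroup Hhb] [InnerProductSpace ℂ Hhb] :
    Submodule ℂ (K0Case3 H Hh Hb Hhb) where
  carrier := {x | x.fst.snd = 0 ∧ x.snd.snd = 0}
  zero_mem' := by simp
  add_mem' := by
    rintro x y ⟨hx, hx'⟩ ⟨hy, hy'⟩
    simp [hx, hy, hx', hy']
  smul_mem' := by
    rintro c x ⟨hx, hx'⟩
    simp [hx, hx']

/-- `Γ₀' = (-Γ_{1a}, i Γ̂_a, Γ_{0b} + Γ̂_b)` in Case 3. -/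
def G0Case3 (S : SymmetricSystem H Hh) (Xa : BoldH H Hh →ₗ[ℂ] BoldH H Hh)
    (Γb : S.SingularBoundaryMap Hb Hhb) (y : S.dom) : K0Case3 H Hh Hb Hhb :=
  osum (osum (-S.Ga1 Xa y) (Complex.I • S.Gah Xa y)) (osum (Γb.G0 y) (Γb.Gh y))

/-- `Γ₁' = (Γ_{0a}, -Γ_{1b})` in Case 3, with values in `𝓗₁ ⊆ 𝓗₀`. -/
def G1Case3 (S : SymmetricSystem H Hh) (Xa : BoldH H Hh →ₗ[ℂ] BoldH H Hh)
    (Γb : S.SingularBoundaryMap Hb Hhb) (y : S.dom) : K0Case3 H Hh Hb Hhb :=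
  osum (osum (S.Ga0 Xa y) 0) (osum (-Γb.G1 y) 0)

/-! #### Equal deficiency indices: `Ĥ_b = Ĥ` (through `V`) and `𝓗 = H₀ ⊕ H_b` -/

/-- `Γ₀' = (-Γ_{1a} + i (Γ̂_a - Γ̂_b), Γ_{0b})`, where `Ĥ` is identified with `Ĥ_b`. -/
def G0Ord (S : SymmetricSystem H Hh) (Xa : BoldH H Hh →ₗ[ℂ] BoldH H Hh)
    (Γb : S.SingularBoundaryMap Hb Hhb) (V : Hh ≃ₗᵢ[ℂ] Hhb) (y : S.dom) :
    WithLp 2 (SpaceH₀ H Hh × Hb) :=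
  osum (osum (-S.Ga1 Xa y) (Complex.I • (S.Gah Xa y - V.symm (Γb.Gh y)))) (Γb.G0 y)

/-- `Γ₁' = (Γ_{0a} + (Γ̂_a + Γ̂_b) / 2, -Γ_{1b})`, where `Ĥ` is identified with `Ĥ_b`. -/
def G1Ord (S : SymmetricSystem H Hh) (Xa : BoldH H Hh →ₗ[ℂ] BoldH H Hh)
    (Γb : S.SingularBoundaryMap Hb Hhb) (V : Hh ≃ₗᵢ[ℂ] Hhb) (y : S.dom) :
    WithLp 2 (SpaceH₀ H Hh × Hb) :=
  osum (osum (S.Ga0 Xa y) ((1 / 2 : ℂ) • (S.Gah Xa y + V.symm (Γb.Gh y)))) (-Γb.G1 y)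

end Maps

end SymmetricSystem

end

set_option linter.unusedSectionVars false

noncomputable section

/-! ### Absolutely continuous functions with values in a Banach space -/

namespace AbsolutelyContinuousOnInterval

variable {X Y Z : Type*} [PseudoMetricSpace X] [PseudoMetricSpace Y] [PseudoMetricSpace Z]

/-! Everything rests on the Lagrange identity. For `{y, f}`, `{z, g}` in the maximal relation,
integrating the derivative of `(J y, z)` over `[a, β]` and letting `β ↑ b` gives `(f, z)_Δ - (y,
g)_Δ = [y, z]_b - (J y(a), z(a))`. The right side is an explicit form in `Γ_a y = X_a y(a)` and `Γ_b
y`. A triplet therefore needs three things: that `T_min` is closed with adjoint `T_max`; that an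
element of `T_max` determines its absolutely continuous representative, which is definiteness
(`exists_representative`); and that `Γ_a y` and `Γ_b y` can be prescribed independently
(`exists_boundary_values`). The rest is algebra: the middle terms `± i (Γ̂_b y, Γ̂_b z)` and `- i
(Γ̂_a y, Γ̂_a z)` are paired off against each other where their signs differ, and what is left over
is the `P₂` term, whose sign is `α`.

The adjoint is computed by steering. Definiteness already holds on some `[a, β₀]`
(`exists_definite`), so the Gram operator of the homogeneous solutions there is invertible, and any
value at `a` can be driven to zero before `b` (`exists_mem_tmax`). If `{z, g}` lies in the adjoint
of `T_min` and `w` solves `J w' - B w = Δ g`, then on each `[a, β]` the function `z - w` is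
orthogonal to every right-hand side that is orthogonal to the homogeneous solutions; hence, modulo
null elements, it is itself a homogeneous solution, and by definiteness the same one for all large
`β` (`adjoint_Tmin`). Conversely the adjoint of `T_max` is `T_min` (`adjoint_Tmax`), which also
gives closedness.

For the statement on equal deficiency indices, the form `-i ((f', f) - (f, f'))` is positive on `ker
(T_min* - i)`, negative on `ker (T_min* + i)`, and by von Neumann's decomposition the two together
account for all boundary values. So `n₊` and `n₋` are the numbers of positive and negative squares
of the boundary form, and these are read off after a Cayley change of coordinates `G0 ± i G1`
(`finrank_eq_of_deficiency_eq`, `HasSign.re_boundaryForm`). Von Neumann's decomposition needs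
`L²_Δ(I)` to be complete, which is proved separately because `Δ` may be degenerate. -/

theorem of_dist_le_add {f : ℝ → X} {y : ℝ → Y} {z : ℝ → Z} {a b : ℝ} (C : ℝ)
    (hy : AbsolutelyContinuousOnInterval y a b) (hz : AbsolutelyContinuousOnInterval z a b)
    (h : ∀ s ∈ Set.uIcc a b, ∀ t ∈ Set.uIcc a b,
      dist (f s) (f t) ≤ C * (dist (y s) (y t) + dist (z s) (z t))) :
    AbsolutelyContinuousOnInterval f a b := by
  unfold AbsolutelyContinuousOnInterval at hy hz
  -- Over a finite disjoint family of intervals the variation of `f` is at most `C` times the sum of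
  -- those of `y` and `z`, which tends to zero with the total length.
  refine squeeze_zero' (.of_forall fun _ => Finset.sum_nonneg fun i _ => dist_nonneg) ?_
    (by simpa using (hy.add hz).const_mul C)
  rw [eventually_inf_principal]
  filter_upwards with E hE
  rw [← Finset.sum_add_distrib, Finset.mul_sum]
  exact Finset.sum_le_sum fun i hi => h _ (hE.1 i hi).1 _ (hE.1 i hi).2

theorem of_dist_le {f : ℝ → X} {y : ℝ → Y} {a b : ℝ} (C : ℝ)
    (hy : AbsolutelyContinuousOnInterval y a b)
    (h : ∀ s ∈ Set.uIcc a b, ∀ t ∈ Set.uIcc a b, dist (f s) (f t) ≤ C * dist (y s) (y t)) :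
    AbsolutelyContinuousOnInterval f a b := by
  refine of_dist_le_add (C / 2) hy hy fun s hs t ht => (h s hs t ht).trans_eq ?_
  ring

theorem congr {f g : ℝ → X} {a b : ℝ} (hf : AbsolutelyContinuousOnInterval f a b)
    (h : Set.EqOn g f (Set.uIcc a b)) : AbsolutelyContinuousOnInterval g a b :=
  of_dist_le 1 hf fun s hs t ht => by rw [h hs, h ht, one_mul]

variable {E : Type*} [NormedAddCommGroup E] [NormedSpace ℝ E]

/-- An increment of the primitive is dominated by the increment of the primitive of `‖g‖`, which
reduces the vector-valued case to the scalar one. -/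
theorem intervalIntegral {g : ℝ → E} {a b c : ℝ}
    (hg : IntervalIntegrable g volume a b) (hc : c ∈ Set.uIcc a b) :
    AbsolutelyContinuousOnInterval (fun t => ∫ s in c..t, g s) a b := by
  refine of_dist_le 1 (hg.norm.absolutelyContinuousOnInterval_intervalIntegral hc)
    fun s hs t ht => ?_
  have h1 : ∀ u ∈ Set.uIcc a b, IntervalIntegrable g volume c u := fun u hu =>
    hg.mono_set (Set.uIcc_subset_uIcc hc hu)
  rw [one_mul, dist_comm (∫ v in c..s, g v), dist_comm (∫ v in c..s, ‖g v‖), dist_eq_norm,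
    Real.dist_eq,
    intervalIntegral.integral_interval_sub_left (h1 t ht) (h1 s hs),
    intervalIntegral.integral_interval_sub_left (h1 t ht).norm (h1 s hs).norm]
  exact intervalIntegral.norm_integral_le_abs_integral_norm

/-- The difference of `y` and the primitive of `g` is absolutely continuous with derivative zero
almost everywhere, hence constant. -/
theorem eq_add_integral [CompleteSpace E] {y g : ℝ → E} {a b : ℝ}
    (hab : a ≤ b) (hy : AbsolutelyContinuousOnInterval y a b)
    (hg : IntervalIntegrable g volume a b)
    (h : ∀ᵐ t, t ∈ Set.Icc a b → HasDerivAt y (g t) t) {t : ℝ} (ht : t ∈ Set.Icc a b) :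
    y t = y a + ∫ s in a..t, g s := by
  have hac := hy.sub (intervalIntegral hg (c := a) Set.left_mem_uIcc)
  obtain ⟨C, hC⟩ := hac.const_of_ae_hasDerivAt_zero (by
    filter_upwards [h, hg.ae_hasDerivAt_integral] with t h1 h2 ht
    rw [← sub_self (g t)]
    exact (h1 (Set.uIcc_of_le hab ▸ ht)).sub (h2 ht a Set.left_mem_uIcc))
  have h1 := hC t (Set.uIcc_of_le hab ▸ ht)
  have h2 := hC a Set.left_mem_uIcc
  simp only [Pi.sub_apply, intervalIntegral.integral_same, sub_zero] at h1 h2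
  rw [h2, ← h1]
  abel

end AbsolutelyContinuousOnInterval

/-! ### Linear differential equations with integrable coefficients -/

section LinearODE

/-- The integrand is half the derivative of `exp (2 m)`, where `m` is the primitive of `k`. Since
`m` is only absolutely continuous, the chain rule holds almost everywhere; `exp` is Lipschitz on the
bounded range of `2 m`, so `exp (2 m)` is absolutely continuous and is recovered from its
derivative. -/
theorem integral_mul_exp_primitive {k : ℝ → ℝ} {a T : ℝ}
    (hk : IntervalIntegrable k volume a T) :
    ∫ s in a..T, k s * Real.exp (2 * ∫ r in a..s, k r) =
      (Real.exp (2 * ∫ r in a..T, k r) - 1) / 2 := by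
  have hm := AbsolutelyContinuousOnInterval.intervalIntegral hk (c := a) Set.left_mem_uIcc
  have h2m := hm.const_mul 2
  obtain ⟨C, hC⟩ := h2m.exists_bound
  have hac : AbsolutelyContinuousOnInterval
      (fun s => Real.exp (2 * ∫ r in a..s, k r)) a T := by
    obtain ⟨K, hK⟩ := (Real.contDiff_exp (n := 1)).contDiffOn.exists_lipschitzOnWith
      (s := Set.Icc (-C) C) (by decide) (convex_Icc _ _) isCompact_Icc
    refine AbsolutelyContinuousOnInterval.of_dist_le K h2m fun s hs t ht => ?_
    exact hK.dist_le_mul _ (abs_le.1 (hC s hs)) _ (abs_le.1 (hC t ht))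
  have h := hac.integral_deriv_eq_sub
  rw [intervalIntegral.integral_same, mul_zero, Real.exp_zero] at h
  rw [← h, eq_div_iff two_ne_zero, ← intervalIntegral.integral_mul_const]
  refine intervalIntegral.integral_congr_ae ?_
  filter_upwards [hk.ae_hasDerivAt_integral] with s hs hs'
  have := ((hs (Set.uIoc_subset_uIcc hs') a Set.left_mem_uIcc).const_mul 2).exp
  rw [this.deriv]
  ring

/-- The factor 2 in the exponent is what produces the contraction constant 1/2 used below. -/
theorem integral_mul_exp_primitive_le {k : ℝ → ℝ} {a T : ℝ}
    (hk : IntervalIntegrable k volume a T) :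
    ∫ s in a..T, k s * Real.exp (2 * ∫ r in a..s, k r) ≤
      Real.exp (2 * ∫ r in a..T, k r) / 2 := by
  rw [integral_mul_exp_primitive hk]
  linarith

variable {E : Type*} [NormedAddCommGroup E] [NormedSpace ℝ E]

theorem intervalIntegrable_clm_apply {A : ℝ → E →L[ℝ] E} {y : ℝ → E} {a b : ℝ}
    (hA : IntervalIntegrable A volume a b) (hy : ContinuousOn y (Set.uIcc a b)) :
    IntervalIntegrable (fun s => A s (y s)) volume a b := by
  obtain ⟨C, hC⟩ := isCompact_uIcc.exists_bound_of_continuousOn hy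
  rw [intervalIntegrable_iff] at hA ⊢
  have hym : AEStronglyMeasurable y (volume.restrict (Set.uIoc a b)) :=
    (hy.aestronglyMeasurable measurableSet_uIcc).mono_set Set.uIoc_subset_uIcc
  refine Integrable.mono' (hA.norm.mul_const C) ?_ ?_
  · exact (isBoundedBilinearMap_apply (𝕜 := ℝ) (E := E)
      (F := E)).continuous.comp_aestronglyMeasurable (hA.aestronglyMeasurable.prodMk hym)
  · refine (ae_restrict_iff' measurableSet_uIoc).2 (.of_forall fun t ht => ?_)
    exact (A t).le_opNorm_of_le (hC t (Set.uIoc_subset_uIcc ht))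

/-- The basic weighted estimate behind existence and uniqueness. -/
theorem norm_integral_clm_apply_le {A : ℝ → E →L[ℝ] E} {y : ℝ → E} {a T M : ℝ} (haT : a ≤ T)
    (hA : IntervalIntegrable A volume a T) (hM : 0 ≤ M)
    (hb : ∀ s ∈ Set.Icc a T, ‖y s‖ ≤ Real.exp (2 * ∫ r in a..s, ‖A r‖) * M) :
    ‖∫ s in a..T, A s (y s)‖ ≤ Real.exp (2 * ∫ r in a..T, ‖A r‖) / 2 * M := by
  have hm := AbsolutelyContinuousOnInterval.intervalIntegral hA.norm (c := a) Set.left_mem_uIcc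
  have hcont : ContinuousOn (fun s => Real.exp (2 * ∫ r in a..s, ‖A r‖)) (Set.uIcc a T) :=
    Real.continuous_exp.comp_continuousOn (continuousOn_const.mul hm.continuousOn)
  refine (intervalIntegral.norm_integral_le_of_norm_le haT (.of_forall fun s hs => ?_)
    ((hA.norm.mul_continuousOn hcont).mul_const M)).trans ?_
  · refine ((A s).le_opNorm_of_le (hb s (Set.Ioc_subset_Icc_self hs))).trans_eq ?_
    ring
  · rw [intervalIntegral.integral_mul_const]
    exact mul_le_mul_of_nonneg_right (integral_mul_exp_primitive_le hA.norm) hM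

/-- Gronwall by a weighted maximum: if `M` is the maximum of `exp (-2 m) ‖y‖` with `m` the primitive
of `‖A‖`, the weighted estimate at a maximum point gives `M ≤ M / 2`. -/
theorem eq_zero_of_eq_integral {A : ℝ → E →L[ℝ] E} {y : ℝ → E} {a b : ℝ} (hab : a ≤ b)
    (hA : IntervalIntegrable A volume a b) (hy : ContinuousOn y (Set.Icc a b))
    (h : ∀ t ∈ Set.Icc a b, y t = ∫ s in a..t, A s (y s)) :
    ∀ t ∈ Set.Icc a b, y t = 0 := by
  have hm := AbsolutelyContinuousOnInterval.intervalIntegral hA.norm (c := a) Set.left_mem_uIcc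
  have hmc := hm.continuousOn
  rw [Set.uIcc_of_le hab] at hmc
  have hcont : ContinuousOn (fun t => Real.exp (-(2 * ∫ r in a..t, ‖A r‖)) * ‖y t‖)
      (Set.Icc a b) :=
    (Real.continuous_exp.comp_continuousOn (continuousOn_const.mul hmc).neg).mul hy.norm
  obtain ⟨t₀, ht₀, hmax⟩ := isCompact_Icc.exists_isMaxOn ⟨a, Set.left_mem_Icc.2 hab⟩ hcont
  set M := Real.exp (-(2 * ∫ r in a..t₀, ‖A r‖)) * ‖y t₀‖ with hMdef
  have hM : 0 ≤ M := by positivity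
  have hb : ∀ s ∈ Set.Icc a b, ‖y s‖ ≤ Real.exp (2 * ∫ r in a..s, ‖A r‖) * M := by
    intro s hs
    have := hmax hs
    simp only [Set.mem_ofPred_eq] at this
    rw [Real.exp_neg, inv_mul_le_iff₀ (Real.exp_pos _)] at this
    exact this
  have h1 := norm_integral_clm_apply_le ht₀.1
    (hA.mono_set (Set.uIcc_subset_uIcc_left (Set.uIcc_of_le hab ▸ ht₀))) hM
    fun s hs => hb s ⟨hs.1, hs.2.trans ht₀.2⟩
  rw [← h t₀ ht₀] at h1
  have h2 : M ≤ M / 2 := by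
    rw [hMdef, Real.exp_neg, inv_mul_le_iff₀ (Real.exp_pos _)]
    refine h1.trans_eq ?_
    rw [hMdef, Real.exp_neg]
    ring
  have hM0 : M = 0 := by linarith
  intro t ht
  simpa [hM0] using hb t ht

variable [CompleteSpace E]

/-- Picard iteration in a weighted sup norm: with `y = exp (2 m) v` and `m` the primitive of `‖A‖`,
the integral equation becomes a fixed-point problem for the bounded continuous function `v`, with a
contraction of constant 1/2 on the whole half-line at once. -/
theorem exists_eq_add_integral {A : ℝ → E →L[ℝ] E} {h : ℝ → E} {a : ℝ} (hA : Integrable A)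
    (hh : Integrable h) (c : E) :
    ∃ y : ℝ → E, Continuous y ∧ ∀ t, a ≤ t → y t = c + ∫ s in a..t, (A s (y s) + h s) := by
  have hAi : ∀ p q, IntervalIntegrable A volume p q := fun p q => hA.intervalIntegrable
  have hhi : ∀ p q, IntervalIntegrable h volume p q := fun p q => hh.intervalIntegrable
  set m : ℝ → ℝ := fun t => ∫ r in a..t, ‖A r‖ with hm
  have hmc : Continuous m := intervalIntegral.continuous_primitive (fun p q => (hAi p q).norm) a
  have hm0 : ∀ t, a ≤ t → 0 ≤ m t := fun t ht =>
    intervalIntegral.integral_nonneg ht fun _ _ => norm_nonneg _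
  have hec : Continuous fun t => Real.exp (2 * m t) := by fun_prop
  have hvi : ∀ (v : BoundedContinuousFunction ℝ E) (p q : ℝ),
      IntervalIntegrable (fun s => A s (Real.exp (2 * m s) • v s)) volume p q := fun v p q =>
    intervalIntegrable_clm_apply (hAi p q) (hec.smul v.continuous).continuousOn
  have hest : ∀ (v : BoundedContinuousFunction ℝ E) (t : ℝ), a ≤ t →
      ‖∫ s in a..t, A s (Real.exp (2 * m s) • v s)‖ ≤ Real.exp (2 * m t) / 2 * ‖v‖ := fun v t ht =>
    norm_integral_clm_apply_le ht (hAi a t) (norm_nonneg v) fun s _ => by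
      rw [norm_smul, Real.norm_of_nonneg (Real.exp_pos _).le]
      gcongr
      exact v.norm_coe_le_norm s
  -- The argument `max a t` freezes the values to the left of `a`, so that the iterates are bounded
  -- continuous functions on all of `ℝ`.
  let F : BoundedContinuousFunction ℝ E → ℝ → E := fun v t =>
    Real.exp (-(2 * m (max a t))) •
      (c + (∫ s in a..max a t, A s (Real.exp (2 * m s) • v s)) + ∫ s in a..max a t, h s)
  have hFc : ∀ v, Continuous (F v) := by
    intro v
    have h1 := (intervalIntegral.continuous_primitive (hvi v) a).comp
      (continuous_const.max continuous_id : Continuous fun t => max a t)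
    have h2 := (intervalIntegral.continuous_primitive hhi a).comp
      (continuous_const.max continuous_id : Continuous fun t => max a t)
    have h3 := hmc.comp (continuous_const.max continuous_id : Continuous fun t => max a t)
    exact (Real.continuous_exp.comp (continuous_const.mul h3).neg).smul
      ((continuous_const.add h1).add h2)
  have hFb : ∀ v t, ‖F v t‖ ≤ ‖c‖ + ‖v‖ / 2 + ∫ s, ‖h s‖ := by
    intro v t
    have hat : a ≤ max a t := le_max_left _ _
    have e1 : Real.exp (-(2 * m (max a t))) ≤ 1 :=
      Real.exp_le_one_iff.2 (by linarith [hm0 _ hat])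
    have e2 : ‖∫ s in a..max a t, h s‖ ≤ ∫ s, ‖h s‖ := by
      rw [intervalIntegral.integral_of_le hat]
      exact (norm_integral_le_integral_norm _).trans
        (setIntegral_le_integral hh.norm (.of_forall fun _ => norm_nonneg _))
    have e3 := hest v _ hat
    have e4 : Real.exp (-(2 * m (max a t))) * ‖∫ s in a..max a t, A s (Real.exp (2 * m s) • v s)‖
        ≤ ‖v‖ / 2 := by
      rw [Real.exp_neg, inv_mul_le_iff₀ (Real.exp_pos _)]
      linarith
    simp only [F]
    rw [smul_add, smul_add]
    refine (norm_add₃_le).trans ?_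
    simp only [norm_smul, Real.norm_of_nonneg (Real.exp_pos _).le]
    have e5 := mul_le_mul_of_nonneg_right e1 (norm_nonneg c)
    have e6 := mul_le_mul_of_nonneg_right e1 (norm_nonneg (∫ s in a..max a t, h s))
    linarith
  let Φ : BoundedContinuousFunction ℝ E → BoundedContinuousFunction ℝ E := fun v =>
    BoundedContinuousFunction.ofNormedAddCommGroup (F v) (hFc v) _ (hFb v)
  have hΦ : ContractingWith (1 / 2) Φ := by
    refine ⟨by rw [← NNReal.coe_lt_coe]; norm_num, LipschitzWith.of_dist_le_mul fun v w => ?_⟩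
    rw [BoundedContinuousFunction.dist_le (by positivity)]
    intro t
    have hat : a ≤ max a t := le_max_left _ _
    have e3 := hest (v - w) _ hat
    have : Φ v t - Φ w t = Real.exp (-(2 * m (max a t))) •
        ∫ s in a..max a t, A s (Real.exp (2 * m s) • (v - w) s) := by
      change F v t - F w t = _
      simp only [F]
      rw [← smul_sub, add_sub_add_right_eq_sub, add_sub_add_left_eq_sub,
        ← intervalIntegral.integral_sub (hvi v _ _) (hvi w _ _)]
      simp [smul_sub]
    rw [dist_eq_norm, this, norm_smul, Real.norm_of_nonneg (Real.exp_pos _).le, Real.exp_neg,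
      inv_mul_le_iff₀ (Real.exp_pos _), dist_eq_norm]
    refine e3.trans_eq ?_
    push_cast
    ring
  obtain ⟨v, hv⟩ : ∃ v, Φ v = v := ⟨_, hΦ.fixedPoint_isFixedPt⟩
  refine ⟨fun t => Real.exp (2 * m t) • v t, hec.smul v.continuous, fun t ht => ?_⟩
  have h1 : v t = F v t := by
    conv_lhs => rw [← hv]
    rfl
  simp only [F, max_eq_right ht] at h1
  simp only
  rw [h1, smul_smul, ← Real.exp_add, add_neg_cancel, Real.exp_zero, one_smul,
    intervalIntegral.integral_add (hvi v a t) (hhi a t), add_assoc]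

theorem exists_eq_add_integral_of_integrableOn {A : ℝ → E →L[ℝ] E} {h : ℝ → E} {a b : ℝ}
    (hA : IntegrableOn A (Set.Icc a b)) (hh : IntegrableOn h (Set.Icc a b)) (c : E) :
    ∃ y : ℝ → E, Continuous y ∧
      ∀ t ∈ Set.Icc a b, y t = c + ∫ s in a..t, (A s (y s) + h s) := by
  have hA' : Integrable ((Set.Icc a b).indicator A) :=
    IntegrableOn.integrable_indicator (ε' := E →L[ℝ] E) hA measurableSet_Icc
  have hh' : Integrable ((Set.Icc a b).indicator h) := hh.integrable_indicator measurableSet_Icc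
  obtain ⟨y, hyc, hy⟩ := exists_eq_add_integral hA' hh' (a := a) c
  refine ⟨y, hyc, fun t ht => ?_⟩
  rw [hy t ht.1]
  congr 1
  refine intervalIntegral.integral_congr fun s hs => ?_
  rw [Set.uIcc_of_le ht.1] at hs
  have hs' : s ∈ Set.Icc a b := ⟨hs.1, hs.2.trans ht.2⟩
  simp only [Set.indicator_of_mem hs']

end LinearODE

/-! ### The operator `J` -/

section OpJ

variable {H Hh : Type*} [NormedAddCommGroup H] [InnerProductSpace ℂ H]
  [NormedAddCommGroup Hh] [InnerProductSpace ℂ Hh]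

theorem BoldH.inner_eq (x y : BoldH H Hh) :
    (inner ℂ x y : ℂ) = inner ℂ (BoldH.blocks x).fst.fst (BoldH.blocks y).fst.fst
      + inner ℂ (BoldH.blocks x).fst.snd (BoldH.blocks y).fst.snd
      + inner ℂ (BoldH.blocks x).snd (BoldH.blocks y).snd := by
  rw [← BoldH.blocks.inner_map_map x y, WithLp.prod_inner_apply, WithLp.prod_inner_apply]
  rfl

@[simp] theorem blocks_opJ (x : BoldH H Hh) :
    BoldH.blocks (opJ H Hh x) = osum (osum (-(BoldH.blocks x).snd)
      (Complex.I • (BoldH.blocks x).fst.snd)) (BoldH.blocks x).fst.fst :=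
  LinearIsometryEquiv.apply_symm_apply _ _

theorem BoldH.ext_blocks {x y : BoldH H Hh}
    (h0 : (BoldH.blocks x).fst.fst = (BoldH.blocks y).fst.fst)
    (hh : (BoldH.blocks x).fst.snd = (BoldH.blocks y).fst.snd)
    (h1 : (BoldH.blocks x).snd = (BoldH.blocks y).snd) : x = y := by
  apply BoldH.blocks.injective
  exact WithLp.ofLp_injective 2 (Prod.ext (WithLp.ofLp_injective 2 (Prod.ext h0 hh)) h1)

@[simp] theorem opJ_opJ (x : BoldH H Hh) : opJ H Hh (opJ H Hh x) = -x := by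
  apply BoldH.ext_blocks <;> simp [smul_smul]

theorem inner_opJ_right (x y : BoldH H Hh) :
    (inner ℂ x (opJ H Hh y) : ℂ) =
      -inner ℂ (BoldH.blocks x).fst.fst (BoldH.blocks y).snd
      + Complex.I * inner ℂ (BoldH.blocks x).fst.snd (BoldH.blocks y).fst.snd
      + inner ℂ (BoldH.blocks x).snd (BoldH.blocks y).fst.fst := by
  rw [BoldH.inner_eq, blocks_opJ]
  simp

theorem inner_opJ_left (x y : BoldH H Hh) :
    (inner ℂ (opJ H Hh x) y : ℂ) = -inner ℂ x (opJ H Hh y) := by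
  rw [inner_opJ_right, BoldH.inner_eq, blocks_opJ]
  simp
  ring

theorem opJ_injective : Function.Injective (opJ H Hh) := by
  intro x y h
  have := congrArg (opJ H Hh) h
  simpa using this

end OpJ

namespace SymmetricSystem

variable {H Hh : Type*} [NormedAddCommGroup H] [InnerProductSpace ℂ H]
  [NormedAddCommGroup Hh] [InnerProductSpace ℂ Hh]

/-! ### The interval and the filter `t ↑ b` -/

section Interval

variable (S : SymmetricSystem H Hh)

theorem le_of_mem {t : ℝ} (ht : t ∈ S.I) : S.a ≤ t := by
  rcases S.hI with h | h <;> (rw [h] at ht; exact ht.1)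

theorem mem_of_lt {t : ℝ} (h1 : S.a ≤ t) (h2 : (t : EReal) < S.b) : t ∈ S.I := by
  rcases S.hI with h | h <;> rw [h]
  exacts [⟨h1, h2⟩, ⟨h1, h2.le⟩]

theorem a_mem : S.a ∈ S.I := S.mem_of_lt le_rfl S.hab

theorem mem_of_le {s t : ℝ} (ht : t ∈ S.I) (h1 : S.a ≤ s) (h2 : s ≤ t) : s ∈ S.I := by
  rcases S.hI with h | h <;> rw [h] at ht ⊢
  · exact ⟨h1, (EReal.coe_le_coe_iff.2 h2).trans_lt ht.2⟩
  · exact ⟨h1, (EReal.coe_le_coe_iff.2 h2).trans ht.2⟩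

theorem Icc_subset {s t : ℝ} (ht : t ∈ S.I) (hs : S.a ≤ s) : Set.Icc s t ⊆ S.I :=
  fun _ hr => S.mem_of_le ht (hs.trans hr.1) hr.2

theorem measurableSet_I : MeasurableSet S.I := by
  rcases S.hI with h | h <;> rw [h]
  · exact (measurableSet_le measurable_const measurable_id).inter
      (measurableSet_lt measurable_coe_real_ereal measurable_const)
  · exact (measurableSet_le measurable_const measurable_id).inter
      (measurableSet_le measurable_coe_real_ereal measurable_const)

/-- Almost every point of `I` is interior, which is where derivatives of functions known only on `I`
make sense. -/
theorem ae_lt : ∀ᵐ t ∂volume.restrict S.I, S.a < t ∧ (t : EReal) < S.b := by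
  rw [ae_restrict_iff' S.measurableSet_I]
  have h1 : ∀ᵐ t : ℝ, t ≠ S.a := by simp [ae_iff]
  -- For `b = ⊤` the value `S.b.toReal` is a harmless default: the exclusion is only used against a
  -- real `t` equal to `b`.
  have h2 : ∀ᵐ t : ℝ, t ≠ S.b.toReal := by simp [ae_iff]
  filter_upwards [h1, h2] with t ht1 ht2 htI
  refine ⟨lt_of_le_of_ne (S.le_of_mem htI) ht1.symm, ?_⟩
  have : (t : EReal) ≤ S.b := by
    rcases S.hI with h | h <;> rw [h] at htI
    exacts [htI.2.le, htI.2]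
  refine lt_of_le_of_ne this fun h => ht2 ?_
  rw [← h, EReal.toReal_coe]

theorem mem_nhds_of_lt {t : ℝ} (h1 : S.a < t) (h2 : (t : EReal) < S.b) : S.I ∈ 𝓝 t := by
  have : ∀ᶠ s : ℝ in 𝓝 t, (s : EReal) < S.b :=
    continuous_coe_real_ereal.continuousAt.eventually (Iio_mem_nhds h2)
  filter_upwards [this, Ioi_mem_nhds h1] with s hs1 hs2
  exact S.mem_of_lt (le_of_lt hs2) hs1

instance : S.atB.IsCountablyGenerated := by
  unfold atB; infer_instance

theorem eventually_atB {s : ℝ} (hs : (s : EReal) < S.b) :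
    ∀ᶠ t in S.atB, s < t ∧ (t : EReal) < S.b := by
  refine mem_comap.2 ⟨Set.Ioo (s : EReal) S.b, Ioo_mem_nhdsLT hs, fun t ht => ?_⟩
  exact ⟨EReal.coe_lt_coe_iff.1 ht.1, ht.2⟩

theorem eventually_mem : ∀ᶠ t in S.atB, t ∈ S.I :=
  (S.eventually_atB S.hab).mono fun _ ht => S.mem_of_lt ht.1.le ht.2

instance : S.atB.NeBot := by
  refine comap_neBot fun u hu => ?_
  obtain ⟨l, hl, hu⟩ := (mem_nhdsLT_iff_exists_Ioo_subset' S.hab).1 hu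
  obtain ⟨x, hx1, hx2⟩ := EReal.lt_iff_exists_real_btwn.1 hl
  exact ⟨x, hu ⟨hx1, hx2⟩⟩

theorem aecover_Iic : AECover (volume.restrict S.I) S.atB fun t => Set.Iic t where
  ae_eventually_mem := by
    filter_upwards [S.ae_lt] with s hs
    exact (S.eventually_atB hs.2).mono fun t ht => ht.1.le
  measurableSet _ := measurableSet_Iic

theorem restrict_Iic {t : ℝ} (ht : t ∈ S.I) :
    (volume.restrict S.I).restrict (Set.Iic t) = volume.restrict (Set.Icc S.a t) := by
  rw [Measure.restrict_restrict measurableSet_Iic]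
  congr 1
  ext s
  exact ⟨fun hs => ⟨S.le_of_mem hs.2, hs.1⟩, fun hs => ⟨hs.2, S.mem_of_le ht hs.1 hs.2⟩⟩

theorem tendsto_integral_atB {E : Type*} [NormedAddCommGroup E] [NormedSpace ℝ E] {f : ℝ → E}
    (hf : IntegrableOn f S.I) :
    Tendsto (fun t => ∫ s in S.a..t, f s) S.atB (𝓝 (∫ s in S.I, f s)) := by
  refine (S.aecover_Iic.integral_tendsto_of_countably_generated hf).congr' ?_
  filter_upwards [S.eventually_mem] with t ht
  rw [S.restrict_Iic ht, intervalIntegral.integral_of_le (S.le_of_mem ht),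
    integral_Icc_eq_integral_Ioc]

/-- A property which holds almost everywhere on `[a, β]` for all large `β < b` holds almost
everywhere on `I`. -/
theorem ae_of_forall_Icc {p : ℝ → Prop} {β₀ : ℝ} (hβ₀ : (β₀ : EReal) < S.b)
    (h : ∀ β, β₀ < β → (β : EReal) < S.b → β ∈ S.I → ∀ᵐ t ∂volume.restrict (Set.Icc S.a β), p t) :
    ∀ᵐ t ∂volume.restrict S.I, p t := by
  -- A sequence tending to `b` replaces the uncountable family of `β` by countably many exceptional
  -- null sets.
  obtain ⟨x, hx⟩ := S.atB.exists_seq_tendsto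
  have hn : ∀ n, ∀ᵐ t ∂volume.restrict S.I,
      (β₀ < x n ∧ (x n : EReal) < S.b) → x n ∈ S.I → t ≤ x n → p t := by
    intro n
    by_cases h1 : (β₀ < x n ∧ (x n : EReal) < S.b) ∧ x n ∈ S.I
    · have := h (x n) h1.1.1 h1.1.2 h1.2
      rw [← S.restrict_Iic h1.2, ae_restrict_iff' measurableSet_Iic] at this
      filter_upwards [this] with t ht _ _ h3 using ht h3
    · exact .of_forall fun t h2 h3 => absurd ⟨h2, h3⟩ h1
  filter_upwards [S.ae_lt, ae_all_iff.2 hn] with t ht htn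
  obtain ⟨n, h1, h2, h3⟩ := (hx.eventually ((S.eventually_atB ht.2).and
    ((S.eventually_atB hβ₀).and S.eventually_mem))).exists
  exact htn n h2 h3 h1.1.le

end Interval

/-! ### Solutions of `J y' - B y = h` -/

/-- `h` is integrable on each `[a, β] ⊆ I`. -/
def LocInt (S : SymmetricSystem H Hh) (h : ℝ → BoldH H Hh) : Prop :=
  ∀ β ∈ S.I, IntegrableOn h (Set.Icc S.a β)

/-- The linear space of pairs `{y, h}` with `y` absolutely continuous and `J y' - B y = h`. -/
def solutions (S : SymmetricSystem H Hh) : Submodule ℂ ((ℝ → BoldH H Hh) × (ℝ → BoldH H Hh)) where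
  carrier := {p | S.IsAC p.1 ∧ ∀ᵐ t ∂volume.restrict S.I, DifferentiableAt ℝ p.1 t ∧
    opJ H Hh (deriv p.1 t) - S.B t (p.1 t) = p.2 t}
  zero_mem' := by
    refine ⟨fun β _ => ?_, .of_forall fun t => ⟨differentiableAt_const _, ?_⟩⟩
    · simpa [AbsolutelyContinuousOnInterval] using tendsto_const_nhds
    · simp
  add_mem' := by
    rintro p q ⟨hp1, hp2⟩ ⟨hq1, hq2⟩
    refine ⟨fun β hβ => (hp1 β hβ).add (hq1 β hβ), ?_⟩
    filter_upwards [hp2, hq2] with t h1 h2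
    refine ⟨h1.1.add h2.1, ?_⟩
    rw [Prod.fst_add, Prod.snd_add, deriv_add h1.1 h2.1, Pi.add_apply, Pi.add_apply, map_add,
      map_add, ← h1.2, ← h2.2]
    abel
  smul_mem' := by
    rintro c p ⟨hp1, hp2⟩
    refine ⟨fun β hβ => (hp1 β hβ).const_smul c, ?_⟩
    filter_upwards [hp2] with t h1
    refine ⟨h1.1.const_smul c, ?_⟩
    rw [Prod.smul_fst, Prod.smul_snd, (h1.1.hasDerivAt.const_smul c).deriv, Pi.smul_apply,
      Pi.smul_apply, map_smul, map_smul, ← h1.2, smul_sub]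

section Solutions

variable {S : SymmetricSystem H Hh}

theorem IsAC.on_Icc {y : ℝ → BoldH H Hh} (hy : S.IsAC y) {s t : ℝ} (hs : S.a ≤ s) (hst : s ≤ t)
    (ht : t ∈ S.I) : AbsolutelyContinuousOnInterval y s t := by
  refine (hy t ht).mono ?_
  rw [Set.uIcc_of_le hst, Set.uIcc_of_le (hs.trans hst)]
  exact Set.Icc_subset_Icc_left hs

theorem IsAC.continuousOn {y : ℝ → BoldH H Hh} (hy : S.IsAC y) {β : ℝ} (hβ : β ∈ S.I) :
    ContinuousOn y (Set.Icc S.a β) := by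
  have := (hy β hβ).continuousOn
  rwa [Set.uIcc_of_le (S.le_of_mem hβ)] at this

theorem IsAC.continuousOn_I {y : ℝ → BoldH H Hh} (hy : S.IsAC y) : ContinuousOn y S.I := by
  intro t ht
  by_cases hmax : ∃ β ∈ S.I, t < β
  · obtain ⟨β, hβ, htβ⟩ := hmax
    refine (hy.continuousOn hβ t ⟨S.le_of_mem ht, htβ.le⟩).mono_of_mem_nhdsWithin ?_
    exact mem_nhdsWithin.2 ⟨Set.Iio β, isOpen_Iio, htβ, fun s hs => ⟨S.le_of_mem hs.2, hs.1.le⟩⟩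
  · push Not at hmax
    exact (hy.continuousOn ht t ⟨S.le_of_mem ht, le_rfl⟩).mono fun s hs =>
      ⟨S.le_of_mem hs, hmax s hs⟩

theorem IsAC.aestronglyMeasurable {y : ℝ → BoldH H Hh} (hy : S.IsAC y) :
    AEStronglyMeasurable y (volume.restrict S.I) :=
  hy.continuousOn_I.aestronglyMeasurable S.measurableSet_I

theorem IsAC.congr {y z : ℝ → BoldH H Hh} (hy : S.IsAC y) (h : Set.EqOn z y S.I) : S.IsAC z :=
  fun β hβ => (hy β hβ).congr fun _ ht => h (S.Icc_subset hβ le_rfl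
    (Set.uIcc_of_le (S.le_of_mem hβ) ▸ ht))

theorem solutions_congr {y z h k : ℝ → BoldH H Hh} (hy : (y, h) ∈ S.solutions)
    (hyz : Set.EqOn z y S.I) (hk : k =ᵐ[volume.restrict S.I] h) : (z, k) ∈ S.solutions := by
  refine ⟨hy.1.congr hyz, ?_⟩
  filter_upwards [hy.2, hk, S.ae_lt] with t h1 h2 h3
  have he : z =ᶠ[𝓝 t] y := by
    filter_upwards [S.mem_nhds_of_lt h3.1 h3.2] with s hs using hyz hs
  refine ⟨h1.1.congr_of_eventuallyEq he, ?_⟩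
  rw [he.deriv_eq, he.self_of_nhds, h2]
  exact h1.2

theorem locInt_zero : S.LocInt 0 := fun _ _ => integrableOn_zero

theorem LocInt.intervalIntegrable {h : ℝ → BoldH H Hh} (hh : S.LocInt h) {s t : ℝ}
    (hs : S.a ≤ s) (hst : s ≤ t) (ht : t ∈ S.I) : IntervalIntegrable h volume s t :=
  (intervalIntegrable_iff_integrableOn_Icc_of_le hst).2
    ((hh t ht).mono_set (Set.Icc_subset_Icc_left hs))

/-- Since `J² = -1`, the equation can be solved for `y'`. -/
theorem hasDerivAt_of_mem_solutions {y h : ℝ → BoldH H Hh} (hy : (y, h) ∈ S.solutions) :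
    ∀ᵐ t ∂volume.restrict S.I, HasDerivAt y (-opJ H Hh (S.B t (y t) + h t)) t := by
  filter_upwards [hy.2] with t ht
  have h1 : S.B t (y t) + h t = opJ H Hh (deriv y t) := by
    rw [← ht.2]
    abel
  rw [h1, opJ_opJ, neg_neg]
  exact ht.1.hasDerivAt

variable [FiniteDimensional ℂ H] [FiniteDimensional ℂ Hh]

instance : CompleteSpace (BoldH H Hh) := FiniteDimensional.complete ℂ _

/-- `-J` as a continuous real-linear map. -/
def negJ (H Hh : Type*) [NormedAddCommGroup H] [InnerProductSpace ℂ H]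
    [NormedAddCommGroup Hh] [InnerProductSpace ℂ Hh]
    [FiniteDimensional ℂ H] [FiniteDimensional ℂ Hh] : BoldH H Hh →L[ℂ] BoldH H Hh :=
  LinearMap.toContinuousLinearMap (-opJ H Hh)

@[simp] theorem negJ_apply (x : BoldH H Hh) : negJ H Hh x = -opJ H Hh x := rfl

/-- The coefficient of the system `y' = -J B y - J h`. -/
def coeff (S : SymmetricSystem H Hh) (t : ℝ) : BoldH H Hh →L[ℝ] BoldH H Hh :=
  (ContinuousLinearMap.restrictScalarsL ℂ (BoldH H Hh) (BoldH H Hh) ℝ ℝ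
    (ContinuousLinearMap.compL ℂ _ _ _ (negJ H Hh) (S.B t)))

@[simp] theorem coeff_apply (t : ℝ) (x : BoldH H Hh) : S.coeff t x = -opJ H Hh (S.B t x) := rfl

theorem integrableOn_coeff {β : ℝ} (hβ : β ∈ S.I) : IntegrableOn S.coeff (Set.Icc S.a β) :=
  (ContinuousLinearMap.integrable_comp
    (((ContinuousLinearMap.compL ℂ _ _ _ (negJ H Hh)) :
      (BoldH H Hh →L[ℂ] BoldH H Hh) →L[ℂ] _).restrictScalars ℝ) (S.B_locallyIntegrable β hβ)
      |> fun h => ContinuousLinearMap.integrable_comp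
        (ContinuousLinearMap.restrictScalarsL ℂ (BoldH H Hh) (BoldH H Hh) ℝ ℝ) h)

theorem intervalIntegrable_coeff {s t : ℝ} (hs : S.a ≤ s) (hst : s ≤ t) (ht : t ∈ S.I) :
    IntervalIntegrable S.coeff volume s t :=
  (intervalIntegrable_iff_integrableOn_Icc_of_le hst).2
    ((integrableOn_coeff ht).mono_set (Set.Icc_subset_Icc_left hs))

theorem LocInt.negJ {h : ℝ → BoldH H Hh} (hh : S.LocInt h) :
    S.LocInt fun t => -opJ H Hh (h t) := fun β hβ =>
  ContinuousLinearMap.integrable_comp ((SymmetricSystem.negJ H Hh).restrictScalars ℝ) (hh β hβ)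

theorem eq_add_integral_of_mem_solutions {y h : ℝ → BoldH H Hh} (hy : (y, h) ∈ S.solutions)
    (hh : S.LocInt h) {s t : ℝ} (hs : S.a ≤ s) (hst : s ≤ t) (ht : t ∈ S.I) :
    y t = y s + ∫ r in s..t, (S.coeff r (y r) + -opJ H Hh (h r)) := by
  have hAC := IsAC.on_Icc hy.1 hs hst ht
  refine hAC.eq_add_integral hst
    ((intervalIntegrable_clm_apply (intervalIntegrable_coeff hs hst ht) hAC.continuousOn).add
      (hh.negJ.intervalIntegrable hs hst ht)) ?_ ⟨hst, le_rfl⟩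
  have := (ae_restrict_iff' S.measurableSet_I).1 (hasDerivAt_of_mem_solutions hy)
  filter_upwards [this] with r hr hr'
  have := hr (S.Icc_subset ht hs hr')
  rwa [map_add, neg_add] at this

/-- A solution of the homogeneous system which vanishes at a point vanishes to the right of it. -/
theorem eq_zero_of_mem_solutions {y : ℝ → BoldH H Hh} (hy : (y, 0) ∈ S.solutions)
    {s : ℝ} (hs : S.a ≤ s) (h0 : y s = 0) {t : ℝ} (hst : s ≤ t) (ht : t ∈ S.I) : y t = 0 := by
  have hAC := IsAC.on_Icc hy.1 hs hst ht
  have hc := hAC.continuousOn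
  rw [Set.uIcc_of_le hst] at hc
  refine eq_zero_of_eq_integral hst (intervalIntegrable_coeff hs hst ht) hc (fun r hr => ?_) t
    ⟨hst, le_rfl⟩
  have := eq_add_integral_of_mem_solutions hy locInt_zero hs hr.1
    (S.mem_of_le ht (hs.trans hr.1) hr.2)
  simpa [h0] using this

/-- The coefficients are integrable only on compact segments, so the equation is solved on each `[a,
β]` and the solutions `Y β` are glued along the diagonal `t ↦ Y t t`; uniqueness makes `Y t` and `Y
β` agree at `t ≤ β`. -/
theorem exists_mem_solutions (h : ℝ → BoldH H Hh) (hh : S.LocInt h) (c : BoldH H Hh) :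
    ∃ y, (y, h) ∈ S.solutions ∧ y S.a = c := by
  have hloc : ∀ β ∈ S.I, ∃ y : ℝ → BoldH H Hh, Continuous y ∧ ∀ t ∈ Set.Icc S.a β,
      y t = c + ∫ s in S.a..t, (S.coeff s (y s) + -opJ H Hh (h s)) := by
    exact fun β hβ => exists_eq_add_integral_of_integrableOn (integrableOn_coeff hβ) (hh.negJ β hβ) c
  choose! Y hYc hY using hloc
  have hint : ∀ β ∈ S.I, ∀ t ∈ Set.Icc S.a β,
      IntervalIntegrable (fun s => S.coeff s (Y β s)) volume S.a t := fun β hβ t ht =>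
    intervalIntegrable_clm_apply
      (intervalIntegrable_coeff le_rfl ht.1 (S.mem_of_le hβ ht.1 ht.2)) (hYc β hβ).continuousOn
  have hcons : ∀ β ∈ S.I, ∀ t ∈ Set.Icc S.a β, Y t t = Y β t := by
    intro β hβ t ht
    have htI := S.mem_of_le hβ ht.1 ht.2
    have := eq_zero_of_eq_integral (y := fun s => Y t s - Y β s) ht.1
      (intervalIntegrable_coeff le_rfl ht.1 htI)
      ((hYc t htI).sub (hYc β hβ)).continuousOn (fun s hs => ?_) t ⟨ht.1, le_rfl⟩
    · exact sub_eq_zero.1 this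
    · have hs' : s ∈ Set.Icc S.a β := ⟨hs.1, hs.2.trans ht.2⟩
      have hhi := hh.negJ.intervalIntegrable le_rfl hs.1 (S.mem_of_le htI hs.1 hs.2)
      rw [hY t htI s hs, hY β hβ s hs', add_sub_add_left_eq_sub,
        ← intervalIntegral.integral_sub ((hint t htI s hs).add hhi)
          ((hint β hβ s hs').add hhi)]
      simp only [add_sub_add_right_eq_sub, ← map_sub]
  have hYβ : ∀ β ∈ S.I, Set.EqOn (fun t => Y t t)
      (fun t => c + ∫ s in S.a..t, (S.coeff s (Y s s) + -opJ H Hh (h s))) (Set.Icc S.a β) := by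
    intro β hβ t ht
    change Y t t = _
    rw [hcons β hβ t ht, hY β hβ t ht]
    congr 1
    refine intervalIntegral.integral_congr fun s hs => ?_
    rw [Set.uIcc_of_le ht.1] at hs
    rw [hcons β hβ s ⟨hs.1, hs.2.trans ht.2⟩]
  have hii : ∀ β ∈ S.I, IntervalIntegrable
      (fun s => S.coeff s (Y s s) + -opJ H Hh (h s)) volume S.a β := by
    intro β hβ
    have haβ := S.le_of_mem hβ
    refine (((hint β hβ β ⟨haβ, le_rfl⟩).add (hh.negJ.intervalIntegrable le_rfl haβ hβ))).congr ?_
    intro s hs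
    rw [Set.uIoc_of_le haβ] at hs
    simp only
    rw [hcons β hβ s ⟨hs.1.le, hs.2⟩]
  refine ⟨fun t => Y t t, ⟨fun β hβ => ?_, ?_⟩, ?_⟩
  · refine AbsolutelyContinuousOnInterval.of_dist_le 1
      (AbsolutelyContinuousOnInterval.intervalIntegral (hii β hβ) (c := S.a) Set.left_mem_uIcc)
      fun s hs t ht => ?_
    rw [Set.uIcc_of_le (S.le_of_mem hβ)] at hs ht
    simp only [hYβ β hβ hs, hYβ β hβ ht, dist_add_left, one_mul, le_refl]
  · refine S.ae_of_forall_Icc S.hab fun β _ _ hβ => ?_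
    rw [ae_restrict_iff' measurableSet_Icc]
    have h1 : ∀ᵐ t : ℝ, t ≠ S.a := by simp [ae_iff]
    have h2 : ∀ᵐ t : ℝ, t ≠ β := by simp [ae_iff]
    filter_upwards [(hii β hβ).ae_hasDerivAt_integral, h1, h2] with t ht hta htβ htI
    have hd := (ht (Set.uIcc_of_le (S.le_of_mem hβ) ▸ htI) S.a Set.left_mem_uIcc).const_add c
    have he : (fun t => Y t t) =ᶠ[𝓝 t]
        fun t => c + ∫ s in S.a..t, (S.coeff s (Y s s) + -opJ H Hh (h s)) := by
      filter_upwards [Icc_mem_nhds (lt_of_le_of_ne htI.1 hta.symm) (lt_of_le_of_ne htI.2 htβ)]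
        with s hs using hYβ β hβ hs
    have hd' := hd.congr_of_eventuallyEq he
    refine ⟨hd'.differentiableAt, ?_⟩
    rw [hd'.deriv]
    simp
  · beta_reduce
    rw [hY S.a S.a_mem S.a ⟨le_rfl, le_rfl⟩]
    simp

/-- The Lagrange identity. -/
theorem lagrange_identity {y h z k : ℝ → BoldH H Hh} (hy : (y, h) ∈ S.solutions)
    (hz : (z, k) ∈ S.solutions) (hh : S.LocInt h) (hk : S.LocInt k) {β : ℝ} (hβ : β ∈ S.I) :
    (inner ℂ (z β) (opJ H Hh (y β)) : ℂ) - inner ℂ (z S.a) (opJ H Hh (y S.a)) =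
      ∫ t in S.a..β, (inner ℂ (z t) (h t) - inner ℂ (k t) (y t)) := by
  have haβ := S.le_of_mem hβ
  have hyc := hy.1.continuousOn hβ
  have hzc := hz.1.continuousOn hβ
  obtain ⟨Cy, hCy⟩ := isCompact_Icc.exists_bound_of_continuousOn hyc
  obtain ⟨Cz, hCz⟩ := isCompact_Icc.exists_bound_of_continuousOn hzc
  set C := ‖negJ H Hh‖ * (|Cy| + |Cz|)
  have hn : ∀ x, ‖opJ H Hh x‖ ≤ ‖negJ H Hh‖ * ‖x‖ := fun x => by
    simpa using (negJ H Hh).le_opNorm x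
  -- The increment of the sesquilinear expression splits into one increment in `z` and one in `y`,
  -- each multiplied by a bounded factor.
  have hac : AbsolutelyContinuousOnInterval
      (fun t => (inner ℂ (z t) (opJ H Hh (y t)) : ℂ)) S.a β := by
    refine AbsolutelyContinuousOnInterval.of_dist_le_add C (hy.1 β hβ) (hz.1 β hβ)
      fun s hs t ht => ?_
    rw [Set.uIcc_of_le haβ] at hs ht
    have e : (inner ℂ (z s) (opJ H Hh (y s)) : ℂ) - inner ℂ (z t) (opJ H Hh (y t)) =
        inner ℂ (z s - z t) (opJ H Hh (y s)) + inner ℂ (z t) (opJ H Hh (y s - y t)) := by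
      rw [inner_sub_left, map_sub, inner_sub_right]
      ring
    rw [dist_eq_norm, dist_eq_norm, dist_eq_norm, e]
    refine (norm_add_le _ _).trans ?_
    have b1 : ‖(inner ℂ (z s - z t) (opJ H Hh (y s)) : ℂ)‖ ≤
        ‖z s - z t‖ * (‖negJ H Hh‖ * |Cy|) :=
      (norm_inner_le_norm _ _).trans (mul_le_mul_of_nonneg_left ((hn _).trans
        (mul_le_mul_of_nonneg_left ((hCy s hs).trans (le_abs_self _)) (norm_nonneg _)))
        (norm_nonneg _))
    have b2 : ‖(inner ℂ (z t) (opJ H Hh (y s - y t)) : ℂ)‖ ≤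
        |Cz| * (‖negJ H Hh‖ * ‖y s - y t‖) :=
      (norm_inner_le_norm _ _).trans (mul_le_mul ((hCz t ht).trans (le_abs_self _)) (hn _)
        (norm_nonneg _) (abs_nonneg _))
    have p1 : 0 ≤ ‖negJ H Hh‖ * |Cy| * ‖y s - y t‖ := by positivity
    have p2 : 0 ≤ ‖negJ H Hh‖ * |Cz| * ‖z s - z t‖ := by positivity
    simp only [C]
    linarith
  have hint : IntervalIntegrable (fun t => (inner ℂ (z t) (h t) : ℂ) - inner ℂ (k t) (y t))
      volume S.a β := by
    rw [intervalIntegrable_iff_integrableOn_Icc_of_le haβ]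
    refine Integrable.sub ?_ ?_
    · refine Integrable.mono' ((hh β hβ).norm.const_mul |Cz|)
        ((hzc.aestronglyMeasurable measurableSet_Icc).inner (hh β hβ).aestronglyMeasurable) ?_
      refine (ae_restrict_iff' measurableSet_Icc).2 (.of_forall fun t ht => ?_)
      exact (norm_inner_le_norm _ _).trans (mul_le_mul_of_nonneg_right
        ((hCz t ht).trans (le_abs_self _)) (norm_nonneg _))
    · refine Integrable.mono' ((hk β hβ).norm.mul_const |Cy|)
        ((hk β hβ).aestronglyMeasurable.inner (hyc.aestronglyMeasurable measurableSet_Icc)) ?_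
      refine (ae_restrict_iff' measurableSet_Icc).2 (.of_forall fun t ht => ?_)
      exact (norm_inner_le_norm _ _).trans (mul_le_mul_of_nonneg_left
        ((hCy t ht).trans (le_abs_self _)) (norm_nonneg _))
  rw [hac.eq_add_integral haβ hint ?_ ⟨haβ, le_rfl⟩, add_sub_cancel_left]
  have e1 := (ae_restrict_iff' S.measurableSet_I).1 (hasDerivAt_of_mem_solutions hy)
  have e2 := (ae_restrict_iff' S.measurableSet_I).1 (hasDerivAt_of_mem_solutions hz)
  have e3 := (ae_restrict_iff' S.measurableSet_I).1 S.B_symmetric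
  filter_upwards [e1, e2, e3] with t h1 h2 h3 ht
  have htI := S.Icc_subset hβ le_rfl ht
  have hJy : HasDerivAt (fun t => opJ H Hh (y t)) (S.B t (y t) + h t) t := by
    have h4 := ((-(negJ H Hh)).restrictScalars ℝ).hasFDerivAt.comp_hasDerivAt t (h1 htI)
    simpa [Function.comp_def, add_comm] using h4
  have h5 := (h2 htI).inner ℂ hJy
  refine h5.congr_deriv ?_
  -- `J` is skew with `J² = -1`, so the derivative of `(J y, z)` contains `B` only through `(B y, z)
  -- - (y, B z)`, which cancels by symmetry.
  rw [inner_neg_left, inner_opJ_left, opJ_opJ, inner_neg_right, neg_neg,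
    inner_add_right, inner_add_left]
  have := h3 htI (z t) (y t)
  simp only [ContinuousLinearMap.coe_coe] at this
  rw [this]
  ring

end Solutions

end SymmetricSystem

namespace SymmetricSystem

variable {H Hh : Type*} [NormedAddCommGroup H] [InnerProductSpace ℂ H]
  [NormedAddCommGroup Hh] [InnerProductSpace ℂ Hh]

/-! ### The space `𝓛²_Δ(I)` -/

/-- Apply the Cauchy-Schwarz type bound to `r T x` and `x`, divide by `r`, and let `r` decrease to
zero. -/
theorem apply_eq_zero_of_inner_eq_zero {T : BoldH H Hh →L[ℂ] BoldH H Hh} (hT : T.IsPositive)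
    {x : BoldH H Hh} (hx : (inner ℂ x (T x) : ℂ) = 0) : T x = 0 := by
  have key : ∀ r : ℝ, 0 < r → ‖T x‖ ^ 2 ≤ r * ‖(inner ℂ (T x) (T (T x)) : ℂ)‖ := by
    intro r hr
    have h := norm_form_le hT ((r : ℂ) • T x) x
    rw [hx, norm_zero, add_zero, map_smul, inner_smul_left, inner_smul_left, inner_smul_right,
      norm_mul, norm_mul, norm_mul, inner_self_eq_norm_sq_to_K] at h
    simp only [Complex.conj_ofReal, Complex.norm_real, norm_pow, Real.norm_of_nonneg hr.le] at h
    have h' : r * ‖T x‖ ^ 2 ≤ r * (r * ‖(inner ℂ (T x) (T (T x)) : ℂ)‖) := by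
      simpa using h
    exact le_of_mul_le_mul_left h' hr
  have hc : Tendsto (fun r : ℝ => r * ‖(inner ℂ (T x) (T (T x)) : ℂ)‖) (𝓝[>] 0) (𝓝 0) := by
    have : Continuous fun r : ℝ => r * ‖(inner ℂ (T x) (T (T x)) : ℂ)‖ := by fun_prop
    simpa using (this.tendsto 0).mono_left nhdsWithin_le_nhds
  have h0 : ‖T x‖ ^ 2 ≤ 0 := by
    refine ge_of_tendsto hc ?_
    filter_upwards [self_mem_nhdsWithin] with r hr using key r hr
  simpa using h0

theorem inner_apply_symm {T : BoldH H Hh →L[ℂ] BoldH H Hh} (hT : T.IsPositive)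
    (x y : BoldH H Hh) : (inner ℂ (T x) y : ℂ) = inner ℂ x (T y) := hT.1 x y

theorem form_nonneg {T : BoldH H Hh →L[ℂ] BoldH H Hh} (hT : T.IsPositive)
    (x : BoldH H Hh) : 0 ≤ (inner ℂ x (T x) : ℂ).re := by
  have h := hT.2 x
  rw [ContinuousLinearMap.reApplyInnerSelf_apply] at h
  rw [← inner_apply_symm hT]
  exact h

theorem form_im {T : BoldH H Hh →L[ℂ] BoldH H Hh} (hT : T.IsPositive)
    (x : BoldH H Hh) : (inner ℂ x (T x) : ℂ).im = 0 := by
  have h := inner_conj_symm (𝕜 := ℂ) x (T x)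
  rw [inner_apply_symm hT] at h
  exact Complex.conj_eq_iff_im.1 h

/-- Test the Cauchy-Schwarz type bound on the unit vector `T x / ‖T x‖` and on `x`. -/
theorem norm_apply_le_of_isPositive {T : BoldH H Hh →L[ℂ] BoldH H Hh} (hT : T.IsPositive)
    (x : BoldH H Hh) : ‖T x‖ ≤ ‖T‖ + ‖(inner ℂ x (T x) : ℂ)‖ := by
  by_cases h0 : T x = 0
  · rw [h0, norm_zero]; positivity
  have hn : ‖T x‖ ≠ 0 := norm_ne_zero_iff.2 h0
  have h := norm_form_le hT (((‖T x‖ : ℂ)⁻¹) • T x) x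
  have hu : ‖((‖T x‖ : ℂ)⁻¹) • T x‖ = 1 := by
    rw [norm_smul, norm_inv, Complex.norm_real, norm_norm, inv_mul_cancel₀ hn]
  have h1 : ‖(inner ℂ (((‖T x‖ : ℂ)⁻¹) • T x) (T (((‖T x‖ : ℂ)⁻¹) • T x)) : ℂ)‖ ≤ ‖T‖ := by
    refine (norm_inner_le_norm _ _).trans ?_
    rw [hu, one_mul]
    exact (T.le_opNorm _).trans_eq (by rw [hu, mul_one])
  have h2 : ‖(inner ℂ (((‖T x‖ : ℂ)⁻¹) • T x) (T x) : ℂ)‖ = ‖T x‖ := by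
    rw [inner_smul_left, norm_mul, inner_self_eq_norm_sq_to_K, RCLike.norm_conj, norm_inv,
      norm_pow]
    simp only [Complex.coe_algebraMap, Complex.norm_real, norm_norm]
    field_simp
  rw [h2] at h
  exact h.trans (by gcongr)

section LSq

variable {S : SymmetricSystem H Hh}

theorem LSq.ext {f g : S.LSq} (h : ∀ t, f t = g t) : f = g := Subtype.ext (funext h)

theorem LSq.aestronglyMeasurable (f : S.LSq) :
    AEStronglyMeasurable f (volume.restrict S.I) := f.2.1

theorem LSq.integrableOn_form (f g : S.LSq) :
    IntegrableOn (fun t => (inner ℂ (f t) (S.Δ t (g t)) : ℂ)) S.I :=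
  S.integrableOn_form f.2.1 g.2.1 f.2.2 g.2.2

theorem LSq.inner_eq (f g : S.LSq) :
    (inner ℂ f g : ℂ) = ∫ t in S.I, (inner ℂ (f t) (S.Δ t (g t)) : ℂ) := rfl

/-- An element of `𝓛²_Δ(I)` given by a function. -/
def LSq.mk (f : ℝ → BoldH H Hh) (hf : f ∈ S.lSqSubmodule) : S.LSq := ⟨f, hf⟩

@[simp] theorem LSq.toFun_mk (f : ℝ → BoldH H Hh) (hf : f ∈ S.lSqSubmodule) :
    LSq.toFun (LSq.mk f hf) = f := rfl

theorem LSq.mem (f : S.LSq) : LSq.toFun f ∈ S.lSqSubmodule := f.2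

/-- An integral of the nonnegative function `(Δ f, f)` vanishes only if the function does almost
everywhere, and for a positive operator this forces `Δ f = 0`. Classes are thus determined by `Δ f`,
which is also the only way the right-hand side enters the system. -/
theorem π_eq_zero_iff {f : S.LSq} :
    S.π f = 0 ↔ ∀ᵐ t ∂volume.restrict S.I, S.Δ t (f t) = 0 := by
  have h1 : S.π f = 0 ↔ (inner ℂ f f : ℂ) = 0 := by
    change SeparationQuotient.mk f = 0 ↔ _
    rw [SeparationQuotient.mk_eq_zero_iff, inner_self_eq_norm_sq_to_K]
    simp
  rw [h1]
  constructor
  · intro h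
    have h2 : ∫ t in S.I, (inner ℂ (f t) (S.Δ t (f t)) : ℂ).re = 0 := by
      have := integral_re (𝕜 := ℂ) (LSq.integrableOn_form f f)
      rw [← LSq.inner_eq, h] at this
      simpa using this
    have h3 : ∀ᵐ t ∂volume.restrict S.I, 0 ≤ (inner ℂ (f t) (S.Δ t (f t)) : ℂ).re := by
      filter_upwards [S.Δ_nonneg] with t ht using form_nonneg ht _
    have h5 := (integral_eq_zero_iff_of_nonneg_ae h3 (LSq.integrableOn_form f f).re).1 h2
    filter_upwards [h5, S.Δ_nonneg] with t ht hp
    exact apply_eq_zero_of_inner_eq_zero hp (Complex.ext ht (form_im hp _))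
  · intro h
    rw [LSq.inner_eq]
    refine integral_eq_zero_of_ae ?_
    filter_upwards [h] with t ht
    rw [ht, inner_zero_right]
    rfl

theorem π_eq_iff {f g : S.LSq} :
    S.π f = S.π g ↔ ∀ᵐ t ∂volume.restrict S.I, S.Δ t (f t) = S.Δ t (g t) := by
  rw [← sub_eq_zero, ← map_sub, π_eq_zero_iff]
  simp only [map_sub, Pi.sub_apply, sub_eq_zero]

theorem π_surjective : Function.Surjective S.π := SeparationQuotient.surjective_mk

theorem inner_π (f g : S.LSq) : (inner ℂ (S.π f) (S.π g) : ℂ) = inner ℂ f g :=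
  SeparationQuotient.inner_mk_mk f g

/-- Where `Δ` degenerates, `f` itself need not be locally integrable; `‖Δ f‖ ≤ ‖Δ‖ + |(Δ f, f)|`
still controls `Δ f`. -/
theorem LSq.locInt (f : S.LSq) : S.LocInt fun t => S.Δ t (f t) := by
  intro β hβ
  have hsub := S.Icc_subset hβ le_rfl
  have hm : AEStronglyMeasurable (fun t => S.Δ t (f t)) (volume.restrict (Set.Icc S.a β)) :=
    (isBoundedBilinearMap_apply (𝕜 := ℂ) (E := BoldH H Hh)
      (F := BoldH H Hh)).continuous.comp_aestronglyMeasurable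
        ((S.aestronglyMeasurable_Δ.prodMk f.aestronglyMeasurable).mono_set hsub)
  refine Integrable.mono' ((S.Δ_locallyIntegrable β hβ).norm.add
    ((LSq.integrableOn_form f f).mono_set hsub).norm) hm ?_
  filter_upwards [ae_restrict_of_ae_restrict_of_subset hsub S.Δ_nonneg] with t ht
  exact norm_apply_le_of_isPositive ht _

theorem indicator_mem {f : ℝ → BoldH H Hh} (hf : f ∈ S.lSqSubmodule) (β : ℝ) :
    (Set.Icc S.a β).indicator f ∈ S.lSqSubmodule := by
  refine ⟨hf.1.indicator measurableSet_Icc, ?_⟩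
  have h : IntegrableOn ((Set.Icc S.a β).indicator
      fun t => (inner ℂ (f t) (S.Δ t (f t)) : ℂ)) S.I :=
    Integrable.indicator hf.2 measurableSet_Icc
  refine h.congr (.of_forall fun t => ?_)
  by_cases ht : t ∈ Set.Icc S.a β <;> simp [ht]

theorem indicator_mem_of_continuousOn {f : ℝ → BoldH H Hh} {β : ℝ} (hβ : β ∈ S.I)
    (hf : ContinuousOn f (Set.Icc S.a β)) : (Set.Icc S.a β).indicator f ∈ S.lSqSubmodule := by
  have hsub := S.Icc_subset hβ le_rfl
  have hm : AEStronglyMeasurable ((Set.Icc S.a β).indicator f) (volume.restrict S.I) :=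
    ((aestronglyMeasurable_indicator_iff measurableSet_Icc).2
      (hf.aestronglyMeasurable measurableSet_Icc)).restrict
  obtain ⟨C, hC⟩ := isCompact_Icc.exists_bound_of_continuousOn hf
  refine ⟨hm, Integrable.mono' (g := (Set.Icc S.a β).indicator fun t => C * (‖S.Δ t‖ * C)) ?_
    (S.aestronglyMeasurable_form hm hm) (.of_forall fun t => ?_)⟩
  · have h1 : IntegrableOn (fun t => C * (‖S.Δ t‖ * C)) (Set.Icc S.a β) :=
      ((S.Δ_locallyIntegrable β hβ).norm.mul_const C).const_mul C
    exact (h1.integrable_indicator measurableSet_Icc).restrict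
  · by_cases ht : t ∈ Set.Icc S.a β
    · simp only [ht, Set.indicator_of_mem]
      have h0 : 0 ≤ C := (norm_nonneg _).trans (hC t ht)
      exact (norm_inner_le_norm _ _).trans (mul_le_mul (hC t ht)
        ((S.Δ t).le_opNorm_of_le (hC t ht)) (norm_nonneg _) h0)
    · simp [ht]

end LSq

/-! ### The maximal relation and the Green identity -/

section Tmax

variable {S : SymmetricSystem H Hh}

theorem mem_tmax_iff {p : S.LSq × S.LSq} : p ∈ S.tmax ↔
    Function.support p.1 ⊆ S.I ∧
      ((LSq.toFun p.1, fun t => S.Δ t (LSq.toFun p.2 t)) ∈ S.solutions) := Iff.rfl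

variable [FiniteDimensional ℂ H] [FiniteDimensional ℂ Hh]

/-- Let the right endpoint in the Lagrange identity tend to `b`: the integrand is integrable over
all of `I` because the four functions lie in `𝓛²_Δ(I)`. This is what makes the limit defining `[y,
z]_b` exist. -/
theorem tendsto_inner_opJ {p q : S.LSq × S.LSq} (hp : p ∈ S.tmax) (hq : q ∈ S.tmax) :
    Tendsto (fun t => (inner ℂ (q.1 t) (opJ H Hh (p.1 t)) : ℂ)) S.atB
      (𝓝 (inner ℂ (q.1 S.a) (opJ H Hh (p.1 S.a)) + (inner ℂ q.1 p.2 - inner ℂ q.2 p.1))) := by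
  have hint := (LSq.integrableOn_form q.1 p.2).sub (LSq.integrableOn_form q.2 p.1)
  have h := (S.tendsto_integral_atB hint).const_add
    (inner ℂ (q.1 S.a) (opJ H Hh (p.1 S.a)) : ℂ)
  rw [integral_sub' (LSq.integrableOn_form q.1 p.2) (LSq.integrableOn_form q.2 p.1)] at h
  refine h.congr' ?_
  filter_upwards [S.eventually_mem] with t ht
  have hL := lagrange_identity (mem_tmax_iff.1 hp).2 (mem_tmax_iff.1 hq).2 p.2.locInt
    q.2.locInt ht
  rw [eq_comm, ← sub_eq_iff_eq_add', hL]
  refine intervalIntegral.integral_congr_ae ?_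
  have := (ae_restrict_iff' S.measurableSet_I).1 S.Δ_nonneg
  filter_upwards [this] with s hs hs'
  rw [Set.uIoc_of_le (S.le_of_mem ht)] at hs'
  have h1 := (hs (S.Icc_subset ht le_rfl (Set.Ioc_subset_Icc_self hs'))).1 (q.2 s) (p.1 s)
  simp only [ContinuousLinearMap.coe_coe] at h1
  simp only [Pi.sub_apply]
  rw [h1]

/-- The Green identity. -/
theorem bForm_eq {p q : S.LSq × S.LSq} (hp : p ∈ S.tmax) (hq : q ∈ S.tmax) :
    S.bForm p.1 q.1 =
      inner ℂ (q.1 S.a) (opJ H Hh (p.1 S.a)) + (inner ℂ q.1 p.2 - inner ℂ q.2 p.1) :=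
  (tendsto_inner_opJ hp hq).limUnder_eq

theorem tendsto_bForm {p q : S.LSq × S.LSq} (hp : p ∈ S.tmax) (hq : q ∈ S.tmax) :
    Tendsto (fun t => (inner ℂ (q.1 t) (opJ H Hh (p.1 t)) : ℂ)) S.atB (𝓝 (S.bForm p.1 q.1)) := by
  rw [bForm_eq hp hq]
  exact tendsto_inner_opJ hp hq

theorem mem_tmin_iff {p : S.LSq × S.LSq} : p ∈ S.tmin ↔
    p ∈ S.tmax ∧ p.1 S.a = 0 ∧ ∀ q ∈ S.tmax, S.bForm p.1 q.1 = 0 := by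
  constructor
  · rintro ⟨h1, h2, h3⟩
    refine ⟨h1, h2, fun q hq => ?_⟩
    exact tendsto_nhds_unique (tendsto_bForm h1 hq) (h3 q.1 ⟨q, hq, rfl⟩)
  · rintro ⟨h1, h2, h3⟩
    refine ⟨h1, h2, ?_⟩
    rintro _ ⟨q, hq, rfl⟩
    rw [← h3 q hq]
    exact tendsto_bForm h1 hq

theorem bForm_eq_zero_of_eventually {p q : S.LSq × S.LSq} (hp : p ∈ S.tmax) (hq : q ∈ S.tmax)
    (h : ∀ᶠ t in S.atB, p.1 t = 0) : S.bForm p.1 q.1 = 0 := by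
  refine tendsto_nhds_unique (tendsto_bForm hp hq) (tendsto_const_nhds.congr' ?_)
  filter_upwards [h] with t ht
  rw [ht, map_zero, inner_zero_right]

end Tmax

end SymmetricSystem

/-! ### Functions supported in a compact segment -/

namespace SymmetricSystem

variable {H Hh : Type*} [NormedAddCommGroup H] [InnerProductSpace ℂ H]
  [NormedAddCommGroup Hh] [InnerProductSpace ℂ Hh]
  {S : SymmetricSystem H Hh}

theorem eventually_eq_zero_of_forall_le {β : ℝ} (hβ : (β : EReal) < S.b)
    {y : ℝ → BoldH H Hh} (hy : ∀ t, β ≤ t → y t = 0) : ∀ᶠ t in S.atB, y t = 0 :=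
  (S.eventually_atB hβ).mono fun t ht => hy t ht.1.le

theorem mem_Tmax_iff {q : S.L2 × S.L2} :
    q ∈ S.Tmax ↔ ∃ p ∈ S.tmax, (S.π p.1, S.π p.2) = q := Iff.rfl

theorem mem_Tmin_iff {q : S.L2 × S.L2} :
    q ∈ S.Tmin ↔ ∃ p ∈ S.tmin, (S.π p.1, S.π p.2) = q := Iff.rfl

theorem setIntegral_eq_intervalIntegral {β : ℝ} (hβ : β ∈ S.I) {F : ℝ → ℂ}
    (hF : ∀ t, t ∉ Set.Icc S.a β → F t = 0) : ∫ t in S.I, F t = ∫ t in S.a..β, F t := by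
  rw [intervalIntegral.integral_of_le (S.le_of_mem hβ), ← integral_Icc_eq_integral_Ioc]
  exact setIntegral_eq_of_subset_of_forall_sdiff_eq_zero S.measurableSet_I
    (S.Icc_subset hβ le_rfl) fun t ht => hF t ht.2

theorem inner_eq_inner_of_eqOn {β : ℝ} {f z z' : S.LSq}
    (hf : ∀ t, t ∉ Set.Icc S.a β → f t = 0) (hz : Set.EqOn z z' (Set.Icc S.a β)) :
    (inner ℂ f z : ℂ) = inner ℂ f z' := by
  rw [LSq.inner_eq, LSq.inner_eq]
  congr 1
  funext t
  by_cases ht : t ∈ Set.Icc S.a β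
  · rw [hz ht]
  · rw [hf t ht, inner_zero_left, inner_zero_left]

variable [FiniteDimensional ℂ H] [FiniteDimensional ℂ Hh]

/-! ### The initial value problem -/

theorem exists_mem_solutions_support (h : ℝ → BoldH H Hh) (hh : S.LocInt h) (c : BoldH H Hh) :
    ∃ y, (y, h) ∈ S.solutions ∧ y S.a = c ∧ Function.support y ⊆ S.I := by
  obtain ⟨y, hy, hc⟩ := exists_mem_solutions h hh c
  refine ⟨S.I.indicator y, solutions_congr hy (fun t ht => Set.indicator_of_mem ht _) .rfl, ?_,
    Set.support_indicator_subset⟩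
  rw [Set.indicator_of_mem S.a_mem, hc]

theorem eq_of_mem_solutions {y z h : ℝ → BoldH H Hh} (hy : (y, h) ∈ S.solutions)
    (hz : (z, h) ∈ S.solutions) (hys : Function.support y ⊆ S.I)
    (hzs : Function.support z ⊆ S.I) (h0 : y S.a = z S.a) : y = z := by
  funext t
  by_cases ht : t ∈ S.I
  · have h1 : (y - z, (0 : ℝ → BoldH H Hh)) ∈ S.solutions := by
      have := S.solutions.sub_mem hy hz
      rwa [Prod.mk_sub_mk, sub_self] at this
    exact sub_eq_zero.1 (eq_zero_of_mem_solutions h1 le_rfl (sub_eq_zero.2 h0)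
      (S.le_of_mem ht) ht)
  · rw [Function.notMem_support.1 fun h => ht (hys h),
      Function.notMem_support.1 fun h => ht (hzs h)]

variable (S) in
/-- The solution of the homogeneous system with a given value at `a`, extended by zero. -/
def homSol : BoldH H Hh →ₗ[ℂ] (ℝ → BoldH H Hh) where
  toFun c := (exists_mem_solutions_support (S := S) 0 locInt_zero c).choose
  map_add' c d := by
    have hc := (exists_mem_solutions_support (S := S) 0 locInt_zero c).choose_spec
    have hd := (exists_mem_solutions_support (S := S) 0 locInt_zero d).choose_spec
    have hcd := (exists_mem_solutions_support (S := S) 0 locInt_zero (c + d)).choose_spec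
    refine eq_of_mem_solutions hcd.1 (by simpa using S.solutions.add_mem hc.1 hd.1) hcd.2.2
      ((Function.support_add _ _).trans (Set.union_subset hc.2.2 hd.2.2)) ?_
    rw [hcd.2.1, Pi.add_apply, hc.2.1, hd.2.1]
  map_smul' r c := by
    have hc := (exists_mem_solutions_support (S := S) 0 locInt_zero c).choose_spec
    have hrc := (exists_mem_solutions_support (S := S) 0 locInt_zero (r • c)).choose_spec
    refine eq_of_mem_solutions hrc.1 (by simpa using S.solutions.smul_mem r hc.1) hrc.2.2
      ((Function.support_const_smul_subset _ _).trans hc.2.2) ?_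
    rw [hrc.2.1, RingHom.id_apply, Pi.smul_apply, hc.2.1]

theorem homSol_mem (c : BoldH H Hh) : (S.homSol c, 0) ∈ S.solutions :=
  (exists_mem_solutions_support (S := S) 0 locInt_zero c).choose_spec.1

@[simp] theorem homSol_a (c : BoldH H Hh) : S.homSol c S.a = c :=
  (exists_mem_solutions_support (S := S) 0 locInt_zero c).choose_spec.2.1

/-- The fundamental solution is `J`-unitary, by the Lagrange identity with zero right-hand sides; in
particular it is invertible at every point. -/
theorem inner_homSol_opJ {β : ℝ} (hβ : β ∈ S.I) (c d : BoldH H Hh) :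
    (inner ℂ (S.homSol d β) (opJ H Hh (S.homSol c β)) : ℂ) = inner ℂ d (opJ H Hh c) := by
  have := lagrange_identity (homSol_mem (S := S) c) (homSol_mem d) locInt_zero locInt_zero hβ
  simpa [sub_eq_zero] using this

theorem homSol_surjective {β : ℝ} (hβ : β ∈ S.I) (x : BoldH H Hh) : ∃ c, S.homSol c β = x := by
  let Y : BoldH H Hh →ₗ[ℂ] BoldH H Hh := LinearMap.proj β ∘ₗ S.homSol
  have hinj : Function.Injective Y := by
    refine (injective_iff_map_eq_zero Y).2 fun c hc => ?_
    have hc' : S.homSol c β = 0 := hc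
    have h := inner_homSol_opJ hβ c (opJ H Hh c)
    rw [hc', map_zero, inner_zero_right, eq_comm, inner_self_eq_zero] at h
    exact opJ_injective (h.trans (map_zero _).symm)
  exact LinearMap.injective_iff_surjective.1 hinj x

/-! ### Definiteness on a compact segment -/

/-- The initial values whose solutions are `Δ`-null on `[a, β]` form a subspace of a
finite-dimensional space that shrinks as `β` grows. Once its dimension is minimal it is constant, so
its elements are `Δ`-null on all of `I`, and definiteness with `lam = 0` makes them zero. -/
theorem exists_definite (hdef : S.IsDefinite) : ∃ β₀ : ℝ, S.a ≤ β₀ ∧ (β₀ : EReal) < S.b ∧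
    ∀ c, (∀ᵐ t ∂volume.restrict (Set.Icc S.a β₀), S.Δ t (S.homSol c t) = 0) → c = 0 := by
  let N : ℝ → Submodule ℂ (BoldH H Hh) := fun β =>
    { carrier := {c | ∀ᵐ t ∂volume.restrict (Set.Icc S.a β), S.Δ t (S.homSol c t) = 0}
      zero_mem' := by simp
      add_mem' := by
        intro c d hc hd
        rw [Set.mem_ofPred_eq] at hc hd ⊢
        filter_upwards [hc, hd] with t h1 h2
        rw [map_add, Pi.add_apply, map_add, h1, h2, add_zero]
      smul_mem' := by
        intro r c hc
        rw [Set.mem_ofPred_eq] at hc ⊢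
        filter_upwards [hc] with t h1
        rw [map_smul, Pi.smul_apply, map_smul, h1, smul_zero] }
  have hanti : ∀ β β', β ≤ β' → N β' ≤ N β := fun β β' h c hc =>
    ae_restrict_of_ae_restrict_of_subset (Set.Icc_subset_Icc_right h) hc
  obtain ⟨β₀, ⟨h1, h2⟩, hmin⟩ := exists_minimalFor_of_wellFoundedLT
    (fun β : ℝ => S.a ≤ β ∧ (β : EReal) < S.b) (fun β => Module.finrank ℂ (N β))
    ⟨S.a, le_rfl, S.hab⟩
  refine ⟨β₀, h1, h2, fun c hc => ?_⟩
  have hcN : ∀ β, β₀ < β → (β : EReal) < S.b → c ∈ N β := by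
    intro β hβ hβb
    have hle := hanti _ _ hβ.le
    rw [Submodule.eq_of_le_of_finrank_le hle
      (hmin ⟨h1.trans hβ.le, hβb⟩ (Submodule.finrank_mono hle))]
    exact hc
  have hae : ∀ᵐ t ∂volume.restrict S.I, S.Δ t (S.homSol c t) = 0 :=
    S.ae_of_forall_Icc h2 fun β h3 h4 _ => hcN β h3 h4
  have hsol : S.Solves (S.homSol c) ((0 : ℂ) • S.homSol c) := by
    filter_upwards [(homSol_mem (S := S) c).2] with t ht
    refine ⟨ht.1, ?_⟩
    simpa using ht.2
  have := hdef 0 (S.homSol c) (homSol_mem c).1 hsol hae S.a S.a_mem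
  rwa [homSol_a] at this

/-- The cut-off to `[a, β]` of the solutions of the homogeneous system. -/
def cutSol {β : ℝ} (hβ : β ∈ S.I) : BoldH H Hh →ₗ[ℂ] S.LSq where
  toFun c := LSq.mk _ (indicator_mem_of_continuousOn hβ ((homSol_mem c).1.continuousOn hβ))
  map_add' c d := by
    refine LSq.ext fun t => ?_
    by_cases ht : t ∈ Set.Icc S.a β <;> simp [ht]
  map_smul' r c := by
    refine LSq.ext fun t => ?_
    by_cases ht : t ∈ Set.Icc S.a β <;> simp [ht]

theorem cutSol_apply {β : ℝ} (hβ : β ∈ S.I) (c : BoldH H Hh) :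
    LSq.toFun (cutSol hβ c) = (Set.Icc S.a β).indicator (S.homSol c) := rfl

theorem ae_cutSol {β : ℝ} (hβ : β ∈ S.I) (c : BoldH H Hh) :
    S.π (cutSol hβ c) = 0 ↔
      ∀ᵐ t ∂volume.restrict (Set.Icc S.a β), S.Δ t (S.homSol c t) = 0 := by
  rw [π_eq_zero_iff, cutSol_apply, ae_restrict_iff' S.measurableSet_I,
    ae_restrict_iff' measurableSet_Icc]
  refine eventually_congr (.of_forall fun t => ?_)
  by_cases ht : t ∈ Set.Icc S.a β
  · simp [ht, S.Icc_subset hβ le_rfl ht]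
  · simp [ht]

/-- The map `c ↦ π (cutSol c)` onto its range. -/
def cutRange {β : ℝ} (hβ : β ∈ S.I) :
    BoldH H Hh →ₗ[ℂ] LinearMap.range (S.π ∘ₗ cutSol hβ) :=
  (S.π ∘ₗ cutSol hβ).rangeRestrict

/-- The Gram operator `R* R` of the cut-off homogeneous solutions is injective by definiteness on
`[a, β]`, hence onto. Restricting the codomain to the finite-dimensional range makes the adjoint
available. -/
theorem exists_inner_cutSol {β : ℝ} (hβ : β ∈ S.I)
    (hdef : ∀ c, (∀ᵐ t ∂volume.restrict (Set.Icc S.a β), S.Δ t (S.homSol c t) = 0) → c = 0)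
    (r : BoldH H Hh) :
    ∃ e, ∀ d, (inner ℂ (cutSol hβ d) (cutSol hβ e) : ℂ) = inner ℂ d r := by
  let R := cutRange hβ
  have hinj : Function.Injective (LinearMap.adjoint R ∘ₗ R) := by
    refine (injective_iff_map_eq_zero _).2 fun c hc => hdef c ?_
    rw [← ae_cutSol hβ]
    have h1 : (inner ℂ c ((LinearMap.adjoint R) (R c)) : ℂ) = 0 := by
      rw [show (LinearMap.adjoint R) (R c) = 0 from hc, inner_zero_right]
    rw [LinearMap.adjoint_inner_right, inner_self_eq_zero] at h1
    exact congrArg Subtype.val h1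
  obtain ⟨e, he⟩ := LinearMap.injective_iff_surjective.1 hinj r
  refine ⟨e, fun d => ?_⟩
  rw [← he, LinearMap.comp_apply, LinearMap.adjoint_inner_right, ← inner_π]
  rfl

/-- Orthogonal projection of `v` onto the finite-dimensional space of cut-off homogeneous solutions;
here no definiteness is needed. -/
theorem exists_inner_sub_cutSol {β : ℝ} (hβ : β ∈ S.I) (v : S.LSq) :
    ∃ e, ∀ d, (inner ℂ (cutSol hβ d) (v - cutSol hβ e) : ℂ) = 0 := by
  set M := LinearMap.range (S.π ∘ₗ cutSol hβ)
  obtain ⟨e, he⟩ := (M.orthogonalProjectionOnto (S.π v)).2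
  refine ⟨e, fun d => ?_⟩
  rw [← inner_π, map_sub]
  have h1 : S.π (cutSol hβ e) = M.starProjection (S.π v) := he
  rw [h1]
  exact (Submodule.mem_orthogonal _ _).1 (Submodule.sub_starProjection_mem_orthogonal (S.π v)) _
    ⟨d, rfl⟩

theorem inner_cutSol {β : ℝ} (hβ : β ∈ S.I) (d : BoldH H Hh) (f : S.LSq) :
    (inner ℂ (cutSol hβ d) f : ℂ) = ∫ t in S.a..β, (inner ℂ (S.homSol d t) (S.Δ t (f t)) : ℂ) := by
  have h : ∀ t, (inner ℂ ((Set.Icc S.a β).indicator (S.homSol d) t) (S.Δ t (f t)) : ℂ) =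
      (Set.Icc S.a β).indicator
        (fun t => (inner ℂ (S.homSol d t) (S.Δ t (f t)) : ℂ)) t := by
    intro t
    by_cases ht : t ∈ Set.Icc S.a β <;> simp [ht]
  rw [LSq.inner_eq, cutSol_apply]
  simp only [h]
  rw [intervalIntegral.integral_of_le (S.le_of_mem hβ), ← integral_Icc_eq_integral_Ioc,
    setIntegral_indicator measurableSet_Icc,
    Set.inter_eq_self_of_subset_right (S.Icc_subset hβ le_rfl)]

/-- Steering a solution to zero at `β` by means of a right-hand side supported in `[a, β]`. -/
theorem exists_mem_tmax_of_inner_cutSol {β : ℝ} (hβ : β ∈ S.I) (c : BoldH H Hh) (f : S.LSq)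
    (hf : ∀ t, t ∉ Set.Icc S.a β → f t = 0)
    (hfc : ∀ d, (inner ℂ (cutSol hβ d) f : ℂ) = -inner ℂ d (opJ H Hh c)) :
    ∃ y : S.LSq, (y, f) ∈ S.tmax ∧ y S.a = c ∧ ∀ t, β ≤ t → y t = 0 := by
  obtain ⟨y, hy, hyc, hys⟩ := exists_mem_solutions_support _ f.locInt c
  have hyβ : y β = 0 := by
    refine opJ_injective ((?_ : opJ H Hh (y β) = 0).trans (map_zero _).symm)
    rw [← inner_self_eq_zero (𝕜 := ℂ)]
    -- Pair `y` with the homogeneous solution whose value at `β` is `J y(β)`: the Lagrange identity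
    -- and the condition on `f` leave `‖J y(β)‖² = 0`.
    obtain ⟨d, hd⟩ := homSol_surjective hβ (opJ H Hh (y β))
    have hL := lagrange_identity hy (homSol_mem (S := S) d) f.locInt locInt_zero hβ
    simp only [Pi.zero_apply, inner_zero_left, sub_zero] at hL
    rw [← inner_cutSol hβ, hfc, homSol_a, hyc, hd] at hL
    linear_combination hL
  have hy0 : ∀ t, β ≤ t → y t = 0 := by
    intro t ht
    by_cases htI : t ∈ S.I
    · have hL := eq_add_integral_of_mem_solutions hy f.locInt (S.le_of_mem hβ) ht htI
      have hAC := IsAC.on_Icc hy.1 (S.le_of_mem hβ) ht htI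
      have hc := hAC.continuousOn
      rw [Set.uIcc_of_le ht] at hc
      -- Beyond `β` the right-hand side vanishes, so `y` continues as the zero solution of the
      -- homogeneous system.
      refine eq_zero_of_eq_integral ht
        (intervalIntegrable_coeff (S.le_of_mem hβ) ht htI) hc (fun r hr => ?_) t ⟨ht, le_rfl⟩
      have h2 := eq_add_integral_of_mem_solutions hy f.locInt (S.le_of_mem hβ) hr.1
        (S.mem_of_le htI ((S.le_of_mem hβ).trans hr.1) hr.2)
      rw [hyβ, zero_add] at h2
      refine h2.trans (intervalIntegral.integral_congr_ae (.of_forall fun s hs => ?_))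
      rw [Set.uIoc_of_le hr.1] at hs
      rw [hf s fun h => absurd h.2 (not_le.2 hs.1)]
      simp
    · exact Function.notMem_support.1 fun h => htI (hys h)
  have hmem : y ∈ S.lSqSubmodule := by
    have h := indicator_mem_of_continuousOn hβ (IsAC.continuousOn hy.1 hβ)
    have e : (Set.Icc S.a β).indicator y = y := by
      funext t
      by_cases ht : t ∈ Set.Icc S.a β
      · rw [Set.indicator_of_mem ht]
      · rw [Set.indicator_of_notMem ht]
        by_cases htI : t ∈ S.I
        · refine (hy0 t (le_of_not_ge fun h => ht ⟨S.le_of_mem htI, h⟩)).symm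
        · exact (Function.notMem_support.1 fun h => htI (hys h)).symm
    rwa [e] at h
  exact ⟨LSq.mk y hmem, ⟨hys, hy.1, hy.2⟩, hyc, hy0⟩

/-- Every vector is the value at `a` of a function in the maximal domain vanishing near `b`. -/
theorem exists_mem_tmax (hdef : S.IsDefinite) (c : BoldH H Hh) :
    ∃ p ∈ S.tmax, p.1 S.a = c ∧ ∀ᶠ t in S.atB, p.1 t = 0 := by
  obtain ⟨β, h1, h2, h3⟩ := exists_definite hdef
  have hβ := S.mem_of_lt h1 h2
  obtain ⟨e, he⟩ := exists_inner_cutSol hβ h3 (-opJ H Hh c)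
  obtain ⟨y, hy, hyc, hy0⟩ := exists_mem_tmax_of_inner_cutSol hβ c (cutSol hβ e)
    (fun t ht => by rw [cutSol_apply, Set.indicator_of_notMem ht])
    (fun d => by rw [he, inner_neg_right])
  exact ⟨(y, cutSol hβ e), hy, hyc, eventually_eq_zero_of_forall_le h2 hy0⟩

/-! ### The adjoint of the minimal relation -/

theorem mem_adjoint_Tmax_iff {z g : S.LSq} : (S.π z, S.π g) ∈ S.Tmax.adjoint ↔
    ∀ p ∈ S.tmax, (inner ℂ p.2 z : ℂ) = inner ℂ p.1 g := by
  rw [Submodule.mem_adjoint_iff]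
  constructor
  · intro h p hp
    have := h _ _ (mem_Tmax_iff.2 ⟨p, hp, rfl⟩)
    rwa [inner_π, inner_π, sub_eq_zero] at this
  · rintro h a b hab
    obtain ⟨p, hp, he⟩ := mem_Tmax_iff.1 hab
    obtain ⟨rfl, rfl⟩ := Prod.mk.inj he
    rw [inner_π, inner_π, h p hp, sub_self]

theorem mem_adjoint_Tmin_iff {z g : S.LSq} : (S.π z, S.π g) ∈ S.Tmin.adjoint ↔
    ∀ p ∈ S.tmin, (inner ℂ p.2 z : ℂ) = inner ℂ p.1 g := by
  rw [Submodule.mem_adjoint_iff]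
  constructor
  · intro h p hp
    have := h _ _ (mem_Tmin_iff.2 ⟨p, hp, rfl⟩)
    rwa [inner_π, inner_π, sub_eq_zero] at this
  · rintro h a b hab
    obtain ⟨p, hp, he⟩ := mem_Tmin_iff.1 hab
    obtain ⟨rfl, rfl⟩ := Prod.mk.inj he
    rw [inner_π, inner_π, h p hp, sub_self]

theorem inner_eq_of_mem_tmin {p q : S.LSq × S.LSq} (hp : p ∈ S.tmin) (hq : q ∈ S.tmax) :
    (inner ℂ p.2 q.1 : ℂ) = inner ℂ p.1 q.2 := by
  obtain ⟨h1, h2, h3⟩ := mem_tmin_iff.1 hp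
  have := bForm_eq h1 hq
  rw [h3 q hq, h2, map_zero, inner_zero_right, zero_add, eq_comm, sub_eq_zero] at this
  rw [← inner_conj_symm, this, inner_conj_symm]

/-- The Lagrange identity on `[a, β]`, where both boundary terms vanish. The solution `w` is not
assumed to be in `𝓛²_Δ(I)`, so its place in the inner product is taken by an element `w'` agreeing
with it on the segment. -/
theorem inner_eq_of_vanishing {β : ℝ} (hβ : β ∈ S.I) {f g y w' : S.LSq} {w : ℝ → BoldH H Hh}
    (hw : (w, fun t => S.Δ t (g t)) ∈ S.solutions) (hy : (y, f) ∈ S.tmax)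
    (hw' : Set.EqOn w' w (Set.Icc S.a β)) (hf : ∀ t, t ∉ Set.Icc S.a β → f t = 0)
    (ha : y S.a = 0) (hy0 : ∀ t, β ≤ t → y t = 0) :
    (inner ℂ f w' : ℂ) = inner ℂ y g := by
  have hL := lagrange_identity (mem_tmax_iff.1 hy).2 hw f.locInt g.locInt hβ
  rw [ha, hy0 β le_rfl, map_zero, inner_zero_right, inner_zero_right, sub_zero] at hL
  have hys : ∀ t, t ∉ Set.Icc S.a β → y t = 0 := by
    intro t ht
    by_cases htI : t ∈ S.I
    · exact hy0 t (le_of_not_ge fun h => ht ⟨S.le_of_mem htI, h⟩)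
    · exact Function.notMem_support.1 fun h => htI ((mem_tmax_iff.1 hy).1 h)
  have h1 : (inner ℂ w' f : ℂ) - inner ℂ g y = 0 := by
    rw [LSq.inner_eq, LSq.inner_eq, ← integral_sub (LSq.integrableOn_form _ _)
      (LSq.integrableOn_form _ _), setIntegral_eq_intervalIntegral hβ
        (fun t ht => by rw [hf t ht, hys t ht]; simp), hL]
    refine intervalIntegral.integral_congr_ae ?_
    filter_upwards [(ae_restrict_iff' S.measurableSet_I).1 S.Δ_nonneg] with t hp ht
    rw [Set.uIoc_of_le (S.le_of_mem hβ)] at ht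
    have ht' := Set.Ioc_subset_Icc_self ht
    rw [hw' ht', inner_apply_symm (hp (S.Icc_subset hβ le_rfl ht'))]
  rw [← inner_conj_symm, sub_eq_zero.1 h1, inner_conj_symm]

/-- Let `f` be what remains of `z - w` on `[a, β]` after projecting off the homogeneous solutions.
As a right-hand side, `f` steers zero to zero and so yields an element of `t_min`. Pairing this
element with `{z, g}` and with `{w, g}` gives the same number, hence `f` is orthogonal to `z - w`;
being orthogonal to the homogeneous solutions as well, it has norm zero. -/
theorem exists_homSol_of_mem_adjoint {z g : S.LSq} (hzg : (S.π z, S.π g) ∈ S.Tmin.adjoint)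
    {w : ℝ → BoldH H Hh} (hw : (w, fun t => S.Δ t (g t)) ∈ S.solutions)
    {β : ℝ} (hβ : β ∈ S.I) (hβb : (β : EReal) < S.b) :
    ∃ e, ∀ᵐ t ∂volume.restrict (Set.Icc S.a β), S.Δ t (z t - w t - S.homSol e t) = 0 := by
  obtain ⟨w', hw'⟩ : ∃ w' : S.LSq, LSq.toFun w' = (Set.Icc S.a β).indicator w :=
    ⟨LSq.mk _ (indicator_mem_of_continuousOn hβ (IsAC.continuousOn hw.1 hβ)), rfl⟩
  obtain ⟨z', hz'⟩ : ∃ z' : S.LSq, LSq.toFun z' = (Set.Icc S.a β).indicator (LSq.toFun z) :=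
    ⟨LSq.mk _ (indicator_mem z.mem β), rfl⟩
  obtain ⟨e, he⟩ := exists_inner_sub_cutSol hβ (z' - w')
  obtain ⟨f, hfe⟩ : ∃ f : S.LSq, f = z' - w' - cutSol hβ e := ⟨_, rfl⟩
  rw [← hfe] at he
  have hft : ∀ t ∈ Set.Icc S.a β, f t = z t - w t - S.homSol e t := by
    intro t ht
    simp only [hfe, map_sub, Pi.sub_apply, cutSol_apply, hz', hw', Set.indicator_of_mem ht]
  have hf0 : ∀ t, t ∉ Set.Icc S.a β → f t = 0 := by
    intro t ht
    simp only [hfe, map_sub, Pi.sub_apply, cutSol_apply, hz', hw', Set.indicator_of_notMem ht,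
      sub_zero]
  obtain ⟨y, hy, hya, hy0⟩ := exists_mem_tmax_of_inner_cutSol hβ 0 f hf0
    (fun d => by rw [he, map_zero, inner_zero_right, neg_zero])
  have hmin : (y, f) ∈ S.tmin := mem_tmin_iff.2 ⟨hy, hya, fun q hq =>
    bForm_eq_zero_of_eventually hy hq (eventually_eq_zero_of_forall_le hβb hy0)⟩
  have h1 : (inner ℂ f z : ℂ) = inner ℂ y g := mem_adjoint_Tmin_iff.1 hzg _ hmin
  have h2 : (inner ℂ f w' : ℂ) = inner ℂ y g :=
    inner_eq_of_vanishing hβ hw hy (fun t ht => by rw [hw', Set.indicator_of_mem ht]) hf0 hya hy0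
  have h3 : (inner ℂ f z : ℂ) = inner ℂ f z' :=
    inner_eq_inner_of_eqOn hf0 fun t ht => by rw [hz', Set.indicator_of_mem ht]
  have h5 : (inner ℂ f (cutSol hβ e) : ℂ) = 0 := by
    rw [← inner_conj_symm, he, map_zero]
  have h4 : (inner ℂ f f : ℂ) = 0 := by
    have h6 : (inner ℂ f f : ℂ) = inner ℂ f z' - inner ℂ f w' - inner ℂ f (cutSol hβ e) := by
      rw [← inner_sub_right, ← inner_sub_right, ← hfe]
    rw [h6, h5, ← h3, h1, h2, sub_self, sub_zero]
  have h7 : S.π f = 0 := by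
    rwa [← inner_π, inner_self_eq_zero] at h4
  refine ⟨e, ?_⟩
  have h8 := ae_restrict_of_ae_restrict_of_subset (S.Icc_subset hβ le_rfl) (π_eq_zero_iff.1 h7)
  filter_upwards [h8, ae_restrict_mem measurableSet_Icc] with t ht htI
  rwa [hft t htI] at ht

theorem adjoint_Tmin (hdef : S.IsDefinite) : S.Tmin.adjoint = S.Tmax := by
  refine le_antisymm ?_ ?_
  · rintro ⟨z', g'⟩ hzg
    obtain ⟨z, rfl⟩ := π_surjective z'
    obtain ⟨g, rfl⟩ := π_surjective g'
    obtain ⟨w, hw, -, hws⟩ := exists_mem_solutions_support _ g.locInt (0 : BoldH H Hh)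
    obtain ⟨β₀, h1, h2, h3⟩ := exists_definite hdef
    have hβ₀ := S.mem_of_lt h1 h2
    obtain ⟨e, he⟩ := exists_homSol_of_mem_adjoint hzg hw hβ₀ h2
    have hae : ∀ᵐ t ∂volume.restrict S.I, S.Δ t (z t - w t - S.homSol e t) = 0 := by
      refine S.ae_of_forall_Icc h2 fun β h4 h5 hβ => ?_
      obtain ⟨e', he'⟩ := exists_homSol_of_mem_adjoint hzg hw hβ h5
      have he'' := ae_restrict_of_ae_restrict_of_subset (Set.Icc_subset_Icc_right h4.le) he'
      -- Both homogeneous solutions represent `z - w` on `[a, β₀]` up to `Δ`-null functions, so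
      -- definiteness there identifies them and `e` does not depend on `β`.
      have : e - e' = 0 := by
        refine h3 _ ?_
        filter_upwards [he, he''] with t ht ht'
        rw [map_sub, Pi.sub_apply, ← sub_sub_sub_cancel_left _ _ (z t - w t), map_sub, ht, ht',
          sub_zero]
      rwa [sub_eq_zero.1 this]
    set y : ℝ → BoldH H Hh := w + S.homSol e
    have hy : (y, fun t => S.Δ t (g t)) ∈ S.solutions := by
      have := S.solutions.add_mem hw (homSol_mem e)
      rwa [Prod.mk_add_mk, add_zero] at this
    have hΔ : ∀ᵐ t ∂volume.restrict S.I, S.Δ t (y t) = S.Δ t (z t) := by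
      filter_upwards [hae] with t ht
      rw [sub_sub, map_sub, sub_eq_zero] at ht
      exact ht.symm
    -- Square integrability passes from `z` to `y`, since `Δ y = Δ z` implies `(Δ y, y) = (Δ z, z)`.
    have hmem : y ∈ S.lSqSubmodule := by
      refine ⟨IsAC.aestronglyMeasurable hy.1, z.mem.2.congr ?_⟩
      filter_upwards [hΔ, S.Δ_nonneg] with t ht hp
      rw [ht, ← inner_apply_symm hp, ← inner_apply_symm hp (y t), ht]
    refine mem_Tmax_iff.2 ⟨(LSq.mk y hmem, g), ⟨?_, hy.1, hy.2⟩, Prod.ext (π_eq_iff.2 hΔ) rfl⟩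
    refine (Function.support_add _ _).trans (Set.union_subset hws ?_)
    exact (exists_mem_solutions_support (S := S) 0 locInt_zero e).choose_spec.2.2
  · rintro ⟨z', g'⟩ hzg
    obtain ⟨q, hq, he⟩ := mem_Tmax_iff.1 hzg
    rw [← he, mem_adjoint_Tmin_iff]
    exact fun p hp => inner_eq_of_mem_tmin hp hq

theorem Tmin_le_Tmax : S.Tmin ≤ S.Tmax := by
  rintro q hq
  obtain ⟨p, hp, he⟩ := mem_Tmin_iff.1 hq
  exact mem_Tmax_iff.2 ⟨p, hp.1, he⟩

/-- An element `p` of the adjoint lies in `T_max`, and the Green identity reduces to `[p, r]_b = (J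
p(a), r(a))` for all `r`. Taking `r` with `r(a) = J p(a)` and `r = 0` near `b` forces `p(a) = 0`,
and then `[p, r]_b = 0` for every `r`. -/
theorem adjoint_Tmax (hdef : S.IsDefinite) : S.Tmax.adjoint = S.Tmin := by
  refine le_antisymm ?_ ?_
  · rintro q hq
    have hq' : q ∈ S.Tmax := by
      rw [← adjoint_Tmin hdef]
      rw [Submodule.mem_adjoint_iff] at hq ⊢
      exact fun a b hab => hq a b (Tmin_le_Tmax hab)
    obtain ⟨p, hp, rfl⟩ := mem_Tmax_iff.1 hq'
    have hadj := mem_adjoint_Tmax_iff.1 hq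
    have hG : ∀ r ∈ S.tmax, S.bForm p.1 r.1 = inner ℂ (r.1 S.a) (opJ H Hh (p.1 S.a)) := by
      intro r hr
      rw [bForm_eq hp hr, hadj r hr, sub_self, add_zero]
    have ha : p.1 S.a = 0 := by
      refine opJ_injective ((?_ : opJ H Hh (p.1 S.a) = 0).trans (map_zero _).symm)
      obtain ⟨r, hr, hra, hr0⟩ := exists_mem_tmax hdef (opJ H Hh (p.1 S.a))
      have h1 := hG r hr
      rw [hra] at h1
      rw [← inner_self_eq_zero (𝕜 := ℂ), ← h1]
      refine tendsto_nhds_unique (tendsto_bForm hp hr) (tendsto_const_nhds.congr' ?_)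
      filter_upwards [hr0] with t ht
      rw [ht, inner_zero_left]
    refine mem_Tmin_iff.2 ⟨p, mem_tmin_iff.2 ⟨hp, ha, fun r hr => ?_⟩, rfl⟩
    rw [hG r hr, ha, map_zero, inner_zero_right]
  · rintro q hq
    obtain ⟨p, hp, rfl⟩ := mem_Tmin_iff.1 hq
    refine mem_adjoint_Tmax_iff.2 fun r hr => ?_
    have := inner_eq_of_mem_tmin hp hr
    rw [← inner_conj_symm, ← this, inner_conj_symm]

theorem isClosed_adjoint {X : Type*} [NormedAddCommGroup X] [InnerProductSpace ℂ X]
    (A : Submodule ℂ (X × X)) : IsClosed (A.adjoint : Set (X × X)) := by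
  have : (A.adjoint : Set (X × X)) =
      ⋂ p : A, {x | (inner ℂ p.1.2 x.1 : ℂ) - inner ℂ p.1.1 x.2 = 0} := by
    ext x
    simp only [SetLike.mem_coe, Submodule.mem_adjoint_iff, Set.mem_iInter, Set.mem_ofPred_eq]
    exact ⟨fun h p => h _ _ p.2, fun h a b hab => h ⟨(a, b), hab⟩⟩
  rw [this]
  exact isClosed_iInter fun p => isClosed_eq (by fun_prop) continuous_const

theorem isClosed_Tmin (hdef : S.IsDefinite) : IsClosed (S.Tmin : Set (S.L2 × S.L2)) := by
  rw [← adjoint_Tmax hdef]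
  exact isClosed_adjoint _

end SymmetricSystem

/-! ### The orthogonal projection onto the range of a positive operator -/

section PositiveOperator

variable {E : Type*} [NormedAddCommGroup E] [InnerProductSpace ℂ E]

/-- A generalized inverse: a section of `f` over its range, extended to the whole space. -/
theorem exists_comp_comp_eq (f : E →ₗ[ℂ] E) : ∃ g : E →ₗ[ℂ] E, ∀ x, f (g (f x)) = f x := by
  obtain ⟨h, hh⟩ := f.rangeRestrict.exists_rightInverse_of_surjective f.range_rangeRestrict
  obtain ⟨g, hg⟩ := LinearMap.exists_extend h
  refine ⟨g, fun x => ?_⟩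
  have h1 : g (f x) = h (f.rangeRestrict x) :=
    LinearMap.congr_fun hg (f.rangeRestrict x)
  rw [h1]
  exact congrArg Subtype.val (LinearMap.congr_fun hh (f.rangeRestrict x))

theorem isPositive_re_nonneg {T : E →L[ℂ] E} (hT : T.IsPositive) (x : E) :
    0 ≤ (inner ℂ (T x) x : ℂ).re := by
  have h := hT.2 x
  rwa [ContinuousLinearMap.reApplyInnerSelf_apply] at h

/-- Positivity on `z - w`, together with `T (z - w) = -r z`, gives `‖z‖² ≤ Re (z, w)`. -/
theorem norm_le_of_add_smul_eq {T : E →L[ℂ] E} (hT : T.IsPositive) {r : ℝ} (hr : 0 < r) {z w : E}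
    (h : T z + (r : ℂ) • z = T w) : ‖z‖ ≤ ‖w‖ := by
  have h1 := isPositive_re_nonneg hT (z - w)
  have h2 : T (z - w) = -((r : ℂ) • z) := by
    rw [map_sub, ← h]
    abel
  rw [h2, inner_neg_left, inner_smul_left, inner_sub_right, inner_self_eq_norm_sq_to_K] at h1
  simp [← Complex.ofReal_pow] at h1
  have h3 : ‖z‖ ^ 2 ≤ (inner ℂ z w : ℂ).re := by
    by_contra h
    have := mul_pos hr (sub_pos.2 (not_le.1 h))
    linarith
  have h4 : (inner ℂ z w : ℂ).re ≤ ‖z‖ * ‖w‖ :=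
    (Complex.re_le_norm _).trans (norm_inner_le_norm z w)
  by_contra hlt
  push Not at hlt
  nlinarith [norm_nonneg z, norm_nonneg w]

variable [FiniteDimensional ℂ E]

theorem isUnit_add_smul_one {T : E →L[ℂ] E} (hT : T.IsPositive) {r : ℝ} (hr : 0 < r) :
    IsUnit (T + (r : ℂ) • (1 : E →L[ℂ] E)) := by
  have hc : CompleteSpace E := FiniteDimensional.complete ℂ E
  have hinj : Function.Injective (T + (r : ℂ) • (1 : E →L[ℂ] E)) := by
    refine (injective_iff_map_eq_zero _).2 fun x hx => ?_
    have h1 : (inner ℂ (T x + (r : ℂ) • x) x : ℂ) = 0 := by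
      rw [show T x + (r : ℂ) • x = (T + (r : ℂ) • (1 : E →L[ℂ] E)) x from rfl, hx,
        inner_zero_left]
    rw [inner_add_left, inner_smul_left, inner_self_eq_norm_sq_to_K] at h1
    have h2 := congrArg Complex.re h1
    have h3 := isPositive_re_nonneg hT x
    simp [← Complex.ofReal_pow] at h2
    have h4 : ‖x‖ ^ 2 ≤ 0 := by
      by_contra h
      have := mul_pos hr (not_le.1 h)
      linarith
    simpa using h4
  exact ContinuousLinearMap.isUnit_iff_bijective.2 ⟨hinj,
    (LinearMap.injective_iff_surjective
      (f := ((T + (r : ℂ) • (1 : E →L[ℂ] E) : E →L[ℂ] E) : E →ₗ[ℂ] E))).1 hinj⟩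

/-- The regularization `(T + r)⁻¹ T` of the projection onto the range of `T`. -/
def regProj (T : E →L[ℂ] E) (r : ℝ) : E →L[ℂ] E :=
  Ring.inverse (T + (r : ℂ) • (1 : E →L[ℂ] E)) * T

theorem regProj_spec {T : E →L[ℂ] E} (hT : T.IsPositive) {r : ℝ} (hr : 0 < r) (x : E) :
    T (regProj T r x) + (r : ℂ) • regProj T r x = T x := by
  have h := Ring.mul_inverse_cancel _ (isUnit_add_smul_one hT hr)
  exact DFunLike.congr_fun h (T x)

/-- For symmetric `T` the ranges of `T` and `T²` coincide, so `T x = T² w` and `(T + r)⁻¹ T x = T w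
- r (T + r)⁻¹ T w`, which tends to `T w`, the projection of `x` onto the range of `T`. The limit
depends on `T x` alone, through `L`. The resolvent form serves to obtain measurability of this
projection when `T = Δ(t)` varies with `t`. -/
theorem exists_tendsto_regProj {T : E →L[ℂ] E} (hT : T.IsPositive) :
    ∃ L : E →L[ℂ] E, (∀ x, T (L (T x)) = T x) ∧
      ∀ x, Tendsto (fun k : ℕ => regProj T (1 / ((k : ℝ) + 1)) x) atTop (𝓝 (L (T x))) := by
  have hker : ∀ x, T (T x) = 0 → T x = 0 := by
    intro x hx
    have h1 : (inner ℂ (T (T x)) x : ℂ) = inner ℂ (T x) (T x) := hT.1 (T x) x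
    rw [hx, inner_zero_left, eq_comm, inner_self_eq_zero] at h1
    exact h1
  have hw : ∀ x, ∃ w, T (T w) = T x := by
    intro x
    let U := (T : E →ₗ[ℂ] E).rangeRestrict ∘ₗ (LinearMap.range (T : E →ₗ[ℂ] E)).subtype
    have hinj : Function.Injective U := by
      refine (injective_iff_map_eq_zero U).2 ?_
      rintro ⟨_, z, rfl⟩ hz
      exact Subtype.ext (hker z (congrArg Subtype.val hz))
    obtain ⟨⟨_, w, rfl⟩, h⟩ := LinearMap.injective_iff_surjective.1 hinj
      ((T : E →ₗ[ℂ] E).rangeRestrict x)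
    exact ⟨w, congrArg Subtype.val h⟩
  obtain ⟨g, hg⟩ := exists_comp_comp_eq ((T : E →ₗ[ℂ] E) ∘ₗ (T : E →ₗ[ℂ] E))
  have hg' : ∀ x, T (T (g (T x))) = T x := by
    intro x
    obtain ⟨w, hw⟩ := hw x
    rw [← hw]
    exact hg w
  refine ⟨T ∘L LinearMap.toContinuousLinearMap g, hg', fun x => ?_⟩
  set w := g (T x) with hwdef
  change Tendsto _ _ (𝓝 (T w))
  have hr : ∀ k : ℕ, 0 < 1 / ((k : ℝ) + 1) := fun k => by positivity
  have hb : ∀ k : ℕ, ‖regProj T (1 / ((k : ℝ) + 1)) w‖ ≤ ‖w‖ := fun k =>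
    norm_le_of_add_smul_eq hT (hr k) (regProj_spec hT (hr k) w)
  have he : ∀ k : ℕ, regProj T (1 / ((k : ℝ) + 1)) x =
      T w - ((1 / ((k : ℝ) + 1) : ℝ) : ℂ) • regProj T (1 / ((k : ℝ) + 1)) w := by
    intro k
    have h1 := Ring.inverse_mul_cancel _ (isUnit_add_smul_one hT (hr k))
    have h2 := DFunLike.congr_fun h1 (T w)
    have h3 : regProj T (1 / ((k : ℝ) + 1)) x =
        Ring.inverse (T + ((1 / ((k : ℝ) + 1) : ℝ) : ℂ) • (1 : E →L[ℂ] E)) (T (T w)) := by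
      rw [hg' x]
      rfl
    rw [h3, eq_sub_iff_add_eq]
    refine Eq.trans ?_ h2
    simp only [mul_apply_eq_comp, add_apply,
      smul_apply, one_apply_eq_self, map_add, map_smul]
    rfl
  simp only [he]
  nth_rewrite 2 [← sub_zero (T w)]
  refine tendsto_const_nhds.sub (squeeze_zero_norm (fun k => ?_)
    (by simpa only [zero_mul] using
      (tendsto_one_div_add_atTop_nhds_zero_nat (𝕜 := ℝ)).mul_const ‖w‖))
  rw [norm_smul, Complex.norm_real, Real.norm_of_nonneg (hr k).le]
  exact mul_le_mul_of_nonneg_left (hb k) (hr k).le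

end PositiveOperator

/-- Approximating `φ` by simple functions needs nothing of `g` except continuity at the values of
`φ`. This suits operator inversion, whose continuity is known only at invertible operators. -/
theorem MeasureTheory.AEStronglyMeasurable.comp_of_continuousAt {α β γ : Type*}
    [MeasurableSpace α] [TopologicalSpace β] [TopologicalSpace γ]
    [TopologicalSpace.PseudoMetrizableSpace γ] {μ : Measure α} {φ : α → β} {g : β → γ}
    (hφ : AEStronglyMeasurable φ μ) (hg : ∀ᵐ a ∂μ, ContinuousAt g (φ a)) :
    AEStronglyMeasurable (g ∘ φ) μ := by
  refine aestronglyMeasurable_of_tendsto_ae atTop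
    (f := fun n => (hφ.stronglyMeasurable_mk.approx n).map g)
    (fun n => (SimpleFunc.stronglyMeasurable _).aestronglyMeasurable) ?_
  filter_upwards [hg, hφ.ae_eq_mk] with a ha he
  have := hφ.stronglyMeasurable_mk.tendsto_approx a
  rw [← he] at this
  exact ha.tendsto.comp this

namespace SymmetricSystem

variable {H Hh : Type*} [NormedAddCommGroup H] [InnerProductSpace ℂ H]
  [NormedAddCommGroup Hh] [InnerProductSpace ℂ Hh]
  {S : SymmetricSystem H Hh}

/-! ### Completeness of `L²_Δ(I)` -/

/-- Rescaling `x` in `norm_apply_le_of_isPositive` frees a parameter, later taken as `2⁻ⁿ`, that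
trades the operator norm against the quadratic form. -/
theorem norm_apply_le_add {T : BoldH H Hh →L[ℂ] BoldH H Hh} (hT : T.IsPositive)
    (x : BoldH H Hh) {r : ℝ} (hr : 0 < r) :
    ‖T x‖ ≤ r * ‖T‖ + r⁻¹ * (inner ℂ x (T x) : ℂ).re := by
  have h := norm_apply_le_of_isPositive hT (((r⁻¹ : ℝ) : ℂ) • x)
  have h1 : (inner ℂ x (T x) : ℂ) = ((inner ℂ x (T x) : ℂ).re : ℂ) :=
    Complex.ext rfl (form_im hT x)
  rw [map_smul, inner_smul_left, inner_smul_right, norm_smul, norm_mul, norm_mul, h1] at h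
  simp only [Complex.conj_ofReal, Complex.norm_real, Real.norm_of_nonneg (form_nonneg hT x),
    Real.norm_of_nonneg (inv_pos.2 hr).le] at h
  have h2 := mul_le_mul_of_nonneg_left h hr.le
  rw [mul_inv_cancel_left₀ hr.ne', mul_add, mul_inv_cancel_left₀ hr.ne'] at h2
  exact h2

theorem LSq.lintegral_form (f : S.LSq) :
    ∫⁻ t in S.I, ENNReal.ofReal (inner ℂ (f t) (S.Δ t (f t)) : ℂ).re =
      ENNReal.ofReal (‖f‖ ^ 2) := by
  have h0 : ∀ᵐ t ∂volume.restrict S.I, 0 ≤ (inner ℂ (f t) (S.Δ t (f t)) : ℂ).re := by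
    filter_upwards [S.Δ_nonneg] with t ht using form_nonneg ht _
  refine (ofReal_integral_eq_lintegral_ofReal (LSq.integrableOn_form f f).re h0).symm.trans ?_
  congr 1
  have h1 := integral_re (𝕜 := ℂ) (LSq.integrableOn_form f f)
  rw [← LSq.inner_eq, inner_self_eq_norm_sq] at h1
  exact h1

/-- A consequence of Fatou's lemma. -/
theorem exists_norm_le_of_tendsto {g : ℝ → BoldH H Hh}
    (hg : AEStronglyMeasurable g (volume.restrict S.I)) {u : ℕ → S.LSq} {C : ℝ} (hC0 : 0 ≤ C)
    (hC : ∀ᶠ m in atTop, ‖u m‖ ≤ C)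
    (h : ∀ᵐ t ∂volume.restrict S.I, Tendsto (fun m => (inner ℂ (u m t) (S.Δ t (u m t)) : ℂ).re)
      atTop (𝓝 (inner ℂ (g t) (S.Δ t (g t)) : ℂ).re)) :
    ∃ f : S.LSq, LSq.toFun f = g ∧ ‖f‖ ≤ C := by
  have hm := S.aestronglyMeasurable_form hg hg
  have h1 : ∫⁻ t in S.I, ENNReal.ofReal (inner ℂ (g t) (S.Δ t (g t)) : ℂ).re ≤
      ENNReal.ofReal (C ^ 2) := by
    calc ∫⁻ t in S.I, ENNReal.ofReal (inner ℂ (g t) (S.Δ t (g t)) : ℂ).re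
        = ∫⁻ t in S.I, liminf (fun m =>
            ENNReal.ofReal (inner ℂ (u m t) (S.Δ t (u m t)) : ℂ).re) atTop := by
          refine lintegral_congr_ae ?_
          filter_upwards [h] with t ht
          exact ((ENNReal.tendsto_ofReal ht).liminf_eq).symm
      _ ≤ liminf (fun m => ∫⁻ t in S.I,
            ENNReal.ofReal (inner ℂ (u m t) (S.Δ t (u m t)) : ℂ).re) atTop :=
          lintegral_liminf_le' fun m =>
            (LSq.integrableOn_form (u m) (u m)).re.aestronglyMeasurable.aemeasurable.ennreal_ofReal
      _ ≤ ENNReal.ofReal (C ^ 2) := by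
          refine liminf_le_of_frequently_le' (Eventually.frequently ?_)
          filter_upwards [hC] with m hm
          rw [LSq.lintegral_form]
          gcongr
  have hint : IntegrableOn (fun t => (inner ℂ (g t) (S.Δ t (g t)) : ℂ)) S.I := by
    refine ⟨hm, ?_⟩
    refine lt_of_le_of_lt (lintegral_mono_ae ?_) (h1.trans_lt ENNReal.ofReal_lt_top)
    filter_upwards [S.Δ_nonneg] with t ht
    rw [← ofReal_norm]
    refine ENNReal.ofReal_le_ofReal ?_
    rw [show (inner ℂ (g t) (S.Δ t (g t)) : ℂ) = ((inner ℂ (g t) (S.Δ t (g t)) : ℂ).re : ℂ) from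
      Complex.ext rfl (form_im ht _), Complex.norm_real, Real.norm_of_nonneg (form_nonneg ht _),
      Complex.ofReal_re]
  obtain ⟨f, hf⟩ : ∃ f : S.LSq, LSq.toFun f = g := ⟨LSq.mk g ⟨hg, hint⟩, rfl⟩
  refine ⟨f, hf, ?_⟩
  have h2 := LSq.lintegral_form f
  rw [hf] at h2
  rw [h2, ENNReal.ofReal_le_ofReal_iff (by positivity)] at h1
  exact le_of_sq_le_sq h1 hC0

variable [FiniteDimensional ℂ H] [FiniteDimensional ℂ Hh]

/-- Weighted by `2ⁿ`, the forms of the increments still have summable integrals, at most `2⁻ⁿ`, so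
they are summable at almost every `t`. The bound on `‖Δ x‖` with `r = 2⁻ⁿ` then makes `Δ u_n` a
Cauchy sequence pointwise. -/
theorem exists_ae_tendsto {u : ℕ → S.LSq}
    (hu : ∀ n, ‖u (n + 1) - u n‖ ^ 2 ≤ (1 / 4 : ℝ) ^ n) :
    ∀ᵐ t ∂volume.restrict S.I, ∃ v, Tendsto (fun n => S.Δ t (u n t)) atTop (𝓝 v) := by
  set d : ℕ → ℝ → ℝ := fun n t =>
    (inner ℂ ((u (n + 1) - u n : S.LSq) t) (S.Δ t ((u (n + 1) - u n : S.LSq) t)) : ℂ).re with hd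
  have hdm : ∀ n, AEMeasurable (fun t => ENNReal.ofReal ((2 : ℝ) ^ n * d n t))
      (volume.restrict S.I) := fun n =>
    ((LSq.integrableOn_form (u (n + 1) - u n) (u (n + 1) - u n)).re.aestronglyMeasurable.aemeasurable.const_mul
      ((2 : ℝ) ^ n)).ennreal_ofReal
  have h1 : ∀ n, ∫⁻ t in S.I, ENNReal.ofReal ((2 : ℝ) ^ n * d n t) ≤
      ENNReal.ofReal ((1 / 2 : ℝ) ^ n) := by
    intro n
    have h2n : (0 : ℝ) ≤ 2 ^ n := by positivity
    simp only [ENNReal.ofReal_mul h2n]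
    rw [lintegral_const_mul' _ _ ENNReal.ofReal_ne_top, hd]
    simp only
    rw [LSq.lintegral_form, ← ENNReal.ofReal_mul h2n]
    refine ENNReal.ofReal_le_ofReal ((mul_le_mul_of_nonneg_left (hu n) h2n).trans_eq ?_)
    rw [← mul_pow]
    norm_num
  have h2 : ∫⁻ t in S.I, ∑' n, ENNReal.ofReal ((2 : ℝ) ^ n * d n t) ≠ ⊤ := by
    rw [lintegral_tsum hdm]
    refine ne_top_of_le_ne_top ?_ (ENNReal.tsum_le_tsum h1)
    rw [← ENNReal.ofReal_tsum_of_nonneg (fun n => by positivity)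
      (summable_geometric_of_lt_one (by norm_num) (by norm_num))]
    exact ENNReal.ofReal_ne_top
  filter_upwards [ae_lt_top' (AEMeasurable.tsum hdm) h2, S.Δ_nonneg] with t ht hp
  have hd0 : ∀ n, 0 ≤ d n t := fun n => form_nonneg hp _
  have hs : Summable fun n => (2 : ℝ) ^ n * d n t := by
    have h3 := ENNReal.summable_toReal ht.ne
    refine h3.congr fun n => ?_
    rw [ENNReal.toReal_ofReal (mul_nonneg (by positivity) (hd0 n))]
  refine cauchySeq_tendsto_of_complete (cauchySeq_of_dist_le_of_summable
    (fun n => (1 / 2 : ℝ) ^ n * ‖S.Δ t‖ + (2 : ℝ) ^ n * d n t) (fun n => ?_)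
    (((summable_geometric_of_lt_one (by norm_num) (by norm_num)).mul_right _).add hs))
  rw [dist_comm, dist_eq_norm, ← map_sub]
  have h4 := norm_apply_le_add hp ((u (n + 1) - u n : S.LSq) t) (r := (1 / 2 : ℝ) ^ n)
    (by positivity)
  rw [← inv_pow, one_div, inv_inv] at h4
  rw [one_div]
  simpa only [map_sub, Pi.sub_apply, hd] using h4

theorem aestronglyMeasurable_regProj {r : ℝ} (hr : 0 < r) :
    AEStronglyMeasurable (fun t => regProj (S.Δ t) r) (volume.restrict S.I) := by
  refine S.aestronglyMeasurable_Δ.comp_of_continuousAt (g := fun T => regProj T r) ?_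
  filter_upwards [S.Δ_nonneg] with t ht
  obtain ⟨v, hv⟩ := isUnit_add_smul_one ht hr
  have h1 : ContinuousAt Ring.inverse (S.Δ t + (r : ℂ) • (1 : BoldH H Hh →L[ℂ] BoldH H Hh)) := by
    rw [← hv]
    exact NormedRing.inverse_continuousAt v
  have h2 : ContinuousAt (fun T : BoldH H Hh →L[ℂ] BoldH H Hh =>
      T + (r : ℂ) • (1 : BoldH H Hh →L[ℂ] BoldH H Hh)) (S.Δ t) := by fun_prop
  exact (ContinuousAt.comp (f := fun T : BoldH H Hh →L[ℂ] BoldH H Hh =>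
      T + (r : ℂ) • (1 : BoldH H Hh →L[ℂ] BoldH H Hh)) h1 h2).mul continuousAt_id

/-- For a rapidly Cauchy sequence only `Δ u_n` converges pointwise, to some `v`; where `Δ`
degenerates `u_n` may not. The limit is taken to be `L v`, the preimage of `v` in the range of `Δ`.
It is measurable because `L Δ u_n` is a pointwise limit of regularized projections of `u_n`, and
Fatou's lemma applied to `u_n - u_m` gives `‖u_n - L v‖ ≤ 2⁻ⁿ`. -/
instance : CompleteSpace S.LSq := by
  refine Metric.complete_of_convergent_controlled_sequences (fun n => (1 / 2 : ℝ) ^ n)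
    (fun n => by positivity) fun u hu => ?_
  have hu1 : ∀ n, ‖u (n + 1) - u n‖ ^ 2 ≤ (1 / 4 : ℝ) ^ n := by
    intro n
    have h := (hu n (n + 1) n n.le_succ le_rfl).le
    rw [dist_eq_norm] at h
    refine (pow_le_pow_left₀ (norm_nonneg _) h 2).trans_eq ?_
    rw [← pow_mul, mul_comm n 2, pow_mul]
    norm_num
  have hL : ∀ᵐ t ∂volume.restrict S.I, ∃ L : BoldH H Hh →L[ℂ] BoldH H Hh,
      (∀ x, S.Δ t (L (S.Δ t x)) = S.Δ t x) ∧
      ∀ x, Tendsto (fun k : ℕ => regProj (S.Δ t) (1 / ((k : ℝ) + 1)) x) atTop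
        (𝓝 (L (S.Δ t x))) := by
    filter_upwards [S.Δ_nonneg] with t ht using exists_tendsto_regProj ht
  obtain ⟨L, hL⟩ : ∃ L : ℝ → BoldH H Hh →L[ℂ] BoldH H Hh, ∀ᵐ t ∂volume.restrict S.I,
      (∀ x, S.Δ t (L t (S.Δ t x)) = S.Δ t x) ∧
      ∀ x, Tendsto (fun k : ℕ => regProj (S.Δ t) (1 / ((k : ℝ) + 1)) x) atTop
        (𝓝 (L t (S.Δ t x))) := by
    classical
    refine ⟨fun t => if h : ∃ L : BoldH H Hh →L[ℂ] BoldH H Hh,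
      (∀ x, S.Δ t (L (S.Δ t x)) = S.Δ t x) ∧
      ∀ x, Tendsto (fun k : ℕ => regProj (S.Δ t) (1 / ((k : ℝ) + 1)) x) atTop
        (𝓝 (L (S.Δ t x))) then h.choose else 0, ?_⟩
    filter_upwards [hL] with t ht
    rw [dif_pos ht]
    exact ht.choose_spec
  obtain ⟨v, hv⟩ : ∃ v : ℝ → BoldH H Hh, ∀ᵐ t ∂volume.restrict S.I,
      Tendsto (fun n => S.Δ t (u n t)) atTop (𝓝 (v t)) := by
    classical
    refine ⟨fun t => if h : ∃ v, Tendsto (fun n => S.Δ t (u n t)) atTop (𝓝 v)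
      then h.choose else 0, ?_⟩
    filter_upwards [exists_ae_tendsto hu1] with t ht
    rw [dif_pos ht]
    exact ht.choose_spec
  have hPm : ∀ n, AEStronglyMeasurable (fun t => L t (S.Δ t (u n t))) (volume.restrict S.I) := by
    intro n
    refine aestronglyMeasurable_of_tendsto_ae atTop
      (f := fun (k : ℕ) t => regProj (S.Δ t) (1 / ((k : ℝ) + 1)) (u n t)) (fun k => ?_) ?_
    · exact (isBoundedBilinearMap_apply (𝕜 := ℂ) (E := BoldH H Hh)
        (F := BoldH H Hh)).continuous.comp_aestronglyMeasurable
          ((aestronglyMeasurable_regProj (by positivity)).prodMk (u n).aestronglyMeasurable)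
    · filter_upwards [hL] with t ht using ht.2 _
  have hfm : AEStronglyMeasurable (fun t => L t (v t)) (volume.restrict S.I) := by
    refine aestronglyMeasurable_of_tendsto_ae atTop hPm ?_
    filter_upwards [hv] with t ht
    exact ((L t).continuous.tendsto _).comp ht
  -- convergence of the quadratic forms
  have hform : ∀ (w : ℕ → S.LSq) (g : ℝ → BoldH H Hh), (∀ᵐ t ∂volume.restrict S.I,
      Tendsto (fun m => L t (S.Δ t (w m t))) atTop (𝓝 (L t (S.Δ t (g t))))) →
      ∀ᵐ t ∂volume.restrict S.I, Tendsto (fun m => (inner ℂ (w m t) (S.Δ t (w m t)) : ℂ).re)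
        atTop (𝓝 (inner ℂ (g t) (S.Δ t (g t)) : ℂ).re) := by
    intro w g hwg
    filter_upwards [hwg, hL, S.Δ_nonneg] with t h1 h2 hp
    -- The quadratic form of `Δ` depends only on the projection `L Δ x`, so convergence of these
    -- projections suffices.
    have h3 : ∀ x, (inner ℂ x (S.Δ t x) : ℂ) =
        inner ℂ (L t (S.Δ t x)) (S.Δ t (L t (S.Δ t x))) := by
      intro x
      rw [h2.1, ← inner_apply_symm hp x, ← inner_apply_symm hp (L t (S.Δ t x)) x, h2.1]
    rw [h3 (g t)]
    simp only [h3 (w _ t)]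
    refine (Complex.continuous_re.tendsto _).comp ?_
    exact h1.inner (((S.Δ t).continuous.tendsto _).comp h1)
  have hvL : ∀ᵐ t ∂volume.restrict S.I, S.Δ t (L t (v t)) = v t := by
    filter_upwards [hv, hL] with t h1 h2
    refine tendsto_nhds_unique ((((S.Δ t).continuous.comp (L t).continuous).tendsto _).comp h1) ?_
    refine h1.congr fun n => ?_
    simp only [Function.comp_apply, h2.1]
  have hlim : ∀ᵐ t ∂volume.restrict S.I,
      Tendsto (fun m => L t (S.Δ t (u m t))) atTop (𝓝 (L t (S.Δ t (L t (v t))))) := by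
    filter_upwards [hv, hvL] with t h1 h2
    rw [h2]
    exact ((L t).continuous.tendsto _).comp h1
  have hbd : ∀ᶠ m in atTop, ‖u m‖ ≤ ‖u 0‖ + 1 := by
    refine .of_forall fun m => ?_
    have h := (hu 0 m 0 m.zero_le le_rfl).le
    rw [dist_eq_norm, pow_zero] at h
    have h2 := norm_le_norm_add_norm_sub (u 0) (u m)
    rw [norm_sub_rev] at h
    linarith
  obtain ⟨f, hf, -⟩ := exists_norm_le_of_tendsto hfm (by positivity) hbd (hform u _ hlim)
  refine ⟨f, tendsto_iff_norm_sub_tendsto_zero.2 ?_⟩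
  refine squeeze_zero (fun _ => norm_nonneg _) (fun n => ?_)
    (tendsto_pow_atTop_nhds_zero_of_lt_one (r := (1 / 2 : ℝ)) (by norm_num) (by norm_num))
  have hlim' : ∀ᵐ t ∂volume.restrict S.I,
      Tendsto (fun m => L t (S.Δ t ((u n - u m : S.LSq) t))) atTop
        (𝓝 (L t (S.Δ t ((u n - f : S.LSq) t)))) := by
    filter_upwards [hlim] with t h1
    simp only [map_sub, Pi.sub_apply, hf]
    exact tendsto_const_nhds.sub h1
  obtain ⟨f', hf', hn⟩ := exists_norm_le_of_tendsto (u := fun m => u n - u m)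
    (u n - f).aestronglyMeasurable (by positivity : (0 : ℝ) ≤ (1 / 2) ^ n)
    ((eventually_ge_atTop n).mono fun m hm => by
      have := (hu n n m le_rfl hm).le
      rwa [dist_eq_norm] at this) (hform _ _ hlim')
  rwa [LSq.ext fun t => congrFun hf' t] at hn

end SymmetricSystem

/-! ### The von Neumann decomposition -/

section VonNeumann

variable {X : Type*} [NormedAddCommGroup X] [InnerProductSpace ℂ X]

theorem mem_defectSubspace {A : Submodule ℂ (X × X)} {c : ℂ} {x : X} :
    x ∈ defectSubspace A c ↔ (x, c • x) ∈ A.adjoint := Iff.rfl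

/-- Symmetry makes `(p.2, p.1)` real, so the cross term, multiplied by `i`, has no real part. -/
theorem norm_add_I_smul_sq {A : Submodule ℂ (X × X)} (hA : A ≤ A.adjoint) {p : X × X}
    (hp : p ∈ A) : ‖p.2 + Complex.I • p.1‖ ^ 2 = ‖p.2‖ ^ 2 + ‖p.1‖ ^ 2 := by
  have h := (Submodule.mem_adjoint_iff _ _).1 (hA hp) _ _ hp
  rw [sub_eq_zero, ← inner_conj_symm, Complex.conj_eq_iff_im] at h
  have h1 : (inner ℂ p.2 p.1 : ℂ).im = 0 := by
    rw [← inner_conj_symm, Complex.conj_im, h, neg_zero]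
  rw [norm_add_sq (𝕜 := ℂ), inner_smul_right, norm_smul, Complex.norm_I, one_mul]
  simp [h1]

/-- The map `p ↦ p.2 + i p.1` is bounded below on the closed relation `A`, so its range is closed,
and the orthogonal complement of the range lies in `ker (A* - i)`. Removing from `p` an element of
`A` and a defect element at `i` leaves a pair `q` with `q.2 = -i q.1`. -/
theorem exists_eq_add_of_mem_adjoint [CompleteSpace X] {A : Submodule ℂ (X × X)}
    (hc : IsClosed (A : Set (X × X))) (hA : A ≤ A.adjoint) {p : X × X} (hp : p ∈ A.adjoint) :
    ∃ a ∈ A, ∃ m ∈ defectSubspace A Complex.I, ∃ n ∈ defectSubspace A (-Complex.I),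
      p = a + (m, Complex.I • m) + (n, (-Complex.I) • n) := by
  let φ : A →L[ℂ] X := (ContinuousLinearMap.snd ℂ X X + Complex.I • ContinuousLinearMap.fst ℂ X X)
    ∘L A.subtypeL
  have hφ : ∀ a : A, φ a = a.1.2 + Complex.I • a.1.1 := fun a => rfl
  have hcA : CompleteSpace A := hc.completeSpace_coe
  have hanti : AntilipschitzWith 1 φ := by
    refine φ.antilipschitz_of_bound fun a => ?_
    have h := norm_add_I_smul_sq hA a.2
    rw [← hφ] at h
    rw [NNReal.coe_one, one_mul]
    change max ‖a.1.1‖ ‖a.1.2‖ ≤ _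
    refine max_le (le_of_sq_le_sq ?_ (norm_nonneg _)) (le_of_sq_le_sq ?_ (norm_nonneg _))
    · rw [h]; nlinarith [sq_nonneg ‖a.1.2‖]
    · rw [h]; nlinarith [sq_nonneg ‖a.1.1‖]
  have hcl : IsClosed (LinearMap.range φ.toLinearMap : Set X) := by
    have := hanti.isClosed_range φ.uniformContinuous
    rwa [LinearMap.coe_range]
  set R := LinearMap.range φ.toLinearMap
  have hcR : CompleteSpace R := hcl.completeSpace_coe
  have hperp : ∀ m ∈ Rᗮ, m ∈ defectSubspace A Complex.I := by
    intro m hm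
    rw [mem_defectSubspace, Submodule.mem_adjoint_iff]
    intro a b hab
    have h := (Submodule.mem_orthogonal _ _).1 hm (φ ⟨(a, b), hab⟩) ⟨_, rfl⟩
    rw [hφ, inner_add_left, inner_smul_left, Complex.conj_I] at h
    rw [inner_smul_right, ← h]
    ring
  obtain ⟨a, ha⟩ := (R.starProjection_apply_mem (p.2 + Complex.I • p.1) :)
  have hm := hperp _ (Submodule.sub_starProjection_mem_orthogonal (K := R)
    (p.2 + Complex.I • p.1))
  rw [← ha] at hm
  set m₀ := p.2 + Complex.I • p.1 - φ.toLinearMap a with hm₀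
  -- The pair `(m, i m)` contributes `2 i m` to `p.2 + i p.1`, hence the normalization.
  have hm₁ : (2 * Complex.I)⁻¹ • m₀ ∈ defectSubspace A Complex.I := Submodule.smul_mem _ _ hm
  set m := (2 * Complex.I)⁻¹ • m₀ with hmdef
  have h2 : (2 * Complex.I) • m = m₀ := by
    rw [hmdef, smul_inv_smul₀ (by simp)]
  set q := p - a.1 - (m, Complex.I • m) with hq
  have hqA : q ∈ A.adjoint :=
    Submodule.sub_mem _ (Submodule.sub_mem _ hp (hA a.2)) (mem_defectSubspace.1 hm₁)
  have hq2 : q.2 = -Complex.I • q.1 := by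
    rw [← sub_eq_zero, neg_smul, sub_neg_eq_add]
    have h3 : q.2 + Complex.I • q.1 =
        p.2 + Complex.I • p.1 - φ.toLinearMap a - (2 * Complex.I) • m := by
      change q.2 + Complex.I • q.1 = p.2 + Complex.I • p.1 - (a.1.2 + Complex.I • a.1.1) - _
      simp only [hq, Prod.snd_sub, Prod.fst_sub, smul_sub, two_mul, add_smul]
      abel
    rw [h3, h2, hm₀, sub_self]
  refine ⟨a.1, a.2, m, hm₁, q.1, ?_, ?_⟩
  · rw [mem_defectSubspace, ← hq2]
    exact hqA
  · rw [← hq2, Prod.mk.eta, hq]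
    abel

/-- The inertia of the boundary form of a closed symmetric relation is given by its deficiency
indices. -/
theorem finrank_eq_of_deficiency_eq [CompleteSpace X] {A : Submodule ℂ (X × X)}
    (hc : IsClosed (A : Set (X × X))) (hA : A ≤ A.adjoint)
    {P N : Type*} [AddCommGroup P] [Module ℂ P] [FiniteDimensional ℂ P]
    [AddCommGroup N] [Module ℂ N] [FiniteDimensional ℂ N]
    (u : A.adjoint →ₗ[ℂ] P) (v : A.adjoint →ₗ[ℂ] N)
    (hsurj : ∀ p n, ∃ f, u f = p ∧ v f = n) (hker : ∀ f, f.1 ∈ A → u f = 0 ∧ v f = 0)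
    (hu : ∀ f, u f = 0 → (-Complex.I * (inner ℂ f.1.1 f.1.2 - inner ℂ f.1.2 f.1.1)).re ≤ 0)
    (hv : ∀ f, v f = 0 → 0 ≤ (-Complex.I * (inner ℂ f.1.1 f.1.2 - inner ℂ f.1.2 f.1.1)).re)
    (h : deficiencyPlus A = deficiencyMinus A) :
    Module.finrank ℂ P = Module.finrank ℂ N := by
  let ι : ∀ c : ℂ, defectSubspace A c →ₗ[ℂ] A.adjoint := fun c =>
    LinearMap.codRestrict _ ((LinearMap.prod LinearMap.id (c • LinearMap.id)) ∘ₗ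
      (defectSubspace A c).subtype) fun x => x.2
  have hι : ∀ c (x : defectSubspace A c), (ι c x).1 = (x.1, c • x.1) := fun c x => rfl
  -- On pairs `(x, c x)` the form equals `2 Im c ‖x‖²`: positive at `i`, negative at `-i`. Thus `u`
  -- is injective on the first defect space and `v` on the second.
  have hform : ∀ (c : ℂ) (x : defectSubspace A c),
      (-Complex.I * (inner ℂ (ι c x).1.1 (ι c x).1.2 - inner ℂ (ι c x).1.2 (ι c x).1.1)).re =
        2 * c.im * ‖x.1‖ ^ 2 := by
    intro c x
    simp only [hι]
    rw [inner_smul_right, inner_smul_left, inner_self_eq_norm_sq_to_K]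
    simp [← Complex.ofReal_pow]
    ring
  have hinjp : Function.Injective (u ∘ₗ ι Complex.I) := by
    refine (injective_iff_map_eq_zero _).2 fun x hx => ?_
    have h1 := hu _ hx
    rw [hform, Complex.I_im] at h1
    have h2 : ‖x.1‖ ^ 2 ≤ 0 := by linarith
    exact Subtype.ext (by simpa using h2)
  have hinjn : Function.Injective (v ∘ₗ ι (-Complex.I)) := by
    refine (injective_iff_map_eq_zero _).2 fun x hx => ?_
    have h1 := hv _ hx
    rw [hform, Complex.neg_im, Complex.I_im] at h1
    have h2 : ‖x.1‖ ^ 2 ≤ 0 := by linarith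
    exact Subtype.ext (by simpa using h2)
  have hfp : FiniteDimensional ℂ (defectSubspace A Complex.I) :=
    FiniteDimensional.of_injective _ hinjp
  have hfn : FiniteDimensional ℂ (defectSubspace A (-Complex.I)) :=
    FiniteDimensional.of_injective _ hinjn
  let w : (defectSubspace A Complex.I × defectSubspace A (-Complex.I)) →ₗ[ℂ] P × N :=
    LinearMap.coprod ((u.prod v) ∘ₗ ι Complex.I) ((u.prod v) ∘ₗ ι (-Complex.I))
  have hw : Function.Surjective w := by
    rintro ⟨p, n⟩
    obtain ⟨f, rfl, rfl⟩ := hsurj p n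
    obtain ⟨a, ha, m, hm, n, hn, he⟩ := exists_eq_add_of_mem_adjoint hc hA f.2
    refine ⟨(⟨m, hm⟩, ⟨n, hn⟩), ?_⟩
    have hf : f = ⟨a, hA ha⟩ + ι Complex.I ⟨m, hm⟩ + ι (-Complex.I) ⟨n, hn⟩ := Subtype.ext he
    obtain ⟨h1, h2⟩ := hker ⟨a, hA ha⟩ ha
    rw [hf]
    simp [w, h1, h2]
  -- Now `n₊ ≤ dim P`, `n₋ ≤ dim N` and `dim P + dim N ≤ n₊ + n₋`, so both inequalities are
  -- equalities.
  have e1 := LinearMap.finrank_le_finrank_of_injective hinjp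
  have e2 := LinearMap.finrank_le_finrank_of_injective hinjn
  have e3 := LinearMap.finrank_le_finrank_of_surjective hw
  rw [Module.finrank_prod, Module.finrank_prod] at e3
  have e4 : Module.finrank ℂ (defectSubspace A Complex.I) =
      Module.finrank ℂ (defectSubspace A (-Complex.I)) := congrArg Cardinal.toNat h
  omega

end VonNeumann

/-! ### Indices of inertia -/

section Inertia

/-- Sylvester's law with a possibly infinite-dimensional kernel: `u` is injective on any positive
subspace, and a linear section of `(u, v)` over `P × 0` produces a positive subspace of dimension
`dim P`. -/
theorem iSup_finrank_pos_eq {V P N : Type*} [AddCommGroup V] [Module ℂ V]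
    [AddCommGroup P] [Module ℂ P] [FiniteDimensional ℂ P] [AddCommGroup N] [Module ℂ N]
    (D : Submodule ℂ V) (q : V → ℝ) (u : D →ₗ[ℂ] P) (v : D →ₗ[ℂ] N)
    (hsurj : ∀ p n, ∃ f, u f = p ∧ v f = n)
    (hu : ∀ f, u f = 0 → q f ≤ 0) (hv : ∀ f, v f = 0 → u f ≠ 0 → 0 < q f) :
    (⨆ (L : Submodule ℂ V) (_ : L ≤ D) (_ : FiniteDimensional ℂ L)
      (_ : ∀ y ∈ L, y ≠ 0 → 0 < q y), (Module.finrank ℂ L : ℕ∞)) = Module.finrank ℂ P := by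
  refine le_antisymm ?_ ?_
  · refine iSup_le fun L => iSup_le fun hL => iSup_le fun hf => iSup_le fun hpos => ?_
    have hinj : Function.Injective (u ∘ₗ Submodule.inclusion hL) := by
      refine (injective_iff_map_eq_zero _).2 fun x hx => ?_
      by_contra hne
      exact absurd (hu _ hx) (not_le.2 (hpos x.1 x.2 fun h => hne (Subtype.ext h)))
    exact_mod_cast LinearMap.finrank_le_finrank_of_injective hinj
  · have hs : Function.Surjective (u.prod v) := fun ⟨p, n⟩ => by
      obtain ⟨f, h1, h2⟩ := hsurj p n
      exact ⟨f, Prod.ext h1 h2⟩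
    obtain ⟨g, hg⟩ := (u.prod v).exists_rightInverse_of_surjective (LinearMap.range_eq_top.2 hs)
    set s : P →ₗ[ℂ] V := D.subtype ∘ₗ g ∘ₗ LinearMap.inl ℂ P N
    have hgu : ∀ p, u (g (p, 0)) = p ∧ v (g (p, 0)) = 0 := fun p =>
      Prod.mk.inj (LinearMap.congr_fun hg (p, 0))
    have hsinj : Function.Injective s := by
      refine (injective_iff_map_eq_zero _).2 fun p hp => ?_
      have : g (p, 0) = 0 := Subtype.ext hp
      rw [← (hgu p).1, this, map_zero]
    refine le_iSup_of_le (LinearMap.range s) (le_iSup_of_le ?_ (le_iSup_of_le inferInstance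
      (le_iSup_of_le ?_ ?_)))
    · rintro _ ⟨p, rfl⟩
      exact (g (p, 0)).2
    · rintro _ ⟨p, rfl⟩ hne
      refine hv (g (p, 0)) (hgu p).2 fun h0 => hne ?_
      rw [(hgu p).1] at h0
      rw [h0, map_zero]
    · rw [LinearMap.finrank_range_of_inj hsinj]

end Inertia

/-! ### Absolutely continuous representatives and the boundary form of the maximal relation -/

namespace SymmetricSystem

variable {H Hh : Type*} [NormedAddCommGroup H] [InnerProductSpace ℂ H] [FiniteDimensional ℂ H]
  [NormedAddCommGroup Hh] [InnerProductSpace ℂ Hh] [FiniteDimensional ℂ Hh]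
  {S : SymmetricSystem H Hh}

/-- If `Δ f = 0` then `y` solves the homogeneous system, and `Δ y = 0` lets definiteness apply with
`lam = 0`. Outside `I` the support condition decides. -/
theorem fst_eq_zero_of_π_eq_zero (hdef : S.IsDefinite) {p : S.LSq × S.LSq} (hp : p ∈ S.tmax)
    (h1 : S.π p.1 = 0) (h2 : S.π p.2 = 0) : p.1 = 0 := by
  rw [π_eq_zero_iff] at h1 h2
  refine LSq.ext fun t => ?_
  by_cases ht : t ∈ S.I
  · refine (hdef 0 _ hp.2.1 ?_ h1 t ht).trans (by simp)
    filter_upwards [hp.2.2, h2] with t h3 h4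
    refine ⟨h3.1, ?_⟩
    rw [h3.2, h4]
    simp
  · rw [Function.notMem_support.1 fun h => ht (hp.1 h)]
    simp

/-- For a definite system, an element of the maximal relation determines its absolutely continuous
representative. -/
theorem exists_representative (hdef : S.IsDefinite) :
    ∃ ρ : S.Tmax →ₗ[ℂ] S.dom, ∀ (p : S.LSq × S.LSq) (hp : p ∈ S.tmax),
      ρ ⟨S.π.prodMap S.π p, Submodule.mem_map_of_mem hp⟩ =
        ⟨p.1, Submodule.mem_map_of_mem (f := LinearMap.fst ℂ S.LSq S.LSq) hp⟩ := by
  let φ : S.tmax →ₗ[ℂ] S.Tmax := (S.π.prodMap S.π).submoduleMap S.tmax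
  have hφ : Function.Surjective φ := LinearMap.submoduleMap_surjective _ _
  obtain ⟨r, hr⟩ := φ.exists_rightInverse_of_surjective (LinearMap.range_eq_top.2 hφ)
  refine ⟨(LinearMap.fst ℂ S.LSq S.LSq).submoduleMap S.tmax ∘ₗ r, fun p hp => ?_⟩
  refine Subtype.ext ?_
  set q := r ⟨S.π.prodMap S.π p, Submodule.mem_map_of_mem hp⟩ with hq
  have h : φ q = ⟨S.π.prodMap S.π p, Submodule.mem_map_of_mem hp⟩ := LinearMap.congr_fun hr _
  have h1 : S.π.prodMap S.π q.1 = S.π.prodMap S.π p := congrArg Subtype.val h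
  have h2 : (S.π q.1.1, S.π q.1.2) = (S.π p.1, S.π p.2) := h1
  rw [Prod.mk.injEq] at h2
  have h3 := fst_eq_zero_of_π_eq_zero hdef (S.tmax.sub_mem q.2 hp)
    (by rw [Prod.fst_sub, map_sub, h2.1, sub_self])
    (by rw [Prod.snd_sub, map_sub, h2.2, sub_self])
  exact sub_eq_zero.1 h3

variable (S) in
/-- The form `[y, z]_b - (J y(a), z(a))`. -/
def boundaryForm (y z : S.dom) : ℂ :=
  S.bForm y z - inner ℂ (z.1 S.a) (opJ H Hh (y.1 S.a))

/-- The Lagrange identity on the maximal relation. -/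
theorem inner_sub_inner_eq_boundaryForm {ρ : S.Tmax →ₗ[ℂ] S.dom}
    (hρ : ∀ (p : S.LSq × S.LSq) (hp : p ∈ S.tmax),
      ρ ⟨S.π.prodMap S.π p, Submodule.mem_map_of_mem hp⟩ =
        ⟨p.1, Submodule.mem_map_of_mem (f := LinearMap.fst ℂ S.LSq S.LSq) hp⟩) (f g : S.Tmax) :
    inner ℂ g.1.1 f.1.2 - inner ℂ g.1.2 f.1.1 = S.boundaryForm (ρ f) (ρ g) := by
  obtain ⟨_, p, hp, rfl⟩ := f
  obtain ⟨_, q, hq, rfl⟩ := g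
  rw [hρ p hp, hρ q hq, boundaryForm, bForm_eq hp hq, add_sub_cancel_left]
  simp only [LinearMap.prodMap_apply, inner_π]

theorem representative_surjective {ρ : S.Tmax →ₗ[ℂ] S.dom}
    (hρ : ∀ (p : S.LSq × S.LSq) (hp : p ∈ S.tmax),
      ρ ⟨S.π.prodMap S.π p, Submodule.mem_map_of_mem hp⟩ =
        ⟨p.1, Submodule.mem_map_of_mem (f := LinearMap.fst ℂ S.LSq S.LSq) hp⟩) :
    Function.Surjective ρ := by
  rintro ⟨_, p, hp, rfl⟩
  exact ⟨_, hρ p hp⟩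

theorem representative_of_mem_Tmin {ρ : S.Tmax →ₗ[ℂ] S.dom}
    (hρ : ∀ (p : S.LSq × S.LSq) (hp : p ∈ S.tmax),
      ρ ⟨S.π.prodMap S.π p, Submodule.mem_map_of_mem hp⟩ =
        ⟨p.1, Submodule.mem_map_of_mem (f := LinearMap.fst ℂ S.LSq S.LSq) hp⟩)
    {f : S.Tmax} (hf : f.1 ∈ S.Tmin) :
    (ρ f).1 S.a = 0 ∧ ∀ z : S.dom, S.bForm (ρ f) z = 0 := by
  obtain ⟨_, hf'⟩ := f
  obtain ⟨p, hp, rfl⟩ := hf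
  rw [SetLike.mem_coe, mem_tmin_iff] at hp
  rw [hρ p hp.1]
  refine ⟨hp.2.1, ?_⟩
  rintro ⟨_, q, hq, rfl⟩
  exact hp.2.2 q hq

/-- `Γ_{0a}` on the domain of the maximal relation. -/
def Ga0Map (S : SymmetricSystem H Hh) (Xa : BoldH H Hh →ₗ[ℂ] BoldH H Hh) : S.dom →ₗ[ℂ] H where
  toFun y := S.Ga0 Xa y
  map_add' y z := by simp [Ga0]
  map_smul' c y := by simp [Ga0]

/-- `Γ̂_a` on the domain of the maximal relation. -/
def GahMap (S : SymmetricSystem H Hh) (Xa : BoldH H Hh →ₗ[ℂ] BoldH H Hh) : S.dom →ₗ[ℂ] Hh where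
  toFun y := S.Gah Xa y
  map_add' y z := by simp [Gah]
  map_smul' c y := by simp [Gah]

/-- `Γ_{1a}` on the domain of the maximal relation. -/
def Ga1Map (S : SymmetricSystem H Hh) (Xa : BoldH H Hh →ₗ[ℂ] BoldH H Hh) : S.dom →ₗ[ℂ] H where
  toFun y := S.Ga1 Xa y
  map_add' y z := by simp [Ga1]
  map_smul' c y := by simp [Ga1]

theorem inner_opJ_eq_endpoint {Xa : BoldH H Hh →ₗ[ℂ] BoldH H Hh}
    (hXa : LinearMap.adjoint Xa ∘ₗ opJ H Hh ∘ₗ Xa = opJ H Hh) (y z : S.dom) :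
    inner ℂ (z.1 S.a) (opJ H Hh (y.1 S.a)) =
      -inner ℂ (S.Ga0Map Xa z) (S.Ga1Map Xa y)
        + Complex.I * inner ℂ (S.GahMap Xa z) (S.GahMap Xa y)
        + inner ℂ (S.Ga1Map Xa z) (S.Ga0Map Xa y) := by
  have h : opJ H Hh (y.1 S.a) = LinearMap.adjoint Xa (opJ H Hh (Xa (y.1 S.a))) :=
    (LinearMap.congr_fun hXa (y.1 S.a)).symm
  rw [h, LinearMap.adjoint_inner_right, inner_opJ_right]
  rfl

theorem surjective_of_adjoint_comp {Xa : BoldH H Hh →ₗ[ℂ] BoldH H Hh}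
    (hXa : LinearMap.adjoint Xa ∘ₗ opJ H Hh ∘ₗ Xa = opJ H Hh) : Function.Surjective Xa := by
  refine LinearMap.injective_iff_surjective.1 ((injective_iff_map_eq_zero _).2 fun x hx => ?_)
  have h : LinearMap.adjoint Xa (opJ H Hh (Xa x)) = opJ H Hh x := LinearMap.congr_fun hXa x
  rw [hx, map_zero, map_zero] at h
  exact opJ_injective (h.symm.trans (map_zero _).symm)

end SymmetricSystem

/-! ### Cayley coordinates for the symplectic form -/

section Cayley

variable {E F : Type*} [NormedAddCommGroup E] [InnerProductSpace ℂ E]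
  [NormedAddCommGroup F] [InnerProductSpace ℂ F]

theorem exists_add_I_smul_sub_I_smul (p n : E) :
    ∃ x y : E, x + Complex.I • y = p ∧ x - Complex.I • y = n := by
  refine ⟨(1 / 2 : ℂ) • (p + n), (-Complex.I / 2) • (p - n), ?_, ?_⟩ <;>
  · rw [smul_smul, mul_div_assoc', mul_neg, Complex.I_mul_I, neg_neg]
    module

theorem im_inner_eq (x y : E) :
    (inner ℂ x y : ℂ).im = (‖x - Complex.I • y‖ ^ 2 - ‖x + Complex.I • y‖ ^ 2) / 4 := by
  rw [norm_add_sq (𝕜 := ℂ), norm_sub_sq (𝕜 := ℂ), inner_smul_right]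
  simp
  ring

/-- Diagonalization of the standard symplectic form. -/
theorem re_neg_I_mul_form (σ : ℤ) (h : F) (x y : E) :
    (-Complex.I * (Complex.I * (σ : ℂ) * inner ℂ h h - inner ℂ x y + inner ℂ y x)).re =
      σ * ‖h‖ ^ 2 + (‖x + Complex.I • y‖ ^ 2 - ‖x - Complex.I • y‖ ^ 2) / 2 := by
  rw [← inner_conj_symm y x, inner_self_eq_norm_sq_to_K]
  have h1 := im_inner_eq x y
  generalize (inner ℂ x y : ℂ) = w at h1 ⊢
  have h2 : (‖x + Complex.I • y‖ ^ 2 - ‖x - Complex.I • y‖ ^ 2) / 2 = -2 * w.im := by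
    rw [h1]; ring
  rw [h2]
  have h3 : -Complex.I * (Complex.I * (σ : ℂ) * ((‖h‖ : ℝ) : ℂ) ^ 2 - w + (starRingEnd ℂ) w) =
      ((σ * ‖h‖ ^ 2 - 2 * w.im : ℝ) : ℂ) := by
    have h4 : w - (starRingEnd ℂ) w = 2 * w.im * Complex.I := by
      rw [Complex.sub_conj]; push_cast; ring
    push_cast
    linear_combination (-σ * (‖h‖ : ℂ) ^ 2 + 2 * w.im) * Complex.I_mul_I + Complex.I * h4
  refine (congrArg Complex.re h3).trans ?_
  rw [Complex.ofReal_re]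
  ring

end Cayley

/-! ### Nondegeneracy and inertia of the boundary form at `b` -/

namespace SymmetricSystem

variable {H Hh : Type*} [NormedAddCommGroup H] [InnerProductSpace ℂ H] [FiniteDimensional ℂ H]
  [NormedAddCommGroup Hh] [InnerProductSpace ℂ Hh] [FiniteDimensional ℂ Hh]
  {S : SymmetricSystem H Hh} {Hb Hhb : Type*}
  [NormedAddCommGroup Hb] [InnerProductSpace ℂ Hb]
  [NormedAddCommGroup Hhb] [InnerProductSpace ℂ Hhb]

namespace SingularBoundaryMap

variable (Γb : S.SingularBoundaryMap Hb Hhb)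

/-- The identity for the boundary form at `b` with an explicit sign `σ`. -/
def HasSign (σ : ℤ) : Prop :=
  ∀ y z : S.dom, S.bForm y z = Complex.I * (σ : ℂ) * inner ℂ (Γb.Gh z) (Γb.Gh y)
    - inner ℂ (Γb.G0 z) (Γb.G1 y) + inner ℂ (Γb.G1 z) (Γb.G0 y)

/-- When the indices agree the middle space is trivial, so any coefficient may stand in front of it.
The sign 0 can therefore be replaced by 1 or -1, and the borderline cases need no separate
treatment. -/
theorem hasSign_of_eq (h : S.nubPlus = S.nubMinus) (σ : ℤ) : Γb.HasSign σ := by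
  intro y z
  have := Γb.middle_trivial h
  rw [Γb.form, Subsingleton.elim (Γb.Gh y) 0, inner_zero_right, mul_zero, mul_zero]

theorem hasSign_one (h : S.nubMinus ≤ S.nubPlus) : Γb.HasSign 1 := by
  rcases h.lt_or_eq with h | h
  · intro y z
    rw [Γb.form, bSign, if_pos h]
  · exact Γb.hasSign_of_eq h.symm 1

theorem hasSign_neg_one (h : S.nubPlus ≤ S.nubMinus) : Γb.HasSign (-1) := by
  rcases h.lt_or_eq with h | h
  · intro y z
    rw [Γb.form, bSign, if_neg h.not_gt, if_pos h]
  · exact Γb.hasSign_of_eq h (-1)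

variable {Γb}

/-- The form is nondegenerate in the values of `Γ_b`: surjectivity supplies test functions `z` that
isolate each component of `Γ_b y` in turn. -/
theorem HasSign.eq_zero {σ : ℤ} (hσ : Γb.HasSign σ) (hσ0 : σ ≠ 0) {y : S.dom}
    (hy : ∀ z : S.dom, S.bForm y z = 0) : Γb.G0 y = 0 ∧ Γb.Gh y = 0 ∧ Γb.G1 y = 0 := by
  refine ⟨?_, ?_, ?_⟩
  · obtain ⟨z, hz⟩ := Γb.surjective (0, 0, Γb.G0 y)
    simp only [Prod.mk.injEq] at hz
    have h := hσ y z
    rw [hy, hz.1, hz.2.1, hz.2.2] at h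
    simpa using h.symm
  · obtain ⟨z, hz⟩ := Γb.surjective (0, Γb.Gh y, 0)
    simp only [Prod.mk.injEq] at hz
    have h := hσ y z
    rw [hy, hz.1, hz.2.1, hz.2.2] at h
    simpa [hσ0] using h.symm
  · obtain ⟨z, hz⟩ := Γb.surjective (Γb.G1 y, 0, 0)
    simp only [Prod.mk.injEq] at hz
    have h := hσ y z
    rw [hy, hz.1, hz.2.1, hz.2.2] at h
    simpa using h.symm

theorem exists_hasSign (Γb : S.SingularBoundaryMap Hb Hhb) : ∃ σ : ℤ, σ ≠ 0 ∧ Γb.HasSign σ := by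
  rcases le_total S.nubMinus S.nubPlus with h | h
  · exact ⟨1, by norm_num, Γb.hasSign_one h⟩
  · exact ⟨-1, by norm_num, Γb.hasSign_neg_one h⟩

/-- The boundary values at both endpoints can be prescribed independently. -/
theorem exists_boundary_values (Γb : S.SingularBoundaryMap Hb Hhb) (hdef : S.IsDefinite)
    {Xa : BoldH H Hh →ₗ[ℂ] BoldH H Hh}
    (hXa : LinearMap.adjoint Xa ∘ₗ opJ H Hh ∘ₗ Xa = opJ H Hh)
    (a₀ : H) (ah : Hh) (a₁ : H) (b₀ : Hb) (bh : Hhb) (b₁ : Hb) :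
    ∃ y : S.dom, S.Ga0Map Xa y = a₀ ∧ S.GahMap Xa y = ah ∧ S.Ga1Map Xa y = a₁ ∧
      Γb.G0 y = b₀ ∧ Γb.Gh y = bh ∧ Γb.G1 y = b₁ := by
  obtain ⟨y, hy⟩ := Γb.surjective (b₀, bh, b₁)
  simp only [Prod.mk.injEq] at hy
  obtain ⟨c, hc⟩ := surjective_of_adjoint_comp hXa (BoldH.blocks.symm (osum (osum a₀ ah) a₁))
  obtain ⟨p, hp, hpa, hpb⟩ := exists_mem_tmax hdef (c - y.1 S.a)
  let x : S.dom := ⟨p.1, Submodule.mem_map_of_mem (f := LinearMap.fst ℂ S.LSq S.LSq) hp⟩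
  have hx : ∀ z : S.dom, S.bForm x z = 0 := by
    rintro ⟨_, q, hq, rfl⟩
    exact bForm_eq_zero_of_eventually hp hq hpb
  obtain ⟨σ, hσ0, hσ⟩ := Γb.exists_hasSign
  -- The correction `x` adjusts the value at `a` and vanishes near `b`, so it is annihilated by
  -- `Γ_b` and leaves the data at `b` unchanged.
  obtain ⟨h0, hh, h1⟩ := hσ.eq_zero hσ0 hx
  have hval : Xa ((y + x).1 S.a) = BoldH.blocks.symm (osum (osum a₀ ah) a₁) := by
    rw [← hc]
    congr 1
    change (LSq.toFun (y.1 + p.1)) S.a = c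
    rw [map_add, Pi.add_apply, hpa, add_sub_cancel]
  refine ⟨y + x, ?_, ?_, ?_, ?_, ?_, ?_⟩
  · change (BoldH.blocks (Xa ((y + x).1 S.a))).fst.fst = a₀
    rw [hval, LinearIsometryEquiv.apply_symm_apply]; rfl
  · change (BoldH.blocks (Xa ((y + x).1 S.a))).fst.snd = ah
    rw [hval, LinearIsometryEquiv.apply_symm_apply]; rfl
  · change (BoldH.blocks (Xa ((y + x).1 S.a))).snd = a₁
    rw [hval, LinearIsometryEquiv.apply_symm_apply]; rfl
  · rw [map_add, h0, add_zero, hy.1]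
  · rw [map_add, hh, add_zero, hy.2.1]
  · rw [map_add, h1, add_zero, hy.2.2]

/-! ### The indices of inertia of the boundary form -/

theorem HasSign.re_bForm {σ : ℤ} (hσ : Γb.HasSign σ) (y : S.dom) :
    (-Complex.I * S.bForm y y).re = σ * ‖Γb.Gh y‖ ^ 2 +
      (‖(Γb.G0 + Complex.I • Γb.G1) y‖ ^ 2 - ‖(Γb.G0 - Complex.I • Γb.G1) y‖ ^ 2) / 2 := by
  rw [hσ, re_neg_I_mul_form]
  rfl

theorem exists_cayley (Γb : S.SingularBoundaryMap Hb Hhb) (p n : Hb) (h : Hhb) :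
    ∃ y : S.dom, (Γb.G0 + Complex.I • Γb.G1) y = p ∧ (Γb.G0 - Complex.I • Γb.G1) y = n ∧
      Γb.Gh y = h := by
  obtain ⟨x, x', hp, hn⟩ := exists_add_I_smul_sub_I_smul p n
  obtain ⟨y, hy⟩ := Γb.surjective (x, h, x')
  simp only [Prod.mk.injEq] at hy
  refine ⟨y, ?_, ?_, hy.2.1⟩
  · rw [← hp, ← hy.1, ← hy.2.2]; rfl
  · rw [← hn, ← hy.1, ← hy.2.2]; rfl

variable [FiniteDimensional ℂ Hb] [FiniteDimensional ℂ Hhb]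

/-- In the coordinates `G0 ± i G1` and `Gh` the form is diagonal; the positive squares are `G0 + i
G1` and `Gh`, the negative ones `G0 - i G1`. So the difference of the two indices is `dim Ĥ_b`. -/
theorem HasSign.nubPlus_of_one (hσ : Γb.HasSign 1) :
    S.nubPlus = (Module.finrank ℂ Hb + Module.finrank ℂ Hhb : ℕ) := by
  rw [← Module.finrank_prod (R := ℂ) (M := Hb) (M' := Hhb)]
  refine iSup_finrank_pos_eq S.dom (fun y => (-Complex.I * S.bForm y y).re)
    ((Γb.G0 + Complex.I • Γb.G1).prod Γb.Gh) (Γb.G0 - Complex.I • Γb.G1) ?_ ?_ ?_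
  · rintro ⟨p, h⟩ n
    obtain ⟨y, h1, h2, h3⟩ := Γb.exists_cayley p n h
    exact ⟨y, Prod.ext h1 h3, h2⟩
  · intro y hy
    obtain ⟨h1, h2⟩ := Prod.mk.inj hy
    rw [hσ.re_bForm, h1, h2, norm_zero, norm_zero]
    nlinarith [sq_nonneg ‖(Γb.G0 - Complex.I • Γb.G1) y‖]
  · intro y hy hne
    rw [hσ.re_bForm, hy, norm_zero]
    by_contra! hle
    push_cast at hle
    have h1 := sq_nonneg ‖Γb.Gh y‖
    have h2 := sq_nonneg ‖(Γb.G0 + Complex.I • Γb.G1) y‖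
    refine hne (Prod.ext (norm_eq_zero.1 (pow_eq_zero_iff two_ne_zero |>.1 ?_))
      (norm_eq_zero.1 (pow_eq_zero_iff two_ne_zero |>.1 ?_)))
    · change ‖(Γb.G0 + Complex.I • Γb.G1) y‖ ^ 2 = 0
      linarith
    · change ‖Γb.Gh y‖ ^ 2 = 0
      linarith

theorem HasSign.nubMinus_of_one (hσ : Γb.HasSign 1) :
    S.nubMinus = (Module.finrank ℂ Hb : ℕ) := by
  have h := iSup_finrank_pos_eq S.dom (fun y => -(-Complex.I * S.bForm y y).re)
    (Γb.G0 - Complex.I • Γb.G1) ((Γb.G0 + Complex.I • Γb.G1).prod Γb.Gh) ?_ ?_ ?_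
  · simpa only [nubMinus, neg_pos] using h
  · rintro n ⟨p, h⟩
    obtain ⟨y, h1, h2, h3⟩ := Γb.exists_cayley p n h
    exact ⟨y, h2, Prod.ext h1 h3⟩
  · intro y hy
    rw [hσ.re_bForm, hy, norm_zero]
    push_cast
    nlinarith [sq_nonneg ‖(Γb.G0 + Complex.I • Γb.G1) y‖, sq_nonneg ‖Γb.Gh y‖]
  · intro y hy hne
    obtain ⟨h1, h2⟩ := Prod.mk.inj hy
    rw [hσ.re_bForm, h1, h2, norm_zero, norm_zero]
    have := norm_pos_iff.2 hne
    have := pow_pos this 2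
    push_cast
    linarith

end SingularBoundaryMap
end SymmetricSystem

/-! ### Deficiency indices in terms of boundary values -/

namespace SymmetricSystem

variable {H Hh : Type*} [NormedAddCommGroup H] [InnerProductSpace ℂ H] [FiniteDimensional ℂ H]
  [NormedAddCommGroup Hh] [InnerProductSpace ℂ Hh] [FiniteDimensional ℂ Hh]
  {S : SymmetricSystem H Hh} {Hb Hhb : Type*}
  [NormedAddCommGroup Hb] [InnerProductSpace ℂ Hb]
  [NormedAddCommGroup Hhb] [InnerProductSpace ℂ Hhb]

namespace SingularBoundaryMap

variable {Γb : S.SingularBoundaryMap Hb Hhb}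

theorem HasSign.boundaryForm_eq {σ : ℤ} (hσ : Γb.HasSign σ) {Xa : BoldH H Hh →ₗ[ℂ] BoldH H Hh}
    (hXa : LinearMap.adjoint Xa ∘ₗ opJ H Hh ∘ₗ Xa = opJ H Hh) (y z : S.dom) :
    S.boundaryForm y z = Complex.I * (σ : ℂ) * inner ℂ (Γb.Gh z) (Γb.Gh y)
      - inner ℂ (Γb.G0 z) (Γb.G1 y) + inner ℂ (Γb.G1 z) (Γb.G0 y)
      + inner ℂ (S.Ga0Map Xa z) (S.Ga1Map Xa y) - inner ℂ (S.Ga1Map Xa z) (S.Ga0Map Xa y)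
      - Complex.I * inner ℂ (S.GahMap Xa z) (S.GahMap Xa y) := by
  rw [boundaryForm, hσ, inner_opJ_eq_endpoint hXa]
  ring

/-- The endpoint `a` enters with the opposite sign, so there `Γ̂_a` counts as negative and the two
Cayley coordinates exchange their roles. -/
theorem HasSign.re_boundaryForm {σ : ℤ} (hσ : Γb.HasSign σ) {Xa : BoldH H Hh →ₗ[ℂ] BoldH H Hh}
    (hXa : LinearMap.adjoint Xa ∘ₗ opJ H Hh ∘ₗ Xa = opJ H Hh) (y : S.dom) :
    (-Complex.I * S.boundaryForm y y).re = σ * ‖Γb.Gh y‖ ^ 2 - ‖S.GahMap Xa y‖ ^ 2 +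
      (‖(Γb.G0 + Complex.I • Γb.G1) y‖ ^ 2 - ‖(Γb.G0 - Complex.I • Γb.G1) y‖ ^ 2) / 2 +
      (‖(S.Ga0Map Xa - Complex.I • S.Ga1Map Xa) y‖ ^ 2 -
        ‖(S.Ga0Map Xa + Complex.I • S.Ga1Map Xa) y‖ ^ 2) / 2 := by
  have h := re_neg_I_mul_form 1 (S.GahMap Xa y) (S.Ga0Map Xa y) (S.Ga1Map Xa y)
  have h2 : S.bForm y y - inner ℂ (y.1 S.a) (opJ H Hh (y.1 S.a)) = S.bForm y y -
      (Complex.I * ((1 : ℤ) : ℂ) * inner ℂ (S.GahMap Xa y) (S.GahMap Xa y)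
        - inner ℂ (S.Ga0Map Xa y) (S.Ga1Map Xa y) + inner ℂ (S.Ga1Map Xa y) (S.Ga0Map Xa y)) := by
    rw [inner_opJ_eq_endpoint hXa]
    push_cast
    ring
  rw [boundaryForm, h2, mul_sub, Complex.sub_re, h, hσ.re_bForm]
  simp only [LinearMap.add_apply, LinearMap.sub_apply, LinearMap.smul_apply]
  push_cast
  ring

theorem exists_cayley_endpoints (Γb : S.SingularBoundaryMap Hb Hhb) (hdef : S.IsDefinite)
    {Xa : BoldH H Hh →ₗ[ℂ] BoldH H Hh}
    (hXa : LinearMap.adjoint Xa ∘ₗ opJ H Hh ∘ₗ Xa = opJ H Hh)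
    (p n : Hb) (h : Hhb) (p' n' : H) (h' : Hh) :
    ∃ y : S.dom, (Γb.G0 + Complex.I • Γb.G1) y = p ∧ (Γb.G0 - Complex.I • Γb.G1) y = n ∧
      Γb.Gh y = h ∧ (S.Ga0Map Xa + Complex.I • S.Ga1Map Xa) y = p' ∧
      (S.Ga0Map Xa - Complex.I • S.Ga1Map Xa) y = n' ∧ S.GahMap Xa y = h' := by
  obtain ⟨x, x', hp, hn⟩ := exists_add_I_smul_sub_I_smul p n
  obtain ⟨w, w', hp', hn'⟩ := exists_add_I_smul_sub_I_smul p' n'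
  obtain ⟨y, h1, h2, h3, h4, h5, h6⟩ := Γb.exists_boundary_values hdef hXa w h' w' x h x'
  refine ⟨y, ?_, ?_, h5, ?_, ?_, h2⟩
  · rw [← hp, ← h4, ← h6]; rfl
  · rw [← hn, ← h4, ← h6]; rfl
  · rw [← hp', ← h1, ← h3]; rfl
  · rw [← hn', ← h1, ← h3]; rfl

theorem eq_zero_of_mem_Tmin (Γb : S.SingularBoundaryMap Hb Hhb) {ρ : S.Tmax →ₗ[ℂ] S.dom}
    (hρ : ∀ (p : S.LSq × S.LSq) (hp : p ∈ S.tmax),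
      ρ ⟨S.π.prodMap S.π p, Submodule.mem_map_of_mem hp⟩ =
        ⟨p.1, Submodule.mem_map_of_mem (f := LinearMap.fst ℂ S.LSq S.LSq) hp⟩)
    {Xa : BoldH H Hh →ₗ[ℂ] BoldH H Hh} {f : S.Tmax} (hf : f.1 ∈ S.Tmin) :
    (S.Ga0Map Xa (ρ f) = 0 ∧ S.GahMap Xa (ρ f) = 0 ∧ S.Ga1Map Xa (ρ f) = 0) ∧
      Γb.G0 (ρ f) = 0 ∧ Γb.Gh (ρ f) = 0 ∧ Γb.G1 (ρ f) = 0 := by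
  obtain ⟨h0, h1⟩ := representative_of_mem_Tmin hρ hf
  obtain ⟨σ, hσ0, hσ⟩ := Γb.exists_hasSign
  refine ⟨⟨?_, ?_, ?_⟩, hσ.eq_zero hσ0 h1⟩
  · change (BoldH.blocks (Xa ((ρ f).1 S.a))).fst.fst = 0
    rw [h0, map_zero, map_zero]; rfl
  · change (BoldH.blocks (Xa ((ρ f).1 S.a))).fst.snd = 0
    rw [h0, map_zero, map_zero]; rfl
  · change (BoldH.blocks (Xa ((ρ f).1 S.a))).snd = 0
    rw [h0, map_zero, map_zero]; rfl

variable [FiniteDimensional ℂ Hb] [FiniteDimensional ℂ Hhb]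

/-- Carries the von Neumann count from the adjoint of `T_min` to `dom t_max`, via `T_min* = T_max`
and the representative map. -/
theorem finrank_eq_of_inertia (hdef : S.IsDefinite)
    {P N : Type*} [AddCommGroup P] [Module ℂ P] [FiniteDimensional ℂ P]
    [AddCommGroup N] [Module ℂ N] [FiniteDimensional ℂ N]
    {ρ : S.Tmax →ₗ[ℂ] S.dom}
    (hρ : ∀ (p : S.LSq × S.LSq) (hp : p ∈ S.tmax),
      ρ ⟨S.π.prodMap S.π p, Submodule.mem_map_of_mem hp⟩ =
        ⟨p.1, Submodule.mem_map_of_mem (f := LinearMap.fst ℂ S.LSq S.LSq) hp⟩)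
    (u : S.dom →ₗ[ℂ] P) (v : S.dom →ₗ[ℂ] N) (hsurj : ∀ p n, ∃ y, u y = p ∧ v y = n)
    (hker : ∀ f, f.1 ∈ S.Tmin → u (ρ f) = 0 ∧ v (ρ f) = 0)
    (hu : ∀ y, u y = 0 → (-Complex.I * S.boundaryForm y y).re ≤ 0)
    (hv : ∀ y, v y = 0 → 0 ≤ (-Complex.I * S.boundaryForm y y).re)
    (h : deficiencyPlus S.Tmin = deficiencyMinus S.Tmin) :
    Module.finrank ℂ P = Module.finrank ℂ N := by
  have hT := adjoint_Tmin hdef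
  let e : S.Tmin.adjoint ≃ₗ[ℂ] S.Tmax := LinearEquiv.ofEq _ _ hT
  refine finrank_eq_of_deficiency_eq (isClosed_Tmin hdef) (hT ▸ Tmin_le_Tmax)
    (u ∘ₗ ρ ∘ₗ e.toLinearMap) (v ∘ₗ ρ ∘ₗ e.toLinearMap) ?_ ?_ ?_ ?_ h
  · intro p n
    obtain ⟨y, h1, h2⟩ := hsurj p n
    obtain ⟨f, rfl⟩ := representative_surjective hρ y
    refine ⟨e.symm f, ?_, ?_⟩ <;>
    simpa only [LinearMap.comp_apply, LinearEquiv.coe_coe, LinearEquiv.apply_symm_apply]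
  · exact fun f hf => hker (e f) hf
  · intro f hf
    have := inner_sub_inner_eq_boundaryForm hρ (e f) (e f)
    exact (congrArg (fun w => (-Complex.I * w).re) this).trans_le (hu _ hf)
  · intro f hf
    have := inner_sub_inner_eq_boundaryForm hρ (e f) (e f)
    exact (hv _ hf).trans_eq (congrArg (fun w => (-Complex.I * w).re) this).symm

/-- The positive squares number `dim H_b + dim Ĥ_b + dim H`, the negative ones `dim H_b + dim Ĥ +
dim H`; equal deficiency indices equate the two. -/
theorem HasSign.finrank_of_one (hσ : Γb.HasSign 1) (hdef : S.IsDefinite)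
    {Xa : BoldH H Hh →ₗ[ℂ] BoldH H Hh}
    (hXa : LinearMap.adjoint Xa ∘ₗ opJ H Hh ∘ₗ Xa = opJ H Hh)
    (h : deficiencyPlus S.Tmin = deficiencyMinus S.Tmin) :
    Module.finrank ℂ Hh = Module.finrank ℂ Hhb := by
  obtain ⟨ρ, hρ⟩ := exists_representative hdef
  have key := finrank_eq_of_inertia hdef hρ
    ((Γb.G0 + Complex.I • Γb.G1).prod (Γb.Gh.prod (S.Ga0Map Xa - Complex.I • S.Ga1Map Xa)))
    ((Γb.G0 - Complex.I • Γb.G1).prod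
      ((S.GahMap Xa).prod (S.Ga0Map Xa + Complex.I • S.Ga1Map Xa))) ?_ ?_ ?_ ?_ h
  · simp only [Module.finrank_prod] at key
    omega
  · rintro ⟨p, h, n'⟩ ⟨n, h', p'⟩
    obtain ⟨y, h1, h2, h3, h4, h5, h6⟩ := Γb.exists_cayley_endpoints hdef hXa p n h p' n' h'
    exact ⟨y, Prod.ext h1 (Prod.ext h3 h5), Prod.ext h2 (Prod.ext h6 h4)⟩
  · intro f hf
    obtain ⟨⟨h1, h2, h3⟩, h4, h5, h6⟩ := Γb.eq_zero_of_mem_Tmin hρ (Xa := Xa) hf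
    simp [h1, h2, h3, h4, h5, h6]
  · intro y hy
    obtain ⟨h1, h2⟩ := Prod.mk.inj hy
    obtain ⟨h2, h3⟩ := Prod.mk.inj h2
    rw [hσ.re_boundaryForm hXa, h1, h2, h3]
    simp only [norm_zero]
    nlinarith [sq_nonneg ‖(Γb.G0 - Complex.I • Γb.G1) y‖, sq_nonneg ‖S.GahMap Xa y‖,
      sq_nonneg ‖(S.Ga0Map Xa + Complex.I • S.Ga1Map Xa) y‖]
  · intro y hy
    obtain ⟨h1, h2⟩ := Prod.mk.inj hy
    obtain ⟨h2, h3⟩ := Prod.mk.inj h2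
    rw [hσ.re_boundaryForm hXa, h1, h2, h3]
    simp only [norm_zero]
    push_cast
    nlinarith [sq_nonneg ‖(Γb.G0 + Complex.I • Γb.G1) y‖, sq_nonneg ‖Γb.Gh y‖,
      sq_nonneg ‖(S.Ga0Map Xa - Complex.I • S.Ga1Map Xa) y‖]

/-- With the negative sign both `Ĥ_b` and `Ĥ` contribute negative squares and nothing compensates
them on the positive side. -/
theorem HasSign.finrank_of_neg_one (hσ : Γb.HasSign (-1)) (hdef : S.IsDefinite)
    {Xa : BoldH H Hh →ₗ[ℂ] BoldH H Hh}
    (hXa : LinearMap.adjoint Xa ∘ₗ opJ H Hh ∘ₗ Xa = opJ H Hh)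
    (h : deficiencyPlus S.Tmin = deficiencyMinus S.Tmin) :
    Module.finrank ℂ Hh = 0 ∧ Module.finrank ℂ Hhb = 0 := by
  obtain ⟨ρ, hρ⟩ := exists_representative hdef
  have key := finrank_eq_of_inertia hdef hρ
    ((Γb.G0 + Complex.I • Γb.G1).prod (S.Ga0Map Xa - Complex.I • S.Ga1Map Xa))
    ((Γb.G0 - Complex.I • Γb.G1).prod (Γb.Gh.prod
      ((S.GahMap Xa).prod (S.Ga0Map Xa + Complex.I • S.Ga1Map Xa)))) ?_ ?_ ?_ ?_ h
  · simp only [Module.finrank_prod] at key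
    omega
  · rintro ⟨p, n'⟩ ⟨n, h, h', p'⟩
    obtain ⟨y, h1, h2, h3, h4, h5, h6⟩ := Γb.exists_cayley_endpoints hdef hXa p n h p' n' h'
    exact ⟨y, Prod.ext h1 h5, Prod.ext h2 (Prod.ext h3 (Prod.ext h6 h4))⟩
  · intro f hf
    obtain ⟨⟨h1, h2, h3⟩, h4, h5, h6⟩ := Γb.eq_zero_of_mem_Tmin hρ (Xa := Xa) hf
    simp [h1, h2, h3, h4, h5, h6]
  · intro y hy
    obtain ⟨h1, h2⟩ := Prod.mk.inj hy
    rw [hσ.re_boundaryForm hXa, h1, h2]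
    simp only [norm_zero]
    push_cast
    nlinarith [sq_nonneg ‖(Γb.G0 - Complex.I • Γb.G1) y‖, sq_nonneg ‖S.GahMap Xa y‖,
      sq_nonneg ‖(S.Ga0Map Xa + Complex.I • S.Ga1Map Xa) y‖, sq_nonneg ‖Γb.Gh y‖]
  · intro y hy
    obtain ⟨h1, h2⟩ := Prod.mk.inj hy
    obtain ⟨h2, h3⟩ := Prod.mk.inj h2
    obtain ⟨h3, h4⟩ := Prod.mk.inj h3
    rw [hσ.re_boundaryForm hXa, h1, h2, h3, h4]
    simp only [norm_zero]
    nlinarith [sq_nonneg ‖(Γb.G0 + Complex.I • Γb.G1) y‖,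
      sq_nonneg ‖(S.Ga0Map Xa - Complex.I • S.Ga1Map Xa) y‖]

/-- Equal deficiency indices force `ν_{b+} - ν_{b-} = dim Ĥ = dim Ĥ_b`. -/
theorem case1_of_deficiency_eq (Γb : S.SingularBoundaryMap Hb Hhb) (hdef : S.IsDefinite)
    {Xa : BoldH H Hh →ₗ[ℂ] BoldH H Hh}
    (hXa : LinearMap.adjoint Xa ∘ₗ opJ H Hh ∘ₗ Xa = opJ H Hh)
    (h : deficiencyPlus S.Tmin = deficiencyMinus S.Tmin) :
    S.Case1 ∧ Module.finrank ℂ Hh = Module.finrank ℂ Hhb := by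
  have hle : S.nubMinus ≤ S.nubPlus := by
    by_contra! hlt
    have hσ := Γb.hasSign_neg_one hlt.le
    obtain ⟨h1, h2⟩ := hσ.finrank_of_neg_one hdef hXa h
    have : Subsingleton Hhb := Module.finrank_zero_iff.1 h2
    -- Since `Ĥ_b` is trivial, the sign is immaterial; computing the indices with sign 1 gives
    -- `ν_{b+} = ν_{b-}`, a contradiction.
    have hσ1 : Γb.HasSign 1 := fun y z => by
      rw [hσ y z, Subsingleton.elim (Γb.Gh y) 0, inner_zero_right, mul_zero, mul_zero]
    rw [hσ1.nubPlus_of_one, hσ1.nubMinus_of_one, h2, add_zero] at hlt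
    exact lt_irrefl _ hlt
  have hσ := Γb.hasSign_one hle
  have hfin := hσ.finrank_of_one hdef hXa h
  refine ⟨?_, hfin⟩
  rw [Case1, hσ.nubPlus_of_one, hσ.nubMinus_of_one, hfin, Nat.cast_add]

/-- Case 1 entails `ν_{b-} ≤ ν_{b+}`, hence sign 1 and `ν_{b+} - ν_{b-} = dim Ĥ_b`. -/
theorem finrank_le_of_case1 (Γb : S.SingularBoundaryMap Hb Hhb) (h : S.Case1) :
    Module.finrank ℂ Hh ≤ Module.finrank ℂ Hhb := by
  have hσ := Γb.hasSign_one (le_self_add.trans h)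
  rw [Case1, hσ.nubPlus_of_one, hσ.nubMinus_of_one, ← Nat.cast_add, Nat.cast_le] at h
  omega

theorem finrank_lt_of_case2 (Γb : S.SingularBoundaryMap Hb Hhb) (h : S.Case2) :
    Module.finrank ℂ Hhb < Module.finrank ℂ Hh := by
  have hσ := Γb.hasSign_one h.2.le
  have h1 := h.1
  rw [hσ.nubPlus_of_one, hσ.nubMinus_of_one, ← Nat.cast_add, Nat.cast_lt] at h1
  omega

end SingularBoundaryMap
end SymmetricSystem

/-! ### Splitting along the range of an isometric embedding -/

section Isometry

variable {E F : Type*} [NormedAddCommGroup E] [InnerProductSpace ℂ E] [FiniteDimensional ℂ E]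
  [NormedAddCommGroup F] [InnerProductSpace ℂ F] [FiniteDimensional ℂ F] (V : E →ₗᵢ[ℂ] F)

open SymmetricSystem

theorem LinearIsometry.adjoint_apply_self (x : E) :
    LinearMap.adjoint V.toLinearMap (V x) = x :=
  ext_inner_left ℂ fun y => by
    rw [LinearMap.adjoint_inner_right]
    exact V.inner_map_map y x

theorem LinearIsometry.adjoint_apply_eq_zero (k : complRange V) :
    LinearMap.adjoint V.toLinearMap (k : F) = 0 :=
  ext_inner_left ℂ fun y => by
    rw [LinearMap.adjoint_inner_right, inner_zero_right]
    exact (Submodule.mem_orthogonal _ _).1 k.2 _ (LinearMap.mem_range_self _ y)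

theorem LinearIsometry.orthogonalProjectionOnto_apply (x : E) :
    (complRange V).orthogonalProjectionOnto (V x) = 0 := by
  rw [Submodule.orthogonalProjectionOnto_eq_zero_iff]
  exact Submodule.le_orthogonal_orthogonal _ (LinearMap.mem_range_self V.toLinearMap x)

theorem LinearIsometry.eq_apply_adjoint_add (w : F) :
    w = V (LinearMap.adjoint V.toLinearMap w) +
      ((complRange V).orthogonalProjectionOnto w : F) := by
  obtain ⟨_, ⟨x, rfl⟩, k, hk, rfl⟩ :=
    (LinearMap.range V.toLinearMap).exists_add_mem_mem_orthogonal w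
  change V x + k = V (LinearMap.adjoint V.toLinearMap (V x + k)) +
    ((complRange V).orthogonalProjectionOnto (V x + k) : F)
  rw [map_add, map_add, map_add, V.orthogonalProjectionOnto_apply,
    V.adjoint_apply_self, V.adjoint_apply_eq_zero ⟨k, hk⟩, map_zero, zero_add, add_zero,
    Submodule.orthogonalProjectionOnto_mem_subspace_eq_self ⟨k, hk⟩]

theorem LinearIsometry.inner_eq_adjoint_add (w w' : F) :
    (inner ℂ w w' : ℂ) =
      inner ℂ (LinearMap.adjoint V.toLinearMap w) (LinearMap.adjoint V.toLinearMap w') +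
      inner ℂ ((complRange V).orthogonalProjectionOnto w)
        ((complRange V).orthogonalProjectionOnto w') := by
  conv_lhs => rw [V.eq_apply_adjoint_add w']
  rw [inner_add_right, ← Submodule.inner_orthogonalProjectionOnto_eq_of_mem_right,
    LinearMap.adjoint_inner_left]
  rfl

end Isometry

/-! ### Maps into orthogonal sums -/

section Osum

variable {M E F : Type*} [AddCommGroup M] [Module ℂ M]
  [NormedAddCommGroup E] [InnerProductSpace ℂ E] [NormedAddCommGroup F] [InnerProductSpace ℂ F]

/-- The linear map into an orthogonal sum with given components. -/
def osumMap (f : M →ₗ[ℂ] E) (g : M →ₗ[ℂ] F) : M →ₗ[ℂ] WithLp 2 (E × F) :=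
  (WithLp.linearEquiv 2 ℂ (E × F)).symm.toLinearMap ∘ₗ f.prod g

theorem inner_osum (x x' : E) (y y' : F) :
    (inner ℂ (osum x y) (osum x' y') : ℂ) = inner ℂ x x' + inner ℂ y y' := rfl

theorem osum_ext {x y : WithLp 2 (E × F)} (h₁ : x.fst = y.fst) (h₂ : x.snd = y.snd) : x = y :=
  WithLp.ofLp_injective 2 (Prod.ext h₁ h₂)

/-- With `half_smul_sub_add`, this verifies the solution of `i (â - b̂) = u`, `(â + b̂) / 2 = v`,
from which the witnesses for surjectivity in the triplets are taken. -/
theorem I_smul_sub_sub (u v : E) :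
    Complex.I • (v - (Complex.I / 2) • u - (v + (Complex.I / 2) • u)) = u := by
  have h : v - (Complex.I / 2) • u - (v + (Complex.I / 2) • u) = (-Complex.I) • u := by module
  rw [h, smul_smul, mul_neg, Complex.I_mul_I, neg_neg, one_smul]

theorem half_smul_sub_add (u v : E) :
    (1 / 2 : ℂ) • (v - (Complex.I / 2) • u + (v + (Complex.I / 2) • u)) = v := by
  module

end Osum

/-! ### From boundary maps on `dom t_max` to boundary triplets -/

namespace SymmetricSystem

variable {H Hh : Type*} [NormedAddCommGroup H] [InnerProductSpace ℂ H] [FiniteDimensional ℂ H]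
  [NormedAddCommGroup Hh] [InnerProductSpace ℂ Hh] [FiniteDimensional ℂ Hh]
  {S : SymmetricSystem H Hh} {Hb Hhb : Type*}
  [NormedAddCommGroup Hb] [InnerProductSpace ℂ Hb] [FiniteDimensional ℂ Hb]
  [NormedAddCommGroup Hhb] [InnerProductSpace ℂ Hhb] [FiniteDimensional ℂ Hhb]

/-- Gathers all the analysis: composition with the representative map moves the boundary maps to
`T_max`, so that only joint surjectivity and an algebraic identity for `boundaryForm` remain to be
checked in each case. -/
theorem exists_isBoundaryTriplet (hdef : S.IsDefinite) {α : ℤ} (hα : α = 1 ∨ α = -1)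
    {K : Type*} [NormedAddCommGroup K] [InnerProductSpace ℂ K] (K₁ : Submodule ℂ K)
    [K₁.HasOrthogonalProjection] (G₀ G₁ : S.dom →ₗ[ℂ] K) (hG₁ : ∀ y, G₁ y ∈ K₁)
    (hsurj : ∀ k, ∀ l ∈ K₁, ∃ y, G₀ y = k ∧ G₁ y = l)
    (hgreen : ∀ y z, S.boundaryForm y z = inner ℂ (G₀ z) (G₁ y) - inner ℂ (G₁ z) (G₀ y)
      + Complex.I * (α : ℂ) *
        inner ℂ (K₁ᗮ.starProjection (G₀ z)) (K₁ᗮ.starProjection (G₀ y))) :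
    ∃ (Γ₀ : S.Tmax →ₗ[ℂ] K) (Γ₁ : S.Tmax →ₗ[ℂ] K₁),
      S.Induces (fun f => Γ₀ f) G₀ ∧ S.Induces (fun f => (Γ₁ f : K)) G₁ ∧
        IsBoundaryTriplet α S.Tmin S.Tmax K₁ Γ₀ Γ₁ := by
  obtain ⟨ρ, hρ⟩ := exists_representative hdef
  refine ⟨G₀ ∘ₗ ρ, G₁.codRestrict K₁ hG₁ ∘ₗ ρ, fun p hp => ?_, fun p hp => ?_, hα,
    isClosed_Tmin hdef, (adjoint_Tmin hdef).symm ▸ Tmin_le_Tmax, (adjoint_Tmin hdef).symm,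
    ?_, fun f g => ?_⟩
  · exact congrArg G₀ (hρ p hp)
  · exact congrArg G₁ (hρ p hp)
  · rintro ⟨k, l, hl⟩
    obtain ⟨y, rfl, rfl⟩ := hsurj k l hl
    obtain ⟨f, rfl⟩ := representative_surjective hρ y
    exact ⟨f, rfl⟩
  · rw [inner_sub_inner_eq_boundaryForm hρ]
    exact hgreen _ _

theorem exists_isOrdinaryBoundaryTriplet (hdef : S.IsDefinite)
    {K : Type*} [NormedAddCommGroup K] [InnerProductSpace ℂ K] (G₀ G₁ : S.dom →ₗ[ℂ] K)
    (hsurj : ∀ k l, ∃ y, G₀ y = k ∧ G₁ y = l)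
    (hgreen : ∀ y z, S.boundaryForm y z = inner ℂ (G₀ z) (G₁ y) - inner ℂ (G₁ z) (G₀ y)) :
    ∃ Γ₀ Γ₁ : S.Tmax →ₗ[ℂ] K, S.Induces (fun f => Γ₀ f) G₀ ∧ S.Induces (fun f => Γ₁ f) G₁ ∧
      IsOrdinaryBoundaryTriplet S.Tmin S.Tmax Γ₀ Γ₁ := by
  obtain ⟨ρ, hρ⟩ := exists_representative hdef
  refine ⟨G₀ ∘ₗ ρ, G₁ ∘ₗ ρ, fun p hp => ?_, fun p hp => ?_,
    isClosed_Tmin hdef, (adjoint_Tmin hdef).symm ▸ Tmin_le_Tmax, (adjoint_Tmin hdef).symm,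
    ?_, fun f g => ?_⟩
  · exact congrArg G₀ (hρ p hp)
  · exact congrArg G₁ (hρ p hp)
  · rintro ⟨k, l⟩
    obtain ⟨y, rfl, rfl⟩ := hsurj k l
    obtain ⟨f, rfl⟩ := representative_surjective hρ y
    exact ⟨f, rfl⟩
  · rw [inner_sub_inner_eq_boundaryForm hρ]
    exact hgreen _ _

theorem starProjection_K1Case1_orthogonal (V : Hh →ₗᵢ[ℂ] Hhb) (x : K0Case1 H Hb V) :
    (K1Case1 H Hb V)ᗮ.starProjection x = osum 0 (osum 0 x.snd.snd) := by
  refine Submodule.eq_starProjection_of_mem_orthogonal'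
    (z := osum x.fst (osum x.snd.fst 0)) ?_ ?_ ?_
  · refine (Submodule.mem_orthogonal _ _).2 fun u hu => ?_
    have hu : u.snd.snd = 0 := hu
    simp [WithLp.prod_inner_apply, hu]
  · exact Submodule.le_orthogonal_orthogonal _ rfl
  · refine osum_ext ?_ (osum_ext ?_ ?_) <;> simp

theorem starProjection_K1Case2_orthogonal (V : Hhb →ₗᵢ[ℂ] Hh) (x : K0Case2 H Hb V) :
    (K1Case2 H Hb V)ᗮ.starProjection x = osum 0 (osum x.snd.fst 0) := by
  refine Submodule.eq_starProjection_of_mem_orthogonal'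
    (z := osum x.fst (osum 0 x.snd.snd)) ?_ ?_ ?_
  · refine (Submodule.mem_orthogonal _ _).2 fun u hu => ?_
    have hu : u.snd.fst = 0 := hu
    simp [WithLp.prod_inner_apply, hu]
  · exact Submodule.le_orthogonal_orthogonal _ rfl
  · refine osum_ext ?_ (osum_ext ?_ ?_) <;> simp

theorem starProjection_K1Case3_orthogonal (x : K0Case3 H Hh Hb Hhb) :
    (K1Case3 H Hh Hb Hhb)ᗮ.starProjection x = osum (osum 0 x.fst.snd) (osum 0 x.snd.snd) := by
  refine Submodule.eq_starProjection_of_mem_orthogonal'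
    (z := osum (osum x.fst.fst 0) (osum x.snd.fst 0)) ?_ ?_ ?_
  · refine (Submodule.mem_orthogonal _ _).2 fun u hu => ?_
    obtain ⟨hu, hu'⟩ : u.fst.snd = 0 ∧ u.snd.snd = 0 := hu
    simp [WithLp.prod_inner_apply, hu, hu']
  · exact Submodule.le_orthogonal_orthogonal _ ⟨rfl, rfl⟩
  · refine osum_ext (osum_ext ?_ ?_) (osum_ext ?_ ?_) <;> simp

end SymmetricSystem

/-! ### The three cases and the ordinary triplet -/

namespace SymmetricSystem

variable {H Hh : Type*} [NormedAddCommGroup H] [InnerProductSpace ℂ H] [FiniteDimensional ℂ H]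
  [NormedAddCommGroup Hh] [InnerProductSpace ℂ Hh] [FiniteDimensional ℂ Hh]
  {S : SymmetricSystem H Hh} {Hb Hhb : Type*}
  [NormedAddCommGroup Hb] [InnerProductSpace ℂ Hb] [FiniteDimensional ℂ Hb]
  [NormedAddCommGroup Hhb] [InnerProductSpace ℂ Hhb] [FiniteDimensional ℂ Hhb]
  {Γb : S.SingularBoundaryMap Hb Hhb} {Xa : BoldH H Hh →ₗ[ℂ] BoldH H Hh}

/-- The middle terms are `i (Γ̂_b, Γ̂_b) - i (Γ̂_a, Γ̂_a)`. The part of `Γ̂_b` in `Ĥ` forms with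
`Γ̂_a` a neutral pair, expressed through the difference and the mean of the two; the part in `H₂'`
is left over with sign `+i`, so `α = 1`. -/
theorem exists_isBoundaryTriplet_case1 (hdef : S.IsDefinite)
    (hXa : LinearMap.adjoint Xa ∘ₗ opJ H Hh ∘ₗ Xa = opJ H Hh) (hσ : Γb.HasSign 1)
    (V : Hh →ₗᵢ[ℂ] Hhb) :
    ∃ (Γ₀ : S.Tmax →ₗ[ℂ] K0Case1 H Hb V) (Γ₁ : S.Tmax →ₗ[ℂ] K1Case1 H Hb V),
      S.Induces (fun f => Γ₀ f) (S.G0Case1 Xa Γb V) ∧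
      S.Induces (fun f => (Γ₁ f : K0Case1 H Hb V)) (S.G1Case1 Xa Γb V) ∧
      IsBoundaryTriplet 1 S.Tmin S.Tmax (K1Case1 H Hb V) Γ₀ Γ₁ := by
  let A := LinearMap.adjoint V.toLinearMap
  let P := (complRange V).orthogonalProjectionOnto.toLinearMap
  let G₀ : S.dom →ₗ[ℂ] K0Case1 H Hb V :=
    osumMap (osumMap (-S.Ga1Map Xa) (Complex.I • (S.GahMap Xa - A ∘ₗ Γb.Gh)))
      (osumMap Γb.G0 (P ∘ₗ Γb.Gh))
  let G₁ : S.dom →ₗ[ℂ] K0Case1 H Hb V :=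
    osumMap (osumMap (S.Ga0Map Xa) ((1 / 2 : ℂ) • (S.GahMap Xa + A ∘ₗ Γb.Gh)))
      (osumMap (-Γb.G1) 0)
  refine exists_isBoundaryTriplet hdef (.inl rfl) _ G₀ G₁ (fun y => rfl) ?_ ?_
  · intro k l hl
    have hl : l.snd.snd = 0 := hl
    -- `q` is to be the `Ĥ`-part of `Γ̂_b y`; together with `Γ̂_a y = l.fst.snd - (i/2) k.fst.snd`
    -- it has the prescribed difference and mean.
    let q : Hh := l.fst.snd + (Complex.I / 2) • k.fst.snd
    obtain ⟨y, h1, h2, h3, h4, h5, h6⟩ := Γb.exists_boundary_values hdef hXa l.fst.fst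
      (l.fst.snd - (Complex.I / 2) • k.fst.snd) (-k.fst.fst) k.snd.fst
      (V q + (k.snd.snd : Hhb)) (-l.snd.fst)
    have hA : A (V q + (k.snd.snd : Hhb)) = q := by
      rw [map_add, V.adjoint_apply_self, V.adjoint_apply_eq_zero, add_zero]
    have hP : P (V q + (k.snd.snd : Hhb)) = k.snd.snd := by
      change (complRange V).orthogonalProjectionOnto (V q + (k.snd.snd : Hhb)) = _
      rw [map_add, V.orthogonalProjectionOnto_apply, zero_add,
        Submodule.orthogonalProjectionOnto_mem_subspace_eq_self]
    refine ⟨y, ?_, ?_⟩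
    · change osum (osum (-S.Ga1Map Xa y) (Complex.I • (S.GahMap Xa y - A (Γb.Gh y))))
        (osum (Γb.G0 y) (P (Γb.Gh y))) = k
      rw [h2, h3, h4, h5, hA, hP, neg_neg, I_smul_sub_sub]
      rfl
    · change osum (osum (S.Ga0Map Xa y) ((1 / 2 : ℂ) • (S.GahMap Xa y + A (Γb.Gh y))))
        (osum (-Γb.G1 y) 0) = l
      rw [h1, h2, h5, h6, hA, neg_neg, ← hl, half_smul_sub_add]
      rfl
  · intro y z
    rw [hσ.boundaryForm_eq hXa, starProjection_K1Case1_orthogonal,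
      starProjection_K1Case1_orthogonal, V.inner_eq_adjoint_add]
    change _ = inner ℂ
      (osum (osum (-S.Ga1Map Xa z) (Complex.I • (S.GahMap Xa z - A (Γb.Gh z))))
        (osum (Γb.G0 z) (P (Γb.Gh z))))
      (osum (osum (S.Ga0Map Xa y) ((1 / 2 : ℂ) • (S.GahMap Xa y + A (Γb.Gh y))))
        (osum (-Γb.G1 y) 0)) - inner ℂ
      (osum (osum (S.Ga0Map Xa z) ((1 / 2 : ℂ) • (S.GahMap Xa z + A (Γb.Gh z))))
        (osum (-Γb.G1 z) 0))
      (osum (osum (-S.Ga1Map Xa y) (Complex.I • (S.GahMap Xa y - A (Γb.Gh y))))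
        (osum (Γb.G0 y) (P (Γb.Gh y)))) +
      _ * inner ℂ (osum 0 (osum 0 (P (Γb.Gh z)))) (osum 0 (osum 0 (P (Γb.Gh y))))
    simp only [inner_osum, inner_smul_left, inner_smul_right, inner_sub_left, inner_sub_right,
      inner_add_left, inner_add_right, inner_neg_left, inner_neg_right, inner_zero_left,
      inner_zero_right, Complex.conj_I, map_div₀, map_one, map_ofNat, Int.cast_one]
    change _ * (inner ℂ (A (Γb.Gh z)) (A (Γb.Gh y)) + inner ℂ (P (Γb.Gh z)) (P (Γb.Gh y))) - _ + _
      + _ - _ - _ = _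
    ring

/-- The roles are reversed: `Γ̂_b` is neutralized by a part of `Γ̂_a`, and the remaining part of
`Γ̂_a` keeps its sign `-i`, so `α = -1`. -/
theorem exists_isBoundaryTriplet_case2 (hdef : S.IsDefinite)
    (hXa : LinearMap.adjoint Xa ∘ₗ opJ H Hh ∘ₗ Xa = opJ H Hh) (hσ : Γb.HasSign 1)
    (V : Hhb →ₗᵢ[ℂ] Hh) :
    ∃ (Γ₀ : S.Tmax →ₗ[ℂ] K0Case2 H Hb V) (Γ₁ : S.Tmax →ₗ[ℂ] K1Case2 H Hb V),
      S.Induces (fun f => Γ₀ f) (S.G0Case2 Xa Γb V) ∧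
      S.Induces (fun f => (Γ₁ f : K0Case2 H Hb V)) (S.G1Case2 Xa Γb V) ∧
      IsBoundaryTriplet (-1) S.Tmin S.Tmax (K1Case2 H Hb V) Γ₀ Γ₁ := by
  let A := LinearMap.adjoint V.toLinearMap
  let P := (complRange V).orthogonalProjectionOnto.toLinearMap
  let G₀ : S.dom →ₗ[ℂ] K0Case2 H Hb V :=
    osumMap (osumMap (-S.Ga1Map Xa) (Complex.I • (A ∘ₗ S.GahMap Xa - Γb.Gh)))
      (osumMap (Complex.I • P ∘ₗ S.GahMap Xa) Γb.G0)
  let G₁ : S.dom →ₗ[ℂ] K0Case2 H Hb V :=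
    osumMap (osumMap (S.Ga0Map Xa) ((1 / 2 : ℂ) • (A ∘ₗ S.GahMap Xa + Γb.Gh)))
      (osumMap 0 (-Γb.G1))
  refine exists_isBoundaryTriplet hdef (.inr rfl) _ G₀ G₁ (fun y => rfl) ?_ ?_
  · intro k l hl
    have hl : l.snd.fst = 0 := hl
    let q : Hhb := l.fst.snd - (Complex.I / 2) • k.fst.snd
    -- The factor `-i` undoes the `i` in front of `P_{H₂'} Γ̂_a`.
    let r : complRange V := (-Complex.I) • k.snd.fst
    obtain ⟨y, h1, h2, h3, h4, h5, h6⟩ := Γb.exists_boundary_values hdef hXa l.fst.fst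
      (V q + (r : Hh)) (-k.fst.fst) k.snd.snd (l.fst.snd + (Complex.I / 2) • k.fst.snd)
      (-l.snd.snd)
    have hA : A (V q + (r : Hh)) = q := by
      rw [map_add, V.adjoint_apply_self, V.adjoint_apply_eq_zero, add_zero]
    have hP : P (V q + (r : Hh)) = r := by
      change (complRange V).orthogonalProjectionOnto (V q + (r : Hh)) = _
      rw [map_add, V.orthogonalProjectionOnto_apply, zero_add,
        Submodule.orthogonalProjectionOnto_mem_subspace_eq_self]
    have hr : Complex.I • r = k.snd.fst := by
      rw [smul_smul, mul_neg, Complex.I_mul_I, neg_neg, one_smul]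
    refine ⟨y, ?_, ?_⟩
    · change osum (osum (-S.Ga1Map Xa y) (Complex.I • (A (S.GahMap Xa y) - Γb.Gh y)))
        (osum (Complex.I • P (S.GahMap Xa y)) (Γb.G0 y)) = k
      rw [h2, h3, h4, h5, hA, hP, hr, neg_neg, I_smul_sub_sub]
      rfl
    · change osum (osum (S.Ga0Map Xa y) ((1 / 2 : ℂ) • (A (S.GahMap Xa y) + Γb.Gh y)))
        (osum 0 (-Γb.G1 y)) = l
      rw [h1, h2, h5, h6, hA, neg_neg, ← hl, half_smul_sub_add]
      rfl
  · intro y z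
    rw [hσ.boundaryForm_eq hXa, starProjection_K1Case2_orthogonal,
      starProjection_K1Case2_orthogonal, V.inner_eq_adjoint_add (S.GahMap Xa z)]
    change _ = inner ℂ
      (osum (osum (-S.Ga1Map Xa z) (Complex.I • (A (S.GahMap Xa z) - Γb.Gh z)))
        (osum (Complex.I • P (S.GahMap Xa z)) (Γb.G0 z)))
      (osum (osum (S.Ga0Map Xa y) ((1 / 2 : ℂ) • (A (S.GahMap Xa y) + Γb.Gh y)))
        (osum 0 (-Γb.G1 y))) - inner ℂ
      (osum (osum (S.Ga0Map Xa z) ((1 / 2 : ℂ) • (A (S.GahMap Xa z) + Γb.Gh z)))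
        (osum 0 (-Γb.G1 z)))
      (osum (osum (-S.Ga1Map Xa y) (Complex.I • (A (S.GahMap Xa y) - Γb.Gh y)))
        (osum (Complex.I • P (S.GahMap Xa y)) (Γb.G0 y))) +
      _ * inner ℂ (osum 0 (osum (Complex.I • P (S.GahMap Xa z)) 0))
        (osum 0 (osum (Complex.I • P (S.GahMap Xa y)) 0))
    simp only [inner_osum, inner_smul_left, inner_smul_right, inner_sub_left, inner_sub_right,
      inner_add_left, inner_add_right, inner_neg_left, inner_neg_right, inner_zero_left,
      inner_zero_right, Complex.conj_I, map_div₀, map_one, map_ofNat, Int.cast_one, Int.cast_neg]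
    change _ - _ + _ + _ - _ - _ * (inner ℂ (A (S.GahMap Xa z)) (A (S.GahMap Xa y)) +
      inner ℂ (P (S.GahMap Xa z)) (P (S.GahMap Xa y))) = _
    linear_combination (-Complex.I * inner ℂ (P (S.GahMap Xa z)) (P (S.GahMap Xa y))) *
      Complex.I_mul_I

/-- Both middle terms carry the sign `-i`, so no neutral pair arises and all of `Ĥ ⊕ Ĥ_b` goes into
the complement of `𝓗₁`, with `α = -1`. -/
theorem exists_isBoundaryTriplet_case3 (hdef : S.IsDefinite)
    (hXa : LinearMap.adjoint Xa ∘ₗ opJ H Hh ∘ₗ Xa = opJ H Hh) (hσ : Γb.HasSign (-1)) :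
    ∃ (Γ₀ : S.Tmax →ₗ[ℂ] K0Case3 H Hh Hb Hhb) (Γ₁ : S.Tmax →ₗ[ℂ] K1Case3 H Hh Hb Hhb),
      S.Induces (fun f => Γ₀ f) (S.G0Case3 Xa Γb) ∧
      S.Induces (fun f => (Γ₁ f : K0Case3 H Hh Hb Hhb)) (S.G1Case3 Xa Γb) ∧
      IsBoundaryTriplet (-1) S.Tmin S.Tmax (K1Case3 H Hh Hb Hhb) Γ₀ Γ₁ := by
  let G₀ : S.dom →ₗ[ℂ] K0Case3 H Hh Hb Hhb :=
    osumMap (osumMap (-S.Ga1Map Xa) (Complex.I • S.GahMap Xa)) (osumMap Γb.G0 Γb.Gh)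
  let G₁ : S.dom →ₗ[ℂ] K0Case3 H Hh Hb Hhb :=
    osumMap (osumMap (S.Ga0Map Xa) 0) (osumMap (-Γb.G1) 0)
  refine exists_isBoundaryTriplet hdef (.inr rfl) _ G₀ G₁ (fun y => ⟨rfl, rfl⟩) ?_ ?_
  · intro k l hl
    obtain ⟨hl, hl'⟩ : l.fst.snd = 0 ∧ l.snd.snd = 0 := hl
    obtain ⟨y, h1, h2, h3, h4, h5, h6⟩ := Γb.exists_boundary_values hdef hXa l.fst.fst
      ((-Complex.I) • k.fst.snd) (-k.fst.fst) k.snd.fst k.snd.snd (-l.snd.fst)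
    refine ⟨y, ?_, ?_⟩
    · change osum (osum (-S.Ga1Map Xa y) (Complex.I • S.GahMap Xa y))
        (osum (Γb.G0 y) (Γb.Gh y)) = k
      rw [h2, h3, h4, h5, neg_neg, smul_smul, mul_neg, Complex.I_mul_I, neg_neg, one_smul]
      rfl
    · change osum (osum (S.Ga0Map Xa y) 0) (osum (-Γb.G1 y) 0) = l
      rw [h1, h6, neg_neg, ← hl, ← hl']
      rfl
  · intro y z
    rw [hσ.boundaryForm_eq hXa, starProjection_K1Case3_orthogonal,
      starProjection_K1Case3_orthogonal]
    change _ = inner ℂ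
      (osum (osum (-S.Ga1Map Xa z) (Complex.I • S.GahMap Xa z)) (osum (Γb.G0 z) (Γb.Gh z)))
      (osum (osum (S.Ga0Map Xa y) 0) (osum (-Γb.G1 y) 0)) - inner ℂ
      (osum (osum (S.Ga0Map Xa z) 0) (osum (-Γb.G1 z) 0))
      (osum (osum (-S.Ga1Map Xa y) (Complex.I • S.GahMap Xa y)) (osum (Γb.G0 y) (Γb.Gh y))) +
      _ * inner ℂ (osum (osum 0 (Complex.I • S.GahMap Xa z)) (osum 0 (Γb.Gh z)))
        (osum (osum 0 (Complex.I • S.GahMap Xa y)) (osum 0 (Γb.Gh y)))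
    simp only [inner_osum, inner_smul_left, inner_smul_right, inner_neg_left, inner_neg_right,
      inner_zero_left, inner_zero_right, Complex.conj_I, Int.cast_one, Int.cast_neg]
    linear_combination (-Complex.I * inner ℂ (S.GahMap Xa z) (S.GahMap Xa y)) * Complex.I_mul_I

/-- When `Ĥ` and `Ĥ_b` are isometric the two middle terms neutralize each other completely and no
`P₂` term survives. -/
theorem exists_isOrdinaryBoundaryTriplet_of_equiv (hdef : S.IsDefinite)
    (hXa : LinearMap.adjoint Xa ∘ₗ opJ H Hh ∘ₗ Xa = opJ H Hh) (hσ : Γb.HasSign 1)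
    (V : Hh ≃ₗᵢ[ℂ] Hhb) :
    ∃ Γ₀ Γ₁ : S.Tmax →ₗ[ℂ] WithLp 2 (SpaceH₀ H Hh × Hb),
      S.Induces (fun f => Γ₀ f) (S.G0Ord Xa Γb V) ∧
      S.Induces (fun f => Γ₁ f) (S.G1Ord Xa Γb V) ∧
      IsOrdinaryBoundaryTriplet S.Tmin S.Tmax Γ₀ Γ₁ := by
  let A : Hhb →ₗ[ℂ] Hh := V.symm.toLinearEquiv.toLinearMap
  let G₀ : S.dom →ₗ[ℂ] WithLp 2 (SpaceH₀ H Hh × Hb) :=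
    osumMap (osumMap (-S.Ga1Map Xa) (Complex.I • (S.GahMap Xa - A ∘ₗ Γb.Gh))) Γb.G0
  let G₁ : S.dom →ₗ[ℂ] WithLp 2 (SpaceH₀ H Hh × Hb) :=
    osumMap (osumMap (S.Ga0Map Xa) ((1 / 2 : ℂ) • (S.GahMap Xa + A ∘ₗ Γb.Gh))) (-Γb.G1)
  refine exists_isOrdinaryBoundaryTriplet hdef G₀ G₁ ?_ ?_
  · intro k l
    obtain ⟨y, h1, h2, h3, h4, h5, h6⟩ := Γb.exists_boundary_values hdef hXa l.fst.fst
      (l.fst.snd - (Complex.I / 2) • k.fst.snd) (-k.fst.fst) k.snd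
      (V (l.fst.snd + (Complex.I / 2) • k.fst.snd)) (-l.snd)
    refine ⟨y, ?_, ?_⟩
    · change osum (osum (-S.Ga1Map Xa y) (Complex.I • (S.GahMap Xa y - V.symm (Γb.Gh y))))
        (Γb.G0 y) = k
      rw [h2, h3, h4, h5, V.symm_apply_apply, neg_neg, I_smul_sub_sub]
      rfl
    · change osum (osum (S.Ga0Map Xa y) ((1 / 2 : ℂ) • (S.GahMap Xa y + V.symm (Γb.Gh y))))
        (-Γb.G1 y) = l
      rw [h1, h2, h5, h6, V.symm_apply_apply, neg_neg, half_smul_sub_add]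
      rfl
  · intro y z
    rw [hσ.boundaryForm_eq hXa, ← V.symm.inner_map_map]
    change _ = inner ℂ
      (osum (osum (-S.Ga1Map Xa z) (Complex.I • (S.GahMap Xa z - V.symm (Γb.Gh z)))) (Γb.G0 z))
      (osum (osum (S.Ga0Map Xa y) ((1 / 2 : ℂ) • (S.GahMap Xa y + V.symm (Γb.Gh y))))
        (-Γb.G1 y)) - inner ℂ
      (osum (osum (S.Ga0Map Xa z) ((1 / 2 : ℂ) • (S.GahMap Xa z + V.symm (Γb.Gh z))))
        (-Γb.G1 z))
      (osum (osum (-S.Ga1Map Xa y) (Complex.I • (S.GahMap Xa y - V.symm (Γb.Gh y)))) (Γb.G0 y))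
    simp only [inner_osum, inner_smul_left, inner_smul_right, inner_sub_left, inner_sub_right,
      inner_add_left, inner_add_right, inner_neg_left, inner_neg_right, Complex.conj_I, map_div₀,
      map_one, map_ofNat, Int.cast_one]
    ring

theorem complRange_eq_bot (h : Module.finrank ℂ Hh = Module.finrank ℂ Hhb)
    (V : Hh →ₗᵢ[ℂ] Hhb) : complRange V = ⊥ := by
  have hs : Function.Surjective V.toLinearMap :=
    (LinearMap.injective_iff_surjective_of_finrank_eq_finrank h).1 V.injective
  rw [complRange, LinearMap.range_eq_top.2 hs, Submodule.top_orthogonal_eq_bot]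

theorem K1Case1_eq_top {V : Hh →ₗᵢ[ℂ] Hhb} (h : complRange V = ⊥) : K1Case1 H Hb V = ⊤ :=
  eq_top_iff.2 fun x _ => Subtype.ext ((Submodule.eq_bot_iff _).1 h _ x.snd.snd.2)

end SymmetricSystem

end

/-! ### The main statement -/

theorem proposition3p3
    {H Hh Hb Hhb : Type*}
    [NormedAddCommGroup H] [InnerProductSpace ℂ H] [FiniteDimensional ℂ H]
    [NormedAddCommGroup Hh] [InnerProductSpace ℂ Hh] [FiniteDimensional ℂ Hh]
    [NormedAddCommGroup Hb] [InnerProductSpace ℂ Hb] [FiniteDimensional ℂ Hb]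
    [NormedAddCommGroup Hhb] [InnerProductSpace ℂ Hhb] [FiniteDimensional ℂ Hhb]
    (S : SymmetricSystem H Hh) (hdef : S.IsDefinite)
    (Xa : BoldH H Hh →ₗ[ℂ] BoldH H Hh)
    (hXa : LinearMap.adjoint Xa ∘ₗ opJ H Hh ∘ₗ Xa = opJ H Hh)
    (Γb : S.SingularBoundaryMap Hb Hhb) :
    (S.Case1 → Module.finrank ℂ Hh ≤ Module.finrank ℂ Hhb ∧
      ∀ V : Hh →ₗᵢ[ℂ] Hhb,
        ∃ (Γ₀ : S.Tmax →ₗ[ℂ] SymmetricSystem.K0Case1 H Hb V)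
          (Γ₁ : S.Tmax →ₗ[ℂ] SymmetricSystem.K1Case1 H Hb V),
          S.Induces (fun f => Γ₀ f) (S.G0Case1 Xa Γb V) ∧
          S.Induces (fun f => (Γ₁ f : SymmetricSystem.K0Case1 H Hb V)) (S.G1Case1 Xa Γb V) ∧
          IsBoundaryTriplet 1 S.Tmin S.Tmax (SymmetricSystem.K1Case1 H Hb V) Γ₀ Γ₁) ∧
    (S.Case2 → Module.finrank ℂ Hhb < Module.finrank ℂ Hh ∧
      ∀ V : Hhb →ₗᵢ[ℂ] Hh,
        ∃ (Γ₀ : S.Tmax →ₗ[ℂ] SymmetricSystem.K0Case2 H Hb V)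
          (Γ₁ : S.Tmax →ₗ[ℂ] SymmetricSystem.K1Case2 H Hb V),
          S.Induces (fun f => Γ₀ f) (S.G0Case2 Xa Γb V) ∧
          S.Induces (fun f => (Γ₁ f : SymmetricSystem.K0Case2 H Hb V)) (S.G1Case2 Xa Γb V) ∧
          IsBoundaryTriplet (-1) S.Tmin S.Tmax (SymmetricSystem.K1Case2 H Hb V) Γ₀ Γ₁) ∧
    (S.Case3 →
        ∃ (Γ₀ : S.Tmax →ₗ[ℂ] SymmetricSystem.K0Case3 H Hh Hb Hhb)
          (Γ₁ : S.Tmax →ₗ[ℂ] SymmetricSystem.K1Case3 H Hh Hb Hhb),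
          S.Induces (fun f => Γ₀ f) (S.G0Case3 Xa Γb) ∧
          S.Induces (fun f => (Γ₁ f : SymmetricSystem.K0Case3 H Hh Hb Hhb)) (S.G1Case3 Xa Γb) ∧
          IsBoundaryTriplet (-1) S.Tmin S.Tmax (SymmetricSystem.K1Case3 H Hh Hb Hhb) Γ₀ Γ₁) ∧
    (deficiencyPlus S.Tmin = deficiencyMinus S.Tmin →
      S.Case1 ∧ Module.finrank ℂ Hh = Module.finrank ℂ Hhb ∧
      (∀ V : Hh →ₗᵢ[ℂ] Hhb, SymmetricSystem.complRange V = ⊥ ∧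
        SymmetricSystem.K1Case1 H Hb V = ⊤) ∧
      ∀ V : Hh ≃ₗᵢ[ℂ] Hhb,
        ∃ Γ₀ Γ₁ : S.Tmax →ₗ[ℂ] WithLp 2 (SpaceH₀ H Hh × Hb),
          S.Induces (fun f => Γ₀ f) (S.G0Ord Xa Γb V) ∧
          S.Induces (fun f => Γ₁ f) (S.G1Ord Xa Γb V) ∧
          IsOrdinaryBoundaryTriplet S.Tmin S.Tmax Γ₀ Γ₁) := by
  refine ⟨fun h => ⟨Γb.finrank_le_of_case1 h, fun V => ?_⟩,
    fun h => ⟨Γb.finrank_lt_of_case2 h, fun V => ?_⟩, fun h => ?_, fun h => ?_⟩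
  · exact SymmetricSystem.exists_isBoundaryTriplet_case1 hdef hXa
      (Γb.hasSign_one (le_self_add.trans h)) V
  · exact SymmetricSystem.exists_isBoundaryTriplet_case2 hdef hXa (Γb.hasSign_one h.2.le) V
  · exact SymmetricSystem.exists_isBoundaryTriplet_case3 hdef hXa (Γb.hasSign_neg_one h.1)
  · obtain ⟨h1, h2⟩ := Γb.case1_of_deficiency_eq hdef hXa h
    refine ⟨h1, h2, fun V => ?_, fun V => ?_⟩
    · have hV := SymmetricSystem.complRange_eq_bot h2 V
      exact ⟨hV, SymmetricSystem.K1Case1_eq_top hV⟩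
    · exact SymmetricSystem.exists_isOrdinaryBoundaryTriplet_of_equiv hdef hXa
        (Γb.hasSign_one (le_self_add.trans h1)) V
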